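/- **Setting.** For every $n$ let $X=AZ+E\in\mathbb R^p$ be a factor model with $p=p_n$, $K=K_n\ge1$ factors, $\operatorname{rank}A=K$, centered square-integrable $Z\in\mathbb R^K$ and $E\in\mathbb R^p$, uncorrelated with each other, $\mathbb E[EE^\top]$ diagonal with positive diagonal, and $\Sigma_Z=\mathbb E[ZZ^\top]$ of rank $K$ with unit diagonal. Let $\Sigma=\operatorname{Cov}(X)$, $R$ the correlation matrix of $X$, and $B=D_\Sigma^{-1/2}A$ with $D_\Sigma=\operatorname{diag}(\Sigma_{11},\dots,\Sigma_{pp})$. Let $I_k$ be the set of indices $i$ with $A_{ik}\neq0$ and $A_{ik'}=0$ for all $k'\ne k$ (pure variables), $\mathcal I=\{I_1,\dots,I_K\}$, $I=\bigcup_kI_k$, $J=[p]\setminus I$, and $\xi_k=\max_{i\in I_k}\|A_{i\cdot}\|_1$. Fix $1\le q\le\infty$ and put, for $i\ne j$, $$S_q(i,j)=(p-2)^{-1/q}\min_{\|(a,b)\|_\infty=1}\big\|aR_{i,\setminus\{i,j\}}+bR_{j,\setminus\{i,j\}}\big\|_q ,\qquad \delta_n=c_\delta\sqrt{\log(p\vee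 n)/n},$$ where $R_{i,\setminus\{i,j\}}$ is the $i$-th row of $R$ without its entries in columns $i,j$, and $$\bar J_1=\{j\in J:\ S_q(j,\ell)\le4\delta_n\text{ for some }\ell\in J\setminus\{j\}\}.$$ **Procedure.** From $n$ i.i.d. copies of $X$, collected in $\mathbf X\in\mathbb R^{n\times p}$, form $\widehat\Sigma=\mathbf X^\top\mathbf X/n$ and the sample correlation matrix $\widehat R$, and let $\widehat S_q$ be $S_q$ computed from $\widehat R$. (a) *Groups.* Start with $\widehat{\mathcal H}=\emptyset$ and visit the pairs $i<j$ in lexicographic order. Whenever $\widehat S_q(i,j)\le2\delta_n$, replace every $g\in\widehat{\mathcal H}$ that meets $\{i,j\}$ by $g\cup\{i,j\}$, or add the new group $\{i,j\}$ if there is no such $g$. Let $\widehat G=|\widehat{\mathcal H}|$ and $\widehat H=\bigcup_{g\in\widehat{\mathcal H}}g$. (b) *Denoising.* For $i$ in a group $g\in\widehat{\mathcal H}$ let $\hat\jmath$ minimize $\widehat S_2(i,\ell)$ over $\ell\in g\setminus\{i\}$; let $\widehat M_{ii}=|\widehat R_{i\hat\jmath}|\,\|\widehat R_{i,\setminus\{i,\hat\jmath\}}\|_2/\|\widehat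 R_{\hat\jmath,\setminus\{i,\hat\jmath\}}\|_2$, and $\widehat M_{ij}=\widehat R_{ij}$ for $i\neq j$. Let $\widehat\Theta=\widehat\Sigma-\widehat D^{1/2}\widehat\Gamma\widehat D^{1/2}$ on $\widehat H\times\widehat H$, with $\widehat\Gamma=\operatorname{diag}(1-\widehat M_{ii})$ and $\widehat D=\operatorname{diag}(\widehat\Sigma_{ii})$. (c) *Pruning with $r$.* If $r<\widehat G$, choose $i_1,\dots,i_r$ successively so that $i_k$ maximizes $\widehat\Theta_{jj|S_k}=\widehat\Theta_{jj}-\widehat\Theta_{jS_k}\widehat\Theta_{S_kS_k}^{-}\widehat\Theta_{S_kj}$ over $j\in\widehat H$, with $S_k=\{i_1,\dots,i_{k-1}\}$ and $^-$ the Moore–Penrose inverse; return $\widehat{\mathcal I}=\{g\in\widehat{\mathcal H}:\ i_a\in g\text{ for some }a\le r\}$. If $r\ge\widehat G$, return $\widehat{\mathcal I}=\widehat{\mathcal H}$. (d) *Number of factors.* In every $g\in\widehat{\mathcal H}$ choose a representative maximizing $\|\widehat R_{i,\setminus\{i\}}\|_2$ over $i\in g$; let $\widehat L$ be the set of representatives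 and $\widehat K=\max\{k\in[\widehat G]:\lambda_k(\widehat M_{\widehat L\widehat L})\ge\mu\}$ ($\widehat K=0$ if there is no such $k$), where $\lambda_k$ is the $k$-th largest eigenvalue. All ties are broken arbitrarily. **Theorem.** For every $\gamma>0$ there is $c_0(\gamma)$ such that the following holds for every constant $c_\delta>0$ with $c_\delta\ge c_0(\gamma)$, every $1\le q\le\infty$ and all constants $0<c\le C<\infty$. Assume that, for all large $n$: * every $I_k$ has at least two elements, and $\Sigma^{-1/2}X$ is $\gamma$-sub-Gaussian, i.e. $\mathbb E\exp(u^\top\Sigma^{-1/2}X)\le\exp(\|u\|_2^2\gamma^2/2)$ for all $u\in\mathbb R^p$; * $S_q(i,j)>4\delta_n$ for all $i\in I$ and all $j$ that are not in the same group $I_k$ as $i$; * $\min(c_{b,I},c_z,c_r)>c$ and $\lambda_1(\Sigma_Z)\le C$, where $c_{b,I}=\min_{j\in I\cup\bar J_1}\|B_{j\cdot}\|_2^2$, $c_z=\lambda_K(\Sigma_Z)$ and $c_r=\min_{i\neq j}\frac1{p-2}\lambda_K\big(B_{\setminus\{i,j\}\cdot}\Sigma_ZB_{\setminus\{i,j\}\cdot}^\top\big)$;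 * if $\bar J_1\ne\emptyset$, then $$\text{(i)}\ \max_k\xi_k\le C_0\min_k\xi_k\qquad\text{and}\qquad\text{(ii)}\ \max_{j\in\bar J_1}\Big(\sum_{k=1}^K|A_{jk}|/\xi_k\Big)^2<1-\varepsilon,$$ with constants $0<C_0<\infty$ and $0<\varepsilon<1$. Assume also that $K\delta_n^2\to0$. Then: 1. For any (possibly random) $r$ with $1\le r\le K$, the procedure with $r$ returns exactly $r$ groups of the partition $\mathcal I$ with probability tending to one: $\widehat{\mathcal I}=\{I_{\pi(1)},\dots,I_{\pi(r)}\}$ for some permutation $\pi$ of $[K]$. Here, if $r$ can take a value with $1<r<K$, (i) is assumed also when $\bar J_1=\emptyset$. 2. There is $C_1>0$ depending only on $q,\gamma,c_\delta,c,C$ such that, for every $C'\ge C_1$ and $\mu=C'\big(\sqrt{K\delta_n^2}+K\delta_n^2+|\bar J_1|\delta_n\big)$, with probability tending to one $\widehat K\le K$ and the procedure with $r=\widehat K$ returns exactly $\widehat K$ groups of $\mathcal I$. If moreover $|\bar J_1|\delta_n\to0$, then with probability tending to one $\widehat K=K$ and $\widehat{\mathcal I}=\mathcal I$. -/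

import Mathlib

open MeasureTheory ProbabilityTheory Filter Topology Matrix
open scoped ENNReal

noncomputable section

namespace PureVar

/-! ### Linear algebra -/

/-- The four Penrose equations: `N` is the Moore-Penrose inverse of the real square matrix `M`. -/
def IsMoorePenrose {ι : Type*} [Fintype ι] (M N : Matrix ι ι ℝ) : Prop :=
  M * N * M = M ∧ N * M * N = N ∧ (M * N)ᵀ = M * N ∧ (N * M)ᵀ = N * M

theorem IsMoorePenrose.unique {ι : Type*} [Fintype ι] {M N N' : Matrix ι ι ℝ}
    (h : IsMoorePenrose M N) (h' : IsMoorePenrose M N') : N = N' := by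
  obtain ⟨h1, h2, h3, h4⟩ := h
  obtain ⟨k1, k2, k3, k4⟩ := h'
  have e1 : M * N = M * N' :=
    calc M * N = (M * N)ᵀ := h3.symm
      _ = (M * N' * (M * N))ᵀ := by rw [← Matrix.mul_assoc, k1]
      _ = M * N * (M * N') := by rw [Matrix.transpose_mul, h3, k3]
      _ = M * N' := by rw [← Matrix.mul_assoc, h1]
  have e2 : N * M = N' * M :=
    calc N * M = (N * M)ᵀ := h4.symm
      _ = (N * M * (N' * M))ᵀ := by
          rw [Matrix.mul_assoc, ← Matrix.mul_assoc M, k1]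
      _ = N' * M * (N * M) := by rw [Matrix.transpose_mul, h4, k4]
      _ = N' * M := by rw [Matrix.mul_assoc, ← Matrix.mul_assoc M, h1]
  calc N = N * M * N := h2.symm
    _ = N' * (M * N) := by rw [e2, Matrix.mul_assoc]
    _ = N' := by rw [e1, ← Matrix.mul_assoc, k2]

/-- Symmetric matrices (the only ones to which it is applied) have a Moore-Penrose inverse. -/
theorem exists_isMoorePenrose {ι : Type*} [Fintype ι] [DecidableEq ι] {M : Matrix ι ι ℝ}
    (hM : M.IsHermitian) : ∃ N, IsMoorePenrose M N := by
  have hs : IsSelfAdjoint M := hM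
  have hc : ∀ f : ℝ → ℝ, ContinuousOn f (spectrum ℝ M) := fun f =>
    (Matrix.finite_real_spectrum (A := M)).continuousOn f
  have hid : cfc (fun x : ℝ => x) M = M := cfc_id' ℝ M
  have hsym : ∀ f : ℝ → ℝ, (cfc f M)ᵀ = cfc f M := fun f => by
    have : IsSelfAdjoint (cfc f M) := cfc_predicate f M
    simpa [IsSelfAdjoint, Matrix.star_eq_conjTranspose] using this
  have hmul : ∀ f g : ℝ → ℝ, cfc f M * cfc g M = cfc (fun x => f x * g x) M := fun f g =>
    (cfc_mul f g M (hc f) (hc g)).symm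
  have a1 : M * cfc (fun x : ℝ => x⁻¹) M = cfc (fun x : ℝ => x * x⁻¹) M := by
    conv_lhs => arg 1; rw [← hid]
    exact hmul _ _
  have a2 : cfc (fun x : ℝ => x⁻¹) M * M = cfc (fun x : ℝ => x⁻¹ * x) M := by
    conv_lhs => arg 2; rw [← hid]
    exact hmul _ _
  refine ⟨cfc (fun x : ℝ => x⁻¹) M, ?_, ?_, ?_, ?_⟩
  · rw [a1]
    conv_lhs => arg 2; rw [← hid]
    rw [hmul]
    conv_rhs => rw [← hid]
    congr 1
    funext x
    by_cases hx : x = 0 <;> simp [hx]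
  · rw [a2, hmul]
    congr 1
    funext x
    by_cases hx : x = 0 <;> simp [hx]
  · rw [a1, hsym]
  · rw [a2, hsym]

open Classical in
/-- The Moore-Penrose inverse. -/
def pinv {ι : Type*} [Fintype ι] (M : Matrix ι ι ℝ) : Matrix ι ι ℝ :=
  if h : ∃ N, IsMoorePenrose M N then h.choose else 0

open Classical in
/-- `kthEig M k` is `λ_k(M)`, the `k`-th largest eigenvalue (with multiplicity, `1 ≤ k`) of the
symmetric matrix `M`; it is `0` when there is no such eigenvalue. -/
def kthEig {ι : Type*} [Fintype ι] [DecidableEq ι] (M : Matrix ι ι ℝ) (k : ℕ) : ℝ :=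
  if h : M.IsHermitian ∧ 1 ≤ k ∧ k ≤ Fintype.card ι then
    h.1.eigenvalues₀ ⟨k - 1, by have := h.2; omega⟩
  else 0

/-- `M^{-1/2}` for a symmetric positive definite matrix `M`, through its spectral decomposition. -/
def invSqrt {p : ℕ} (M : Matrix (Fin p) (Fin p) ℝ) : Matrix (Fin p) (Fin p) ℝ :=
  cfc (fun x : ℝ => (√x)⁻¹) M

/-- The `ℓ_q` norm of a finite real vector, `1 ≤ q ≤ ∞`. -/
def lqNorm {ι : Type*} [Fintype ι] (q : ℝ≥0∞) (v : ι → ℝ) : ℝ :=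
  ‖(WithLp.toLp q v : PiLp q (fun _ : ι => ℝ))‖

/-- The correlation matrix of a covariance matrix. -/
def corr {p : ℕ} (S : Matrix (Fin p) (Fin p) ℝ) : Matrix (Fin p) (Fin p) ℝ :=
  Matrix.of fun i j => S i j / √(S i i * S j j)

/-- The row `R_{i, ∖{i,j}}`: row `i` without its entries in columns `i` and `j`, read here for an
arbitrary row `m`. -/
def rowDel {p : ℕ} (R : Matrix (Fin p) (Fin p) ℝ) (i j m : Fin p) :
    {l : Fin p // l ≠ i ∧ l ≠ j} → ℝ :=
  fun l => R m l

/-- The score `S_q(i,j) = (p-2)^{-1/q} min_{‖(a,b)‖_∞ = 1} ‖a R_{i,∖{i,j}} + b R_{j,∖{i,j}}‖_q`. -/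
def score {p : ℕ} (q : ℝ≥0∞) (R : Matrix (Fin p) (Fin p) ℝ) (i j : Fin p) : ℝ :=
  ((p : ℝ) - 2) ^ (-(q⁻¹).toReal) *
    ⨅ ab : {ab : ℝ × ℝ // max |ab.1| |ab.2| = 1},
      lqNorm q (ab.1.1 • rowDel R i j i + ab.1.2 • rowDel R i j j)

/-- `δ_n = c √(log (p ∨ n) / n)`. -/
def delta (c : ℝ) (p n : ℕ) : ℝ :=
  c * √(Real.log (max (p : ℝ) (n : ℝ)) / (n : ℝ))

/-! ### The factor model -/

/-- The factor model `X = A Z + E` with `K` factors: `rank A = K`, centered square-integrable `Z`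
and `E`, uncorrelated with each other, `E[E Eᵀ]` diagonal with positive diagonal, `E[Z Zᵀ]` of rank
`K` with unit diagonal. -/
structure FactorModel (p K : ℕ) {Ω : Type*} [MeasurableSpace Ω] (P : Measure Ω) where
  A : Matrix (Fin p) (Fin K) ℝ
  Z : Ω → Fin K → ℝ
  E : Ω → Fin p → ℝ
  one_le_K : 1 ≤ K
  memLp_Z : ∀ k, MemLp (fun ω => Z ω k) 2 P
  memLp_E : ∀ i, MemLp (fun ω => E ω i) 2 P
  mean_Z : ∀ k, ∫ ω, Z ω k ∂P = 0
  mean_E : ∀ i, ∫ ω, E ω i ∂P = 0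
  uncorr_Z_E : ∀ k i, ∫ ω, Z ω k * E ω i ∂P = 0
  uncorr_E : ∀ i j, i ≠ j → ∫ ω, E ω i * E ω j ∂P = 0
  var_E_pos : ∀ i, 0 < ∫ ω, E ω i * E ω i ∂P
  var_Z : ∀ k, ∫ ω, Z ω k * Z ω k ∂P = 1
  rank_cov_Z : (Matrix.of fun k l => ∫ ω, Z ω k * Z ω l ∂P).rank = K
  rank_A : A.rank = K

namespace FactorModel

variable {p K : ℕ} {Ω : Type*} [MeasurableSpace Ω] {P : Measure Ω}

/-- The observable vector `X = A Z + E`. -/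
def X (M : FactorModel p K P) (ω : Ω) : Fin p → ℝ := M.A *ᵥ M.Z ω + M.E ω

/-- `Σ_Z = E[Z Zᵀ]`. -/
def SigmaZ (M : FactorModel p K P) : Matrix (Fin K) (Fin K) ℝ :=
  Matrix.of fun k l => ∫ ω, M.Z ω k * M.Z ω l ∂P

/-- `Σ = Cov(X)`. -/
def Sigma (M : FactorModel p K P) : Matrix (Fin p) (Fin p) ℝ :=
  Matrix.of fun i j => cov[fun ω => M.X ω i, fun ω => M.X ω j; P]

/-- The correlation matrix `R` of `X`. -/
def R (M : FactorModel p K P) : Matrix (Fin p) (Fin p) ℝ := corr M.Sigma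

/-- `B = D_Σ^{-1/2} A`. -/
def B (M : FactorModel p K P) : Matrix (Fin p) (Fin K) ℝ :=
  Matrix.of fun i k => M.A i k / √(M.Sigma i i)

open Classical in
/-- The pure-variable group `I_k`: the rows of `A` whose only non-zero entry is the `k`-th. -/
def pureGroup (M : FactorModel p K P) (k : Fin K) : Finset (Fin p) :=
  Finset.univ.filter fun i => M.A i k ≠ 0 ∧ ∀ k', k' ≠ k → M.A i k' = 0

/-- `i ∈ I`. -/
def IsPure (M : FactorModel p K P) (i : Fin p) : Prop := ∃ k, i ∈ M.pureGroup k

/-- Every factor has at least two pure variables. -/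
def TwoPure (M : FactorModel p K P) : Prop :=
  ∀ k, ∃ i ∈ M.pureGroup k, ∃ j ∈ M.pureGroup k, i ≠ j

/-- `Σ^{-1/2} X` is `γ`-sub-Gaussian. -/
def IsSubGaussian (M : FactorModel p K P) (γ : ℝ) : Prop :=
  ∀ u : Fin p → ℝ,
    Integrable (fun ω => Real.exp (u ⬝ᵥ (invSqrt M.Sigma *ᵥ M.X ω))) P ∧
    ∫ ω, Real.exp (u ⬝ᵥ (invSqrt M.Sigma *ᵥ M.X ω)) ∂P ≤ Real.exp ((u ⬝ᵥ u) * γ ^ 2 / 2)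

/-- The separation condition: `S_q(i,j) > 4δ` for `i ∈ I` and `j` not in the same pure group. -/
def Separated (M : FactorModel p K P) (q : ℝ≥0∞) (δ : ℝ) : Prop :=
  ∀ i j, M.IsPure i → (¬ ∃ k, i ∈ M.pureGroup k ∧ j ∈ M.pureGroup k) → 4 * δ < score q M.R i j

open Classical in
/-- `J̄₁`: the non-pure indices whose row is near-parallel to that of another non-pure index. -/
def Jbar (M : FactorModel p K P) (q : ℝ≥0∞) (δ : ℝ) : Finset (Fin p) :=
  Finset.univ.filter fun j =>
    ¬ M.IsPure j ∧ ∃ l, ¬ M.IsPure l ∧ l ≠ j ∧ score q M.R j l ≤ 4 * δ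

/-- `B_{∖{i,j}·} Σ_Z B_{∖{i,j}·}ᵀ`. -/
def lowRankDel (M : FactorModel p K P) (i j : Fin p) :
    Matrix {l : Fin p // l ≠ i ∧ l ≠ j} {l : Fin p // l ≠ i ∧ l ≠ j} ℝ :=
  (M.B * M.SigmaZ * M.Bᵀ).submatrix Subtype.val Subtype.val

/-- The regularity bounds `min(c_{b,I}, c_z, c_r) > c` and `λ_1(Σ_Z) ≤ C`, where
`c_{b,I} = min_{j ∈ I ∪ J̄₁} ‖B_j‖₂²`, `c_z = λ_K(Σ_Z)` and
`c_r = min_{i ≠ j} (p-2)^{-1} λ_K(B_{∖{i,j}·} Σ_Z B_{∖{i,j}·}ᵀ)`. -/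
def Regular (M : FactorModel p K P) (q : ℝ≥0∞) (δ c C : ℝ) : Prop :=
  (∀ j, (M.IsPure j ∨ j ∈ M.Jbar q δ) → c < ∑ k, M.B j k ^ 2) ∧
  c < kthEig M.SigmaZ K ∧
  (∀ i j, i ≠ j → c < 1 / ((p : ℝ) - 2) * kthEig (M.lowRankDel i j) K) ∧
  kthEig M.SigmaZ 1 ≤ C

/-- `ξ_k = max_{i ∈ I_k} ‖A_i‖₁`. -/
def xi (M : FactorModel p K P) (k : Fin K) : ℝ :=
  ⨆ i : {i : Fin p // i ∈ M.pureGroup k}, ∑ l, |M.A i l|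

/-- `max_k ξ_k ≤ C₀ min_k ξ_k`. -/
def ScaleRatio (M : FactorModel p K P) (C₀ : ℝ) : Prop :=
  ∀ k l, M.xi k ≤ C₀ * M.xi l

/-- `max_{j ∈ J̄₁} (∑_k |A_{jk}| / ξ_k)² < 1 - ε`. -/
def ScaleNonPure (M : FactorModel p K P) (q : ℝ≥0∞) (δ ε : ℝ) : Prop :=
  ∀ j ∈ M.Jbar q δ, (∑ k, |M.A j k| / M.xi k) ^ 2 < 1 - ε

open Classical in
/-- `Ihat = {I_{π(1)}, …, I_{π(r)}}` for some permutation `π` of the factors, with `r ≤ K`: the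
collection `Ihat` consists of exactly `r` groups of the partition of the pure variables. -/
def Recovers (M : FactorModel p K P) (r : ℕ) (Ihat : Finset (Finset (Fin p))) : Prop :=
  r ≤ K ∧ ∃ π : Equiv.Perm (Fin K),
    Ihat = (Finset.univ.filter fun a : Fin K => a.val < r).image fun a => M.pureGroup (π a)

end FactorModel

/-! ### The estimators -/

/-- The sample covariance matrix `Xᵀ X / n` of the `n × p` data matrix `X`. -/
def sampleCov {n p : ℕ} (X : Fin n → Fin p → ℝ) : Matrix (Fin p) (Fin p) ℝ :=
  (n : ℝ)⁻¹ • ((Matrix.of X)ᵀ * Matrix.of X)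

/-- The sample correlation matrix. -/
def sampleCorr {n p : ℕ} (X : Fin n → Fin p → ℝ) : Matrix (Fin p) (Fin p) ℝ :=
  corr (sampleCov X)

open Classical in
/-- `Merge(S, H)`: every `g ∈ H` that meets `S` is replaced by `g ∪ S`; if there is none, `S` is
added to `H`. -/
def merge {p : ℕ} (S : Finset (Fin p)) (H : Finset (Finset (Fin p))) : Finset (Finset (Fin p)) :=
  if ∃ g ∈ H, (g ∩ S).Nonempty then
    H.image fun g => if (g ∩ S).Nonempty then g ∪ S else g
  else insert S H

/-- The pairs `i < j` in the order in which the two nested loops visit them. -/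
def orderedPairs (p : ℕ) : List (Fin p × Fin p) :=
  (List.finRange p).flatMap fun i =>
    ((List.finRange p).filter fun j => i < j).map fun j => (i, j)

open Classical in
/-- The collection of estimated groups of parallel rows. -/
def parallelGroups {p : ℕ} (q : ℝ≥0∞) (R : Matrix (Fin p) (Fin p) ℝ) (δ : ℝ) :
    Finset (Finset (Fin p)) :=
  (orderedPairs p).foldl
    (fun H ij => if score q R ij.1 ij.2 ≤ 2 * δ then merge {ij.1, ij.2} H else H) ∅

/-- The union of the estimated groups. -/
def parallelSet {p : ℕ} (H : Finset (Finset (Fin p))) : Finset (Fin p) := H.sup id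

/-- `jhat i` minimizes `S_2(i, ·)` over the other members of the group of `i` (ties are broken
arbitrarily). -/
def IsPartnerMap {p : ℕ} (R : Matrix (Fin p) (Fin p) ℝ) (H : Finset (Finset (Fin p)))
    (jhat : Fin p → Fin p) : Prop :=
  ∀ i ∈ parallelSet H, ∃ g ∈ H, i ∈ g ∧ jhat i ∈ g ∧ jhat i ≠ i ∧
    ∀ l ∈ g, l ≠ i → score 2 R i (jhat i) ≤ score 2 R i l

/-- The matrix with entries `R_{ij}` off the diagonal and
`|R_{i ĵ}| ‖R_{i,∖{i,ĵ}}‖₂ / ‖R_{ĵ,∖{i,ĵ}}‖₂` on it, `ĵ = jhat i`. -/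
def Mhat {p : ℕ} (R : Matrix (Fin p) (Fin p) ℝ) (jhat : Fin p → Fin p) :
    Matrix (Fin p) (Fin p) ℝ :=
  Matrix.of fun i j =>
    if i = j then
      |R i (jhat i)| * (lqNorm 2 (rowDel R i (jhat i) i) / lqNorm 2 (rowDel R i (jhat i) (jhat i)))
    else R i j

/-- The estimate `Σ̂ - D^{1/2} Γ̂ D^{1/2}` of `A Σ_Z Aᵀ`, with `D = diag Σ̂` and
`Γ̂ = diag (1 - M̂_ii)`. -/
def ThetaHat {p : ℕ} (S : Matrix (Fin p) (Fin p) ℝ) (jhat : Fin p → Fin p) :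
    Matrix (Fin p) (Fin p) ℝ :=
  S - Matrix.diagonal (fun i => √(S i i)) *
      Matrix.diagonal (fun i => 1 - Mhat (corr S) jhat i i) *
      Matrix.diagonal (fun i => √(S i i))

/-- `Θ_{jj|S} = Θ_jj - Θ_{jS} Θ_{SS}⁻ Θ_{Sj}`. -/
def schurDiag {p : ℕ} (Θ : Matrix (Fin p) (Fin p) ℝ) (S : Finset (Fin p)) (j : Fin p) : ℝ :=
  Θ j j - (fun s : {s // s ∈ S} => Θ j s) ⬝ᵥ
    (pinv (Θ.submatrix (Subtype.val : {s // s ∈ S} → Fin p) Subtype.val) *ᵥ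
      fun s : {s // s ∈ S} => Θ s j)

/-- `i_1, …, i_r` are successive maximizers over `Hset` of the Schur complements `Θ_{jj|S_k}`,
`S_k = {i_1, …, i_{k-1}}` (ties are broken arbitrarily). -/
def IsSelection {p : ℕ} (Θ : Matrix (Fin p) (Fin p) ℝ) (Hset : Finset (Fin p)) (r : ℕ)
    (i : Fin r → Fin p) : Prop :=
  ∀ k : Fin r, i k ∈ Hset ∧ ∀ j ∈ Hset,
    schurDiag Θ ((Finset.univ.filter fun a : Fin r => a < k).image i) j ≤
      schurDiag Θ ((Finset.univ.filter fun a : Fin r => a < k).image i) (i k)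

/-- The pruning algorithm with input `r`: it keeps the groups that contain a selected index. -/
def IsPruning {p : ℕ} (S : Matrix (Fin p) (Fin p) ℝ) (jhat : Fin p → Fin p)
    (H : Finset (Finset (Fin p))) (r : ℕ) (Ihat : Finset (Finset (Fin p))) : Prop :=
  ∃ i : Fin r → Fin p, IsSelection (ThetaHat S jhat) (parallelSet H) r i ∧
    ∀ g, g ∈ Ihat ↔ g ∈ H ∧ ∃ a, i a ∈ g

/-- Pruning is applied when `r` is smaller than the number of groups; otherwise no action is
taken and all groups are returned. -/
def IsPruned {p : ℕ} (S : Matrix (Fin p) (Fin p) ℝ) (jhat : Fin p → Fin p)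
    (H : Finset (Finset (Fin p))) (r : ℕ) (Ihat : Finset (Finset (Fin p))) : Prop :=
  (r < H.card → IsPruning S jhat H r Ihat) ∧ (H.card ≤ r → Ihat = H)

/-- A possible output `Ihat` of the procedure on the data `X`, for given `r`. -/
def IsOutput {n p : ℕ} (q : ℝ≥0∞) (δ : ℝ) (X : Fin n → Fin p → ℝ) (r : ℕ)
    (Ihat : Finset (Finset (Fin p))) : Prop :=
  ∃ jhat, IsPartnerMap (sampleCorr X) (parallelGroups q (sampleCorr X) δ) jhat ∧
    IsPruned (sampleCov X) jhat (parallelGroups q (sampleCorr X) δ) r Ihat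

/-- `rep g` maximizes `‖R_{i,∖{i}}‖₂` over `i ∈ g`, for every group `g` (ties are broken
arbitrarily). -/
def IsRepMap {p : ℕ} (R : Matrix (Fin p) (Fin p) ℝ) (H : Finset (Finset (Fin p)))
    (rep : Finset (Fin p) → Fin p) : Prop :=
  ∀ g ∈ H, rep g ∈ g ∧ ∀ i ∈ g,
    lqNorm 2 (rowDel R i i i) ≤ lqNorm 2 (rowDel R (rep g) (rep g) (rep g))

open Classical in
/-- `K̂ = max {k ∈ [Ĝ] : λ_k(M̂_{L̂L̂}) ≥ μ}` (`0` if there is no such `k`), where `L̂` is the set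
of the representatives of the `Ĝ` groups. -/
def Khat {p : ℕ} (R : Matrix (Fin p) (Fin p) ℝ) (H : Finset (Finset (Fin p)))
    (jhat : Fin p → Fin p) (rep : Finset (Fin p) → Fin p) (μ : ℝ) : ℕ :=
  ((Finset.Icc 1 H.card).filter fun k =>
    μ ≤ kthEig ((Mhat R jhat).submatrix
      (Subtype.val : {l // l ∈ H.image rep} → Fin p) Subtype.val) k).sup id

/-- A possible output `(K̂, Ihat)` of the whole procedure with tuning parameters `δ` and `μ`, on the
data `X`: the pruning step is run with `r = K̂`. -/
def IsFullOutput {n p : ℕ} (q : ℝ≥0∞) (δ μ : ℝ) (X : Fin n → Fin p → ℝ) (k : ℕ)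
    (Ihat : Finset (Finset (Fin p))) : Prop :=
  ∃ jhat rep, IsPartnerMap (sampleCorr X) (parallelGroups q (sampleCorr X) δ) jhat ∧
    IsRepMap (sampleCorr X) (parallelGroups q (sampleCorr X) δ) rep ∧
    k = Khat (sampleCorr X) (parallelGroups q (sampleCorr X) δ) jhat rep μ ∧
    IsPruned (sampleCov X) jhat (parallelGroups q (sampleCorr X) δ) k Ihat

/-- `X` is an i.i.d. sample of size `n` from the law of the random vector `Y`. -/
def IsIIDSample {n p : ℕ} {Ω Ω' : Type*} [MeasurableSpace Ω] [MeasurableSpace Ω']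
    (P : Measure Ω) (P' : Measure Ω') (X : Fin n → Ω → Fin p → ℝ) (Y : Ω' → Fin p → ℝ) : Prop :=
  iIndepFun X P ∧ ∀ t, IdentDistrib (X t) Y P P'

end PureVar

end

open PureVar

/-!
# Recovery of the pure variables of a factor model

The factors are represented by vectors `ζ_k` with Gram matrix `Σ_Z`, and the variable `X_i` by
`β_i = ∑ B_ik ζ_k`, so that `R_ij = ⟨β_i, β_j⟩` for `i ≠ j`. The bound on `c_z` says that the `ζ_k`
are well conditioned, and the one on `c_r` that the `β_l`, even with two of them removed, form a
frame whose lower bound is proportional to `p - 2`. Since the normalized `ℓ_1` norm is the smallest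
of the normalized `ℓ_q` norms, the frame bound turns a small score `S_q(i, j)` into near parallelism
of `β_i` and `β_j`, whatever the value of `q` (`FactorModel.Regular.exists_norm_le_of_score_lt`).

The randomness enters through a single estimate, `sparse_concentration`: on vectors with at most
`s` non-zero entries, the quadratic forms of the sample covariance matrix and of `Σ` differ by a
factor `1 + O(√(s log (p ∨ n) / n) + s log (p ∨ n) / n)`, with probability at least `1 - 2 / n`. It
combines Chernoff's bound for squares of sub-Gaussian variables with a union bound over the
supports and over a finite grid for every support. It is used for `s = 2`, which controls `R`
entrywise and gives the lower bound on `c_δ`, for `s = K`, which serves the pruning step, and for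
`s = K + |J̄₁|`, which is the largest possible number of representatives. All the rest is
deterministic, so that random `r` and arbitrary tie-breaking cost nothing
(`FactorModel.exists_correct_procedure`).

*Groups.* When `R` is known up to `δ / 2`, every pair inside a group `I_k` is joined and no pure
variable is joined to a variable outside its group. As the pairs are visited in lexicographic order,
the smallest member of `I_k` collects the others before two separate groups inside `I_k` can arise
(`groupFold_unique`); hence every `I_k` is one of the estimated groups, and all the other groups
consist of members of `J̄₁` (`FactorModel.groupSpec_parallelGroups`).

*Denoising.* The partner of `i` minimizes `S_2`, so `β_i` is nearly a multiple of the partner's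
vector, and the ratio of row norms recovers `‖β_i‖²` up to `O(δ)`
(`FactorModel.exists_Mhat_bound`). The diagonal noise being removed, the rescaled form of `Θ̂` is
close to `x ↦ ‖∑ x_i β_i‖²` on sparse vectors (`FactorModel.SparseClose.formApprox`).

*Pruning.* A Schur complement is the minimum of the quadratic form over the span of the selected
indices (`schurDiag_isLeast`). Hence it approximates the squared residual of `∑ A_jk ζ_k` after
projection away from the selected directions (`FactorModel.FormApprox.abs_schurDiag_sub_le`). If `T`
is the residual map and `m = max_k ξ_k ‖T ζ_k‖`, a pure variable attains `m`, whereas the triangle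
inequality and (ii) keep every member of `J̄₁` below `√(1 - ε) m`. Condition (i) makes `m`
comparable to the standard deviations, so that this gap dominates the error, and the maximizer is a
pure variable of a factor not selected before (`FactorModel.IsFactorOf.maximizer_isPure`).

*Number of factors.* By the Courant-Fischer principle, `M̂` on the representatives has at most `K`
eigenvalues above the error, because `x ↦ ‖∑ x_i β_i‖²` has rank at most `K`
(`FactorModel.Khat_le`). If the threshold is small, it has at least `K` eigenvalues above it,
because the pure representatives are well conditioned (`FactorModel.le_Khat`).
-/

noncomputable section

namespace PureVar

/-! ### Ordered eigenvalues of symmetric matrices -/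

section Eig

variable {ι : Type*} [Fintype ι] [DecidableEq ι]

/-- An orthonormal basis of eigenvectors of `M`, indexed in the order of `eigenvalues₀`. -/
def eigBasis {M : Matrix ι ι ℝ} (hM : M.IsHermitian) :
    OrthonormalBasis (Fin (Fintype.card ι)) ℝ (EuclideanSpace ℝ ι) :=
  (isSymmetric_toEuclideanLin_iff.mpr hM).eigenvectorBasis finrank_euclideanSpace

theorem mulVec_eigBasis {M : Matrix ι ι ℝ} (hM : M.IsHermitian) (a : Fin (Fintype.card ι)) :
    M *ᵥ (eigBasis hM a).ofLp = hM.eigenvalues₀ a • (eigBasis hM a).ofLp := by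
  have h := (isSymmetric_toEuclideanLin_iff.mpr hM).apply_eigenvectorBasis
    finrank_euclideanSpace a
  exact congrArg WithLp.ofLp h

theorem dotProduct_self_eq_sum_eigBasis {M : Matrix ι ι ℝ} (hM : M.IsHermitian)
    (x : EuclideanSpace ℝ ι) :
    x.ofLp ⬝ᵥ x.ofLp = ∑ a, inner ℝ (eigBasis hM a) x ^ 2 := by
  have h1 := (eigBasis hM).sum_sq_norm_inner_right x
  simp only [Real.norm_eq_abs, sq_abs] at h1
  rw [h1, EuclideanSpace.real_norm_sq_eq]
  simp [dotProduct, sq]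

theorem quad_eq_sum_eigBasis {M : Matrix ι ι ℝ} (hM : M.IsHermitian)
    (x : EuclideanSpace ℝ ι) :
    x.ofLp ⬝ᵥ (M *ᵥ x.ofLp) =
      ∑ a, hM.eigenvalues₀ a * inner ℝ (eigBasis hM a) x ^ 2 := by
  have h1 : x.ofLp = ∑ a, inner ℝ (eigBasis hM a) x • (eigBasis hM a).ofLp := by
    conv_lhs => rw [← (eigBasis hM).sum_repr' x]
    simp
  have h2 : M *ᵥ x.ofLp =
      ∑ a, (inner ℝ (eigBasis hM a) x * hM.eigenvalues₀ a) • (eigBasis hM a).ofLp := by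
    conv_lhs => rw [h1]
    rw [Matrix.mulVec_sum]
    refine Finset.sum_congr rfl fun a _ => ?_
    rw [Matrix.mulVec_smul, mulVec_eigBasis, smul_smul]
  rw [h2, dotProduct_sum]
  refine Finset.sum_congr rfl fun a _ => ?_
  rw [dotProduct_smul]
  have : x.ofLp ⬝ᵥ (eigBasis hM a).ofLp = inner ℝ (eigBasis hM a) x := by
    simp [EuclideanSpace.inner_eq_star_dotProduct]
  rw [this, smul_eq_mul]; ring

theorem kthEig_eq {M : Matrix ι ι ℝ} (hM : M.IsHermitian) {k : ℕ} (h1 : 1 ≤ k)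
    (h2 : k ≤ Fintype.card ι) :
    kthEig M k = hM.eigenvalues₀ ⟨k - 1, by omega⟩ := by
  unfold kthEig
  rw [dif_pos ⟨hM, h1, h2⟩]

/-- The smallest eigenvalue bounds the quadratic form from below. -/
theorem kthEig_card_mul_le_quad {M : Matrix ι ι ℝ} (hM : M.IsHermitian) {k : ℕ}
    (hk : Fintype.card ι = k) (x : ι → ℝ) :
    kthEig M k * (x ⬝ᵥ x) ≤ x ⬝ᵥ (M *ᵥ x) := by
  rcases Nat.eq_zero_or_pos k with h0 | h0
  · have : IsEmpty ι := Fintype.card_eq_zero_iff.1 (hk.trans h0)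
    simp [dotProduct]
  have e1 := quad_eq_sum_eigBasis hM (WithLp.toLp 2 x)
  have e2 := dotProduct_self_eq_sum_eigBasis hM (WithLp.toLp 2 x)
  simp only at e1 e2
  rw [e1, e2, kthEig_eq hM h0 hk.ge, Finset.mul_sum]
  refine Finset.sum_le_sum fun a _ => mul_le_mul_of_nonneg_right ?_ (sq_nonneg _)
  apply hM.eigenvalues₀_antitone
  have := a.2
  simp only [Fin.le_def]
  omega

/-- Courant-Fischer, lower bound: a `k`-dimensional space on which the form is at least `t` times
the squared norm. -/
theorem le_kthEig_of_subspace {M : Matrix ι ι ℝ} (hM : M.IsHermitian) {k : ℕ} (hk : 1 ≤ k)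
    {t : ℝ} (T : (Fin k → ℝ) →ₗ[ℝ] EuclideanSpace ℝ ι) (hT : Function.Injective T)
    (h : ∀ y, t * ((T y).ofLp ⬝ᵥ (T y).ofLp) ≤ (T y).ofLp ⬝ᵥ (M *ᵥ (T y).ofLp)) :
    t ≤ kthEig M k := by
  have hcard : k ≤ Fintype.card ι := by
    have := LinearMap.finrank_le_finrank_of_injective hT
    simpa using this
  by_contra hlt
  push Not at hlt
  let F : (Fin k → ℝ) →ₗ[ℝ] (Fin (k - 1) → ℝ) :=
    LinearMap.pi fun a =>
      (innerSL ℝ (eigBasis hM ⟨a.1, by omega⟩)).toLinearMap ∘ₗ T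
  have hker : LinearMap.ker F ≠ ⊥ := by
    apply LinearMap.ker_ne_bot_of_finrank_lt
    simp; omega
  obtain ⟨y, hy, hy0⟩ := Submodule.exists_mem_ne_zero_of_ne_bot hker
  have hx0 : T y ≠ 0 := fun h0 => hy0 (hT (by simpa using h0))
  have hz : ∀ a : Fin (Fintype.card ι), a.1 < k - 1 → inner ℝ (eigBasis hM a) (T y) = 0 := by
    intro a ha
    have := congrFun (LinearMap.mem_ker.1 hy) ⟨a.1, ha⟩
    simpa [F] using this
  have hpos : 0 < (T y).ofLp ⬝ᵥ (T y).ofLp := by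
    have : (T y).ofLp ⬝ᵥ (T y).ofLp = ‖T y‖ ^ 2 := by
      rw [EuclideanSpace.real_norm_sq_eq]; simp [dotProduct, sq]
    rw [this]; positivity
  have hub : (T y).ofLp ⬝ᵥ (M *ᵥ (T y).ofLp) ≤ kthEig M k * ((T y).ofLp ⬝ᵥ (T y).ofLp) := by
    rw [quad_eq_sum_eigBasis hM, dotProduct_self_eq_sum_eigBasis hM, kthEig_eq hM hk hcard,
      Finset.mul_sum]
    refine Finset.sum_le_sum fun a _ => ?_
    by_cases ha : a.1 < k - 1
    · simp [hz a ha]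
    · refine mul_le_mul_of_nonneg_right (hM.eigenvalues₀_antitone ?_) (sq_nonneg _)
      simp only [Fin.le_def]; omega
  nlinarith [h y]

/-- The span of the first `k` eigenvectors, where the form is at least `kthEig M k` times the
squared norm. -/
theorem exists_eigenspace {M : Matrix ι ι ℝ} (hM : M.IsHermitian) {k : ℕ} (hk : 1 ≤ k)
    (hcard : k ≤ Fintype.card ι) :
    ∃ T : (Fin k → ℝ) →ₗ[ℝ] EuclideanSpace ℝ ι, Function.Injective T ∧
      ∀ y, kthEig M k * ((T y).ofLp ⬝ᵥ (T y).ofLp) ≤ (T y).ofLp ⬝ᵥ (M *ᵥ (T y).ofLp) := by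
  let v : Fin k → EuclideanSpace ℝ ι := fun a => eigBasis hM (Fin.castLE hcard a)
  have hv : Orthonormal ℝ v :=
    (eigBasis hM).orthonormal.comp _ (Fin.castLE_injective hcard)
  refine ⟨Fintype.linearCombination ℝ v, ?_, fun y => ?_⟩
  · exact LinearIndependent.fintypeLinearCombination_injective hv.linearIndependent
  rw [quad_eq_sum_eigBasis hM, dotProduct_self_eq_sum_eigBasis hM, kthEig_eq hM hk hcard,
    Finset.mul_sum]
  refine Finset.sum_le_sum fun a _ => ?_
  by_cases ha : a.1 < k
  · refine mul_le_mul_of_nonneg_right (hM.eigenvalues₀_antitone ?_) (sq_nonneg _)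
    simp only [Fin.le_def]; omega
  · have : inner ℝ (eigBasis hM a) (Fintype.linearCombination ℝ v y) = 0 := by
      rw [Fintype.linearCombination_apply, inner_sum]
      refine Finset.sum_eq_zero fun b _ => ?_
      rw [inner_smul_right, (eigBasis hM).inner_eq_zero, mul_zero]
      intro hab
      apply ha
      rw [hab]; simp
    simp [this]

/-- Courant-Fischer, upper bound: the form is at most `t` times the squared norm on the kernel of a
map of rank less than `k`. -/
theorem kthEig_le_of_ker {M : Matrix ι ι ℝ} (hM : M.IsHermitian) {k : ℕ}
    {t : ℝ} (ht : 0 ≤ t) {V : Type*} [AddCommGroup V] [Module ℝ V] [FiniteDimensional ℝ V]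
    (hk : Module.finrank ℝ V < k) (F : (ι → ℝ) →ₗ[ℝ] V)
    (h : ∀ x, F x = 0 → x ⬝ᵥ (M *ᵥ x) ≤ t * (x ⬝ᵥ x)) :
    kthEig M k ≤ t := by
  by_cases hcard : k ≤ Fintype.card ι
  swap
  · unfold kthEig
    rw [dif_neg (fun h => hcard h.2.2)]
    exact ht
  obtain ⟨T, hT, hq⟩ := exists_eigenspace hM (by omega) hcard
  have hker : LinearMap.ker (F ∘ₗ (WithLp.linearEquiv 2 ℝ (ι → ℝ)).toLinearMap ∘ₗ T) ≠ ⊥ := by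
    apply LinearMap.ker_ne_bot_of_finrank_lt
    simpa using hk
  obtain ⟨y, hy, hy0⟩ := Submodule.exists_mem_ne_zero_of_ne_bot hker
  have hx0 : T y ≠ 0 := fun h0 => hy0 (hT (by simpa using h0))
  have hpos : 0 < (T y).ofLp ⬝ᵥ (T y).ofLp := by
    have : (T y).ofLp ⬝ᵥ (T y).ofLp = ‖T y‖ ^ 2 := by
      rw [EuclideanSpace.real_norm_sq_eq]; simp [dotProduct, sq]
    rw [this]; positivity
  have h1 := h (T y).ofLp (by simpa using hy)
  have h2 := hq y
  by_contra hlt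
  push Not at hlt
  nlinarith

/-- If the `K`-th eigenvalue of the Gram matrix of vectors `b l` in a `K`-dimensional space is at
least `t > 0`, the vectors form a frame with lower bound `t`: the non-zero eigenvalues of `G Gᵀ` and
`Gᵀ G` are the same. -/
theorem frame_of_kthEig_gram {K : ℕ} (hK : 1 ≤ K) (b : ι → EuclideanSpace ℝ (Fin K))
    {t : ℝ} (ht : 0 < t)
    (h : t ≤ kthEig (Matrix.of fun l m => inner ℝ (b l) (b m)) K)
    (w : EuclideanSpace ℝ (Fin K)) :
    t * ‖w‖ ^ 2 ≤ ∑ l, inner ℝ (b l) w ^ 2 := by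
  set G : Matrix ι ι ℝ := Matrix.of fun l m => inner ℝ (b l) (b m) with hG
  have hM : G.IsHermitian := by
    ext l m; simp [hG, Matrix.conjTranspose_apply, real_inner_comm]
  have hcard : K ≤ Fintype.card ι := by
    by_contra hc
    unfold kthEig at h
    rw [dif_neg (fun h => hc h.2.2)] at h
    linarith
  obtain ⟨T, hT, hq⟩ := exists_eigenspace hM hK hcard
  have hquad : ∀ u : ι → ℝ, u ⬝ᵥ (G *ᵥ u) = ‖∑ l, u l • b l‖ ^ 2 := by
    intro u
    rw [← real_inner_self_eq_norm_sq, sum_inner]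
    simp only [dotProduct, Matrix.mulVec, hG, Matrix.of_apply, inner_sum, inner_smul_left,
      inner_smul_right, Finset.mul_sum]
    refine Finset.sum_congr rfl fun l _ => Finset.sum_congr rfl fun m _ => ?_
    simp; ring
  let S : (Fin K → ℝ) →ₗ[ℝ] EuclideanSpace ℝ (Fin K) :=
    Fintype.linearCombination ℝ b ∘ₗ (WithLp.linearEquiv 2 ℝ (ι → ℝ)).toLinearMap ∘ₗ T
  have hS : ∀ y, S y = ∑ l, (T y).ofLp l • b l := fun y => by
    simp [S, Fintype.linearCombination_apply]
  have hnn : ∀ x : EuclideanSpace ℝ ι, x.ofLp ⬝ᵥ x.ofLp = ‖x‖ ^ 2 := fun x => by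
    rw [EuclideanSpace.real_norm_sq_eq]; simp [dotProduct, sq]
  have key : ∀ y, t * ‖T y‖ ^ 2 ≤ ‖S y‖ ^ 2 := by
    intro y
    have := hq y
    rw [hquad, ← hS, hnn] at this
    nlinarith [sq_nonneg ‖T y‖]
  have hinj : Function.Injective S := by
    rw [← LinearMap.ker_eq_bot, LinearMap.ker_eq_bot']
    intro y hy
    have := key y
    rw [hy] at this
    have h0 : ‖T y‖ ^ 2 ≤ 0 := by
      by_contra hc
      push Not at hc
      have := mul_pos ht hc
      simp at *; linarith
    have : T y = 0 := by
      have := pow_eq_zero_iff (two_ne_zero) |>.1 (le_antisymm h0 (sq_nonneg _))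
      exact norm_eq_zero.1 this
    exact hT (by simpa using this)
  have hsurj : Function.Surjective S :=
    (LinearMap.injective_iff_surjective_of_finrank_eq_finrank (by simp)).1 hinj
  obtain ⟨y, rfl⟩ := hsurj w
  have hk := key y
  have h1 : ‖S y‖ ^ 2 = ∑ l, (T y).ofLp l * inner ℝ (b l) (S y) := by
    rw [← real_inner_self_eq_norm_sq]
    conv_lhs => arg 2; rw [hS]
    rw [sum_inner]
    exact Finset.sum_congr rfl fun l _ => by rw [inner_smul_left]; simp
  have h2 : (‖S y‖ ^ 2) ^ 2 ≤ ‖T y‖ ^ 2 * ∑ l, inner ℝ (b l) (S y) ^ 2 := by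
    rw [EuclideanSpace.real_norm_sq_eq (T y)]
    conv_lhs => rw [h1]
    exact Finset.sum_mul_sq_le_sq_mul_sq _ _ _
  set A := ‖S y‖ ^ 2
  set D := ∑ l, inner ℝ (b l) (S y) ^ 2
  have hD : 0 ≤ D := Finset.sum_nonneg fun _ _ => sq_nonneg _
  have hA : 0 ≤ A := sq_nonneg _
  rcases hA.eq_or_lt with h0 | h0
  · rw [← h0]; simpa using hD
  · have : A * (t * A) ≤ A * D := by nlinarith [mul_le_mul_of_nonneg_right hk hD]
    exact le_of_mul_le_mul_left this h0

end Eig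

/-! ### Merging pairs into groups -/

section Merge

variable {p : ℕ}

open Classical in
/-- The groups obtained by merging, in the order of the list, the pairs that satisfy `J`. -/
def groupFold (J : Fin p × Fin p → Prop) (l : List (Fin p × Fin p)) : Finset (Finset (Fin p)) :=
  l.foldl (fun H ij => if J ij then merge {ij.1, ij.2} H else H) ∅

theorem parallelGroups_eq_groupFold (q : ℝ≥0∞) (R : Matrix (Fin p) (Fin p) ℝ) (δ : ℝ) :
    parallelGroups q R δ = groupFold (fun ij => score q R ij.1 ij.2 ≤ 2 * δ) (orderedPairs p) := by
  unfold parallelGroups groupFold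
  congr

@[simp] theorem groupFold_nil (J : Fin p × Fin p → Prop) : groupFold J [] = ∅ := rfl

theorem groupFold_append_of {J : Fin p × Fin p → Prop} (l : List (Fin p × Fin p))
    {x : Fin p × Fin p} (hx : J x) :
    groupFold J (l ++ [x]) = merge {x.1, x.2} (groupFold J l) := by
  simp [groupFold, hx]

theorem groupFold_append_of_not {J : Fin p × Fin p → Prop} (l : List (Fin p × Fin p))
    {x : Fin p × Fin p} (hx : ¬ J x) :
    groupFold J (l ++ [x]) = groupFold J l := by
  simp [groupFold, hx]

theorem mem_merge {S : Finset (Fin p)} {H : Finset (Finset (Fin p))} {g' : Finset (Fin p)}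
    (h : g' ∈ merge S H) :
    (g' ∈ H ∧ ¬ (g' ∩ S).Nonempty ∧ ∃ g ∈ H, (g ∩ S).Nonempty) ∨
      (∃ g ∈ H, (g ∩ S).Nonempty ∧ g' = g ∪ S) ∨
      ((∀ g ∈ H, ¬ (g ∩ S).Nonempty) ∧ (g' = S ∨ g' ∈ H)) := by
  classical
  unfold merge at h
  split_ifs at h with hS
  · obtain ⟨g, hg, rfl⟩ := Finset.mem_image.1 h
    split_ifs with hgS
    · exact Or.inr (Or.inl ⟨g, hg, hgS, rfl⟩)
    · exact Or.inl ⟨hg, hgS, hS⟩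
  · push Not at hS
    refine Or.inr (Or.inr ⟨fun g hg hn => ?_, Finset.mem_insert.1 h⟩)
    exact Finset.nonempty_iff_ne_empty.1 hn (hS g hg)

theorem exists_superset_mem_merge {S : Finset (Fin p)} {H : Finset (Finset (Fin p))}
    {g : Finset (Fin p)} (hg : g ∈ H) : ∃ g' ∈ merge S H, g ⊆ g' := by
  classical
  unfold merge
  split_ifs with hS
  · refine ⟨_, Finset.mem_image_of_mem _ hg, ?_⟩
    split_ifs
    · exact Finset.subset_union_left
    · exact subset_rfl
  · exact ⟨g, Finset.mem_insert_of_mem hg, subset_rfl⟩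

theorem exists_mem_merge_superset (S : Finset (Fin p)) (H : Finset (Finset (Fin p))) :
    ∃ g' ∈ merge S H, S ⊆ g' := by
  classical
  unfold merge
  split_ifs with hS
  · obtain ⟨g, hg, hgS⟩ := hS
    refine ⟨_, Finset.mem_image_of_mem _ hg, ?_⟩
    rw [if_pos hgS]
    exact Finset.subset_union_right
  · exact ⟨S, Finset.mem_insert_self _ _, subset_rfl⟩

/-- Every group lies in a single class, if the pairs do. -/
theorem groupFold_class {κ : Type*} {J : Fin p × Fin p → Prop} (cls : Fin p → κ)
    (l : List (Fin p × Fin p)) (hJ : ∀ x ∈ l, J x → cls x.1 = cls x.2) :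
    ∀ g ∈ groupFold J l, ∀ a ∈ g, ∀ b ∈ g, cls a = cls b := by
  classical
  induction l using List.reverseRecOn with
  | nil => simp
  | append_singleton l x ih =>
    have ih' := ih fun y hy => hJ y (by simp [hy])
    by_cases hx : J x
    · rw [groupFold_append_of l hx]
      have hxx := hJ x (by simp) hx
      have hS : ∀ a ∈ ({x.1, x.2} : Finset (Fin p)), cls a = cls x.1 := by
        intro a ha
        rcases Finset.mem_insert.1 ha with rfl | ha
        · rfl
        · rw [Finset.mem_singleton.1 ha, hxx]
      intro g' hg'
      rcases mem_merge hg' with ⟨h, -⟩ | ⟨g, hg, ⟨c, hc⟩, rfl⟩ | ⟨-, rfl | h⟩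
      · exact ih' g' h
      · have hc' := Finset.mem_inter.1 hc
        have : ∀ a ∈ g ∪ {x.1, x.2}, cls a = cls x.1 := by
          intro a ha
          rcases Finset.mem_union.1 ha with ha | ha
          · rw [ih' g hg a ha c hc'.1, hS c hc'.2]
          · exact hS a ha
        exact fun a ha b hb => (this a ha).trans (this b hb).symm
      · exact fun a ha b hb => (hS a ha).trans (hS b hb).symm
      · exact ih' g' h
    · rw [groupFold_append_of_not l hx]; exact ih'

/-- Every group is non-empty, and every member of a group was joined to another member. -/
theorem groupFold_partner {J : Fin p × Fin p → Prop}
    (l : List (Fin p × Fin p)) (hne : ∀ x ∈ l, x.1 ≠ x.2) :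
    ∀ g ∈ groupFold J l, g.Nonempty ∧ ∀ a ∈ g, ∃ b ∈ g, b ≠ a ∧ (J (a, b) ∨ J (b, a)) := by
  classical
  induction l using List.reverseRecOn with
  | nil => simp
  | append_singleton l x ih =>
    have ih' := ih fun y hy => hne y (by simp [hy])
    by_cases hx : J x
    · rw [groupFold_append_of l hx]
      have hxx := hne x (by simp)
      have hS : ∀ a ∈ ({x.1, x.2} : Finset (Fin p)), ∃ b ∈ ({x.1, x.2} : Finset (Fin p)),
          b ≠ a ∧ (J (a, b) ∨ J (b, a)) := by
        intro a ha
        rcases Finset.mem_insert.1 ha with rfl | ha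
        · exact ⟨x.2, by simp, hxx.symm, Or.inl hx⟩
        · rw [Finset.mem_singleton.1 ha]
          exact ⟨x.1, by simp, hxx, Or.inr hx⟩
      intro g' hg'
      rcases mem_merge hg' with ⟨h, -⟩ | ⟨g, hg, -, rfl⟩ | ⟨-, rfl | h⟩
      · exact ih' g' h
      · refine ⟨(ih' g hg).1.mono Finset.subset_union_left, fun a ha => ?_⟩
        rcases Finset.mem_union.1 ha with ha | ha
        · obtain ⟨b, hb, h⟩ := (ih' g hg).2 a ha
          exact ⟨b, Finset.mem_union_left _ hb, h⟩
        · obtain ⟨b, hb, h⟩ := hS a ha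
          exact ⟨b, Finset.mem_union_right _ hb, h⟩
      · exact ⟨⟨x.1, by simp⟩, hS⟩
      · exact ih' g' h
    · rw [groupFold_append_of_not l hx]; exact ih'

theorem groupFold_cover {J : Fin p × Fin p → Prop} (l : List (Fin p × Fin p)) :
    ∀ x ∈ l, J x → ∃ g ∈ groupFold J l, x.1 ∈ g ∧ x.2 ∈ g := by
  classical
  induction l using List.reverseRecOn with
  | nil => simp
  | append_singleton l x ih =>
    intro y hy hJy
    by_cases hx : J x
    · rw [groupFold_append_of l hx]
      rcases List.mem_append.1 hy with hy | hy
      · obtain ⟨g, hg, h1, h2⟩ := ih y hy hJy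
        obtain ⟨g', hg', hsub⟩ := exists_superset_mem_merge (S := {x.1, x.2}) hg
        exact ⟨g', hg', hsub h1, hsub h2⟩
      · rw [List.mem_singleton.1 hy]
        obtain ⟨g', hg', hsub⟩ := exists_mem_merge_superset {x.1, x.2} (groupFold J l)
        exact ⟨g', hg', hsub (by simp), hsub (by simp)⟩
    · rw [groupFold_append_of_not l hx]
      rcases List.mem_append.1 hy with hy | hy
      · exact ih y hy hJy
      · rw [List.mem_singleton.1 hy] at hJy
        exact absurd hJy hx

theorem mem_orderedPairs {x : Fin p × Fin p} : x ∈ orderedPairs p ↔ x.1 < x.2 := by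
  simp only [orderedPairs, List.mem_flatMap, List.mem_finRange, true_and, List.mem_map,
    List.mem_filter, decide_eq_true_eq]
  constructor
  · rintro ⟨i, j, h, rfl⟩; exact h
  · intro h; exact ⟨x.1, x.2, h, rfl⟩

theorem pairwise_orderedPairs : (orderedPairs p).Pairwise fun a b => a.1 ≤ b.1 := by
  unfold orderedPairs
  rw [List.pairwise_flatMap]
  constructor
  · intro i _
    rw [List.pairwise_map]
    exact List.pairwise_of_forall (fun _ _ => le_rfl)
  · refine (List.pairwise_lt_finRange p).imp ?_
    intro a b hab x hx y hy
    obtain ⟨_, _, rfl⟩ := List.mem_map.1 hx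
    obtain ⟨_, _, rfl⟩ := List.mem_map.1 hy
    exact hab.le

/-- Let `c` be a class with least element `i₀`, closed under joining, such that `i₀` is joined to
all other members. Because the row of `i₀` is visited before the other rows of `c`, no second group
that meets `c` is ever created. -/
theorem groupFold_unique {J : Fin p × Fin p → Prop} {c : Finset (Fin p)} {i₀ : Fin p}
    (hmin : ∀ i ∈ c, i₀ ≤ i) (hclosed : ∀ i j, i < j → J (i, j) → (i ∈ c ↔ j ∈ c))
    (hjoin : ∀ j ∈ c, j ≠ i₀ → J (i₀, j)) (l : List (Fin p × Fin p))
    (hl : l <+: orderedPairs p) :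
    (∀ g ∈ groupFold J l, (g ∩ c).Nonempty → i₀ ∈ g) ∧
      ∀ g ∈ groupFold J l, ∀ g' ∈ groupFold J l, (g ∩ c).Nonempty → (g' ∩ c).Nonempty →
        g = g' := by
  classical
  induction l using List.reverseRecOn with
  | nil => simp
  | append_singleton l x ih =>
    obtain ⟨ih1, ih2⟩ := ih ((List.prefix_append l [x]).trans hl)
    by_cases hx : J x
    swap
    · rw [groupFold_append_of_not l hx]; exact ⟨ih1, ih2⟩
    rw [groupFold_append_of l hx]
    obtain ⟨i, j⟩ := x
    have hij : i < j := mem_orderedPairs.1 (hl.subset (by simp : (i, j) ∈ l ++ [(i, j)]))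
    have hcl := hclosed i j hij hx
    simp only
    set S : Finset (Fin p) := {i, j} with hSdef
    have hSc : (S ∩ c).Nonempty → i ∈ c ∧ S ⊆ c := by
      rintro ⟨a, ha⟩
      have ha' := Finset.mem_inter.1 ha
      have hic : i ∈ c := by
        rcases Finset.mem_insert.1 ha'.1 with h | h
        · exact h ▸ ha'.2
        · exact hcl.2 (Finset.mem_singleton.1 h ▸ ha'.2)
      refine ⟨hic, fun b hb => ?_⟩
      rcases Finset.mem_insert.1 hb with h | h
      · exact h ▸ hic
      · exact Finset.mem_singleton.1 h ▸ hcl.1 hic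
    by_cases hex : ∃ g ∈ groupFold J l, (g ∩ S).Nonempty
    · -- the merged groups meet `c` exactly when the original groups do
      have hback : ∀ g' ∈ merge S (groupFold J l), (g' ∩ c).Nonempty →
          ∃ g ∈ groupFold J l, (g ∩ c).Nonempty ∧ g ⊆ g' ∧
            g' = if (g ∩ S).Nonempty then g ∪ S else g := by
        intro g' hg' hc
        rcases mem_merge hg' with ⟨h, hn, -⟩ | ⟨g, hg, hgS, rfl⟩ | ⟨hno, -⟩
        · exact ⟨g', h, hc, subset_rfl, by rw [if_neg hn]⟩
        · refine ⟨g, hg, ?_, Finset.subset_union_left, by rw [if_pos hgS]⟩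
          obtain ⟨a, ha⟩ := hc
          have ha' := Finset.mem_inter.1 ha
          rcases Finset.mem_union.1 ha'.1 with h | h
          · exact ⟨a, Finset.mem_inter.2 ⟨h, ha'.2⟩⟩
          · have hsub := (hSc ⟨a, Finset.mem_inter.2 ⟨h, ha'.2⟩⟩).2
            obtain ⟨b, hb⟩ := hgS
            have hb' := Finset.mem_inter.1 hb
            exact ⟨b, Finset.mem_inter.2 ⟨hb'.1, hsub hb'.2⟩⟩
        · obtain ⟨g, hg, hgS⟩ := hex
          exact absurd hgS (hno g hg)
      constructor
      · intro g' hg' hc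
        obtain ⟨g, hg, hgc, hsub, -⟩ := hback g' hg' hc
        exact hsub (ih1 g hg hgc)
      · intro g₁ h₁ g₂ h₂ hc₁ hc₂
        obtain ⟨a₁, ha₁, hac₁, -, e₁⟩ := hback g₁ h₁ hc₁
        obtain ⟨a₂, ha₂, hac₂, -, e₂⟩ := hback g₂ h₂ hc₂
        rw [e₁, e₂, ih2 a₁ ha₁ a₂ ha₂ hac₁ hac₂]
    · have hno : ∀ g ∈ groupFold J l, ¬ (g ∩ S).Nonempty := fun g hg h => hex ⟨g, hg, h⟩
      have hmem : ∀ g' ∈ merge S (groupFold J l), g' = S ∨ g' ∈ groupFold J l := by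
        intro g' hg'
        rcases mem_merge hg' with ⟨-, -, h⟩ | ⟨g, hg, hgS, -⟩ | ⟨-, h⟩
        · exact absurd h hex
        · exact absurd hgS (hno g hg)
        · exact h
      -- if the new group meets `c`, it contains `i₀`
      have hi₀ : (S ∩ c).Nonempty → i₀ ∈ S := by
        intro hc
        have hic := (hSc hc).1
        by_contra hnot
        have hne : i ≠ i₀ := fun h => hnot (by simp [hSdef, h])
        have hlt : i₀ < i := lt_of_le_of_ne (hmin i hic) hne.symm
        obtain ⟨rest, hrest⟩ := hl
        have hin : (i₀, i) ∈ l := by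
          have h0 : (i₀, i) ∈ orderedPairs p := mem_orderedPairs.2 hlt
          have hpw := pairwise_orderedPairs (p := p)
          rw [← hrest, List.append_assoc] at h0 hpw
          rcases List.mem_append.1 h0 with h | h
          · exact h
          · have hpw2 := (List.pairwise_append.1 hpw).2.1
            rw [List.singleton_append] at h hpw2
            rcases List.mem_cons.1 h with h | h
            · exact absurd (congrArg Prod.fst h).symm hne
            · exact absurd ((List.pairwise_cons.1 hpw2).1 _ h) (not_le.2 hlt)
        obtain ⟨g, hg, -, h2⟩ := groupFold_cover l (i₀, i) hin (hjoin i hic hne)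
        exact hno g hg ⟨i, Finset.mem_inter.2 ⟨h2, by simp [hSdef]⟩⟩
      have hold : (S ∩ c).Nonempty → ∀ g ∈ groupFold J l, ¬ (g ∩ c).Nonempty := by
        intro hc g hg hgc
        exact hno g hg ⟨i₀, Finset.mem_inter.2 ⟨ih1 g hg hgc, hi₀ hc⟩⟩
      constructor
      · intro g' hg' hc
        rcases hmem g' hg' with rfl | h
        · exact hi₀ hc
        · exact ih1 g' h hc
      · intro g₁ h₁ g₂ h₂ hc₁ hc₂
        rcases hmem g₁ h₁ with rfl | h₁
        · rcases hmem g₂ h₂ with rfl | h₂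
          · rfl
          · exact absurd hc₂ (hold hc₁ g₂ h₂)
        · rcases hmem g₂ h₂ with rfl | h₂
          · exact absurd hc₁ (hold hc₂ g₁ h₁)
          · exact ih2 g₁ h₁ g₂ h₂ hc₁ hc₂

/-- A class all of whose pairs are joined, and that is joined to nothing else, is one of the
groups, and it is the only group that meets it. -/
theorem groupFold_eq_class {J : Fin p × Fin p → Prop} {c : Finset (Fin p)}
    (hcard : ∃ i ∈ c, ∃ j ∈ c, i ≠ j)
    (hclosed : ∀ i j, i < j → J (i, j) → (i ∈ c ↔ j ∈ c))
    (hjoin : ∀ i ∈ c, ∀ j ∈ c, i < j → J (i, j)) :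
    c ∈ groupFold J (orderedPairs p) ∧
      ∀ g ∈ groupFold J (orderedPairs p), (g ∩ c).Nonempty → g = c := by
  classical
  obtain ⟨i, hi, j, hj, hij⟩ := hcard
  have hne : c.Nonempty := ⟨i, hi⟩
  set i₀ := c.min' hne with hi₀
  have hmem : i₀ ∈ c := c.min'_mem hne
  have hmin : ∀ i ∈ c, i₀ ≤ i := fun i hi => c.min'_le i hi
  have hjoin' : ∀ j ∈ c, j ≠ i₀ → J (i₀, j) := fun j hj hne =>
    hjoin i₀ hmem j hj (lt_of_le_of_ne (hmin j hj) hne.symm)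
  obtain ⟨-, hu⟩ := groupFold_unique hmin hclosed hjoin' (orderedPairs p) List.prefix_rfl
  have hcl := groupFold_class (J := J) (fun a => (a ∈ c : Prop)) (orderedPairs p)
    (fun x hx hJ => propext (hclosed x.1 x.2 (mem_orderedPairs.1 hx) hJ))
  have hcover : ∀ j ∈ c, j ≠ i₀ → ∃ g ∈ groupFold J (orderedPairs p), i₀ ∈ g ∧ j ∈ g := by
    intro j hj hne
    exact groupFold_cover (orderedPairs p) (i₀, j)
      (mem_orderedPairs.2 (lt_of_le_of_ne (hmin j hj) hne.symm)) (hjoin' j hj hne)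
  have hex : ∃ j ∈ c, j ≠ i₀ := by
    by_cases h : i = i₀
    · exact ⟨j, hj, fun h' => hij (h.trans h'.symm)⟩
    · exact ⟨i, hi, h⟩
  obtain ⟨j₁, hj₁, hj₁ne⟩ := hex
  obtain ⟨g, hg, hg0, -⟩ := hcover j₁ hj₁ hj₁ne
  have hmeet : ∀ g : Finset (Fin p), i₀ ∈ g → (g ∩ c).Nonempty := fun g h =>
    ⟨i₀, Finset.mem_inter.2 ⟨h, hmem⟩⟩
  have hgc : g = c := by
    apply Finset.Subset.antisymm
    · intro a ha
      have := hcl g hg a ha i₀ hg0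
      exact this.symm ▸ hmem
    · intro a ha
      by_cases h : a = i₀
      · exact h ▸ hg0
      · obtain ⟨g', hg', h0, ha'⟩ := hcover a ha h
        rw [hu g hg g' hg' (hmeet g hg0) (hmeet g' h0)]
        exact ha'
  refine ⟨hgc ▸ hg, fun g' hg' h => ?_⟩
  rw [hu g' hg' g hg h (hmeet g hg0), hgc]

end Merge

/-! ### Bernstein's inequality for squares of sub-Gaussian variables -/

section Scalar

theorem factorial_two_mul_le (k : ℕ) : (2 * k).factorial ≤ k.factorial * (2 * k) ^ k := by
  rw [two_mul, ← Nat.factorial_mul_ascFactorial]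
  exact Nat.mul_le_mul_left _ (Nat.ascFactorial_le_pow_add k k)

theorem exp_le_one_add_add_sq_mul_exp_abs (y : ℝ) :
    Real.exp y ≤ 1 + y + y ^ 2 * Real.exp |y| := by
  rcases le_or_gt |y| 1 with h | h
  · have h1 := (abs_le.1 (Real.abs_exp_sub_one_sub_id_le h)).2
    have h2 : 1 ≤ Real.exp |y| := Real.one_le_exp (abs_nonneg y)
    nlinarith [sq_nonneg y]
  · have hy2 : 1 < y ^ 2 := by rw [← sq_abs]; nlinarith
    rcases lt_or_ge 0 y with h0 | h0
    · rw [abs_of_pos h0]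
      nlinarith [Real.exp_pos y]
    · rw [abs_of_nonpos h0] at *
      have h2 : 1 ≤ Real.exp (-y) := Real.one_le_exp (by linarith)
      have h3 : Real.exp y ≤ 1 := Real.exp_le_one_iff.2 h0
      nlinarith [mul_le_mul_of_nonneg_left h2 (sq_nonneg y)]

variable {Ω : Type*} [MeasurableSpace Ω] {P : Measure Ω} {γ : ℝ}

/-- The even moments of a sub-Gaussian variable, from one term of the series of `cosh`. -/
theorem lintegral_pow_le_of_subGaussian {Y : Ω → ℝ} (hγ : 0 < γ)
    (hint : ∀ t, Integrable (fun ω => Real.exp (t * Y ω)) P)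
    (hle : ∀ t, ∫ ω, Real.exp (t * Y ω) ∂P ≤ Real.exp (t ^ 2 * γ ^ 2 / 2)) (k : ℕ) :
    ∫⁻ ω, ENNReal.ofReal (Y ω ^ (2 * k) / k.factorial) ∂P ≤
      ENNReal.ofReal ((Real.exp 1 * γ ^ 2) ^ k) := by
  rcases Nat.eq_zero_or_pos k with rfl | hk
  · have h0 := hle 0
    have hi0 := hint 0
    simp only [zero_mul, Real.exp_zero] at h0 hi0
    have : ∫⁻ ω, ENNReal.ofReal 1 ∂P = ENNReal.ofReal (∫ ω, (1 : ℝ) ∂P) :=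
      (ofReal_integral_eq_lintegral_ofReal hi0 (Eventually.of_forall fun _ => zero_le_one)).symm
    simp only [mul_zero, pow_zero, Nat.factorial_zero, Nat.cast_one, div_one]
    rw [this]
    apply ENNReal.ofReal_le_ofReal
    simpa using h0
  have hk' : (0 : ℝ) < k := Nat.cast_pos.2 hk
  -- the choice of the parameter that makes the bound for `E Y ^ (2 * k)` smallest
  set t : ℝ := √(2 * k / γ ^ 2) with ht
  have ht2 : t ^ 2 = 2 * k / γ ^ 2 := Real.sq_sqrt (by positivity)
  have hcosh_int : Integrable (fun ω => (Real.exp (t * Y ω) + Real.exp (-t * Y ω)) / 2) P :=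
    ((hint t).add (hint (-t))).div_const 2
  have hcosh : ∫ ω, (Real.exp (t * Y ω) + Real.exp (-t * Y ω)) / 2 ∂P ≤ Real.exp k := by
    rw [integral_div, integral_add (hint t) (hint (-t))]
    have e : t ^ 2 * γ ^ 2 / 2 = k := by rw [ht2]; field_simp
    have h1 := hle t
    have h2 := hle (-t)
    rw [neg_sq] at h2
    rw [e] at h1 h2
    linarith
  have hpt : ∀ ω, Y ω ^ (2 * k) / k.factorial ≤
      γ ^ (2 * k) * ((Real.exp (t * Y ω) + Real.exp (-t * Y ω)) / 2) := by
    intro ω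
    have h1 : (t * Y ω) ^ (2 * k) / (2 * k).factorial ≤ Real.cosh (t * Y ω) := by
      rw [Real.cosh_eq_tsum]
      refine (Real.hasSum_cosh (t * Y ω)).summable.le_tsum k fun j _ => ?_
      rw [pow_mul]; positivity
    rw [Real.cosh_eq, ← neg_mul] at h1
    set D := (Real.exp (t * Y ω) + Real.exp (-t * Y ω)) / 2
    have h2 : ((2 * k).factorial : ℝ) ≤ k.factorial * (2 * k) ^ k := by
      exact_mod_cast factorial_two_mul_le k
    have h3 : (t * Y ω) ^ (2 * k) = (2 * k / γ ^ 2) ^ k * Y ω ^ (2 * k) := by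
      rw [mul_pow, pow_mul t, ht2]
    rw [h3, div_le_iff₀ (by positivity)] at h1
    have hD : 0 ≤ D := by positivity
    have h4 : (2 * k / γ ^ 2 : ℝ) ^ k * Y ω ^ (2 * k) ≤ D * (k.factorial * (2 * k) ^ k) :=
      h1.trans (mul_le_mul_of_nonneg_left h2 hD)
    rw [div_pow, ← pow_mul, div_mul_eq_mul_div, div_le_iff₀ (by positivity)] at h4
    rw [div_le_iff₀ (by positivity)]
    have h5 : (0 : ℝ) < (2 * k) ^ k := by positivity
    refine le_of_mul_le_mul_left ?_ h5
    linarith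
  calc ∫⁻ ω, ENNReal.ofReal (Y ω ^ (2 * k) / k.factorial) ∂P
      ≤ ∫⁻ ω, ENNReal.ofReal
          (γ ^ (2 * k) * ((Real.exp (t * Y ω) + Real.exp (-t * Y ω)) / 2)) ∂P :=
        lintegral_mono fun ω => ENNReal.ofReal_le_ofReal (hpt ω)
    _ = ENNReal.ofReal
          (∫ ω, γ ^ (2 * k) * ((Real.exp (t * Y ω) + Real.exp (-t * Y ω)) / 2) ∂P) :=
        (ofReal_integral_eq_lintegral_ofReal (hcosh_int.const_mul _)
          (Eventually.of_forall fun ω => by simp only [Pi.zero_apply]; positivity)).symm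
    _ ≤ ENNReal.ofReal ((Real.exp 1 * γ ^ 2) ^ k) := by
        apply ENNReal.ofReal_le_ofReal
        rw [integral_const_mul, mul_pow, ← Real.exp_nat_mul, mul_one, ← pow_mul, mul_comm]
        exact mul_le_mul_of_nonneg_right hcosh (by positivity)

/-- The square of a sub-Gaussian variable has exponential moments: in the series of `exp (A Y²)`,
the moment bound turns the `k`-th term into at most `2⁻ᵏ`. -/
theorem integrable_exp_sq_of_subGaussian {Y : Ω → ℝ} (hY : AEMeasurable Y P) (hγ : 0 < γ)
    (hint : ∀ t, Integrable (fun ω => Real.exp (t * Y ω)) P)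
    (hle : ∀ t, ∫ ω, Real.exp (t * Y ω) ∂P ≤ Real.exp (t ^ 2 * γ ^ 2 / 2)) {A : ℝ}
    (hA : A = 1 / (2 * Real.exp 1 * γ ^ 2)) :
    Integrable (fun ω => Real.exp (A * Y ω ^ 2)) P ∧
      ∫ ω, Real.exp (A * Y ω ^ 2) ∂P ≤ 2 := by
  have hA0 : 0 < A := by rw [hA]; positivity
  have hmeas : AEStronglyMeasurable (fun ω => Real.exp (A * Y ω ^ 2)) P :=
    (Real.measurable_exp.comp_aemeasurable ((hY.pow_const 2).const_mul A)).aestronglyMeasurable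
  have hlint : ∫⁻ ω, ENNReal.ofReal (Real.exp (A * Y ω ^ 2)) ∂P ≤ 2 := by
    have hser : ∀ ω, ENNReal.ofReal (Real.exp (A * Y ω ^ 2)) =
        ∑' k : ℕ, ENNReal.ofReal (A ^ k) * ENNReal.ofReal (Y ω ^ (2 * k) / k.factorial) := by
      intro ω
      have hs := NormedSpace.expSeries_div_hasSum_exp (A * Y ω ^ 2)
      rw [← Real.exp_eq_exp_ℝ] at hs
      rw [← hs.tsum_eq, ENNReal.ofReal_tsum_of_nonneg (fun k => by positivity) hs.summable]
      refine tsum_congr fun k => ?_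
      rw [← ENNReal.ofReal_mul (by positivity), mul_pow, ← pow_mul, mul_div_assoc]
    calc ∫⁻ ω, ENNReal.ofReal (Real.exp (A * Y ω ^ 2)) ∂P
        = ∑' k : ℕ, ENNReal.ofReal (A ^ k) *
            ∫⁻ ω, ENNReal.ofReal (Y ω ^ (2 * k) / k.factorial) ∂P := by
          simp_rw [hser]
          rw [lintegral_tsum]
          · refine tsum_congr fun k => ?_
            rw [lintegral_const_mul' _ _ ENNReal.ofReal_ne_top]
          · intro k
            exact (((hY.pow_const _).div_const _).ennreal_ofReal).const_mul _
      _ ≤ ∑' k : ℕ, (2⁻¹ : ℝ≥0∞) ^ k := by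
          refine ENNReal.tsum_le_tsum fun k => ?_
          calc ENNReal.ofReal (A ^ k) * ∫⁻ ω, ENNReal.ofReal (Y ω ^ (2 * k) / k.factorial) ∂P
              ≤ ENNReal.ofReal (A ^ k) * ENNReal.ofReal ((Real.exp 1 * γ ^ 2) ^ k) := by
                gcongr
                exact lintegral_pow_le_of_subGaussian hγ hint hle k
            _ = (2⁻¹ : ℝ≥0∞) ^ k := by
                rw [← ENNReal.ofReal_mul (by positivity), ← mul_pow]
                have : A * (Real.exp 1 * γ ^ 2) = 2⁻¹ := by rw [hA]; field_simp
                rw [this, ENNReal.ofReal_pow (by positivity),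
                  ENNReal.ofReal_inv_of_pos (by norm_num)]
                simp
      _ = 2 := by rw [ENNReal.tsum_geometric, ENNReal.one_sub_inv_two, inv_inv]
  have hI : Integrable (fun ω => Real.exp (A * Y ω ^ 2)) P := by
    refine ⟨hmeas, ?_⟩
    rw [hasFiniteIntegral_iff_ofReal (Eventually.of_forall fun ω => (Real.exp_pos _).le)]
    exact hlint.trans_lt (by simp)
  refine ⟨hI, ?_⟩
  rw [integral_eq_lintegral_of_nonneg_ae (Eventually.of_forall fun ω => (Real.exp_pos _).le) hmeas]
  exact ENNReal.toReal_le_of_le_ofReal (by norm_num) (by simpa using hlint)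

/-- The centred square of a sub-Gaussian variable is sub-exponential. -/
theorem mgf_sq_sub_one_le {Y : Ω → ℝ} [IsProbabilityMeasure P] (hY : AEMeasurable Y P) (hγ : 0 < γ)
    (hint : ∀ t, Integrable (fun ω => Real.exp (t * Y ω)) P)
    (hle : ∀ t, ∫ ω, Real.exp (t * Y ω) ∂P ≤ Real.exp (t ^ 2 * γ ^ 2 / 2))
    (hvar : ∫ ω, Y ω ^ 2 ∂P = 1) {A : ℝ}
    (hA : A = 1 / (2 * Real.exp 1 * γ ^ 2)) {θ : ℝ} (hθ : |θ| ≤ A / 2) :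
    Integrable (fun ω => Real.exp (θ * (Y ω ^ 2 - 1))) P ∧
      mgf (fun ω => Y ω ^ 2 - 1) P θ ≤ Real.exp (16 * Real.exp A / A ^ 2 * θ ^ 2) := by
  have hA0 : 0 < A := by rw [hA]; positivity
  obtain ⟨hI, hI2⟩ := integrable_exp_sq_of_subGaussian hY hγ hint hle hA
  -- `Y ^ 2` is integrable, as otherwise its integral would be the junk value `0`, not `1`
  have hsq : Integrable (fun ω => Y ω ^ 2) P := by
    by_contra h
    rw [integral_undef h] at hvar
    norm_num at hvar
  have hpt : ∀ ω, Real.exp (θ * (Y ω ^ 2 - 1)) ≤ 1 + θ * (Y ω ^ 2 - 1) +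
      8 * θ ^ 2 / A ^ 2 * Real.exp A * Real.exp (A * Y ω ^ 2) := by
    intro ω
    refine (exp_le_one_add_add_sq_mul_exp_abs _).trans ?_
    refine add_le_add_right ?_ _
    set x := Y ω ^ 2 + 1 with hx
    have hx0 : 0 ≤ x := by positivity
    have h1 : |θ * (Y ω ^ 2 - 1)| ≤ A / 2 * x := by
      rw [abs_mul]
      refine mul_le_mul hθ ?_ (abs_nonneg _) (by positivity)
      rw [abs_le]; constructor <;> nlinarith [sq_nonneg (Y ω)]
    have h2 : (Y ω ^ 2 - 1) ^ 2 ≤ x ^ 2 := by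
      rw [hx]; nlinarith [sq_nonneg (Y ω)]
    have h3 : x ^ 2 ≤ 8 / A ^ 2 * Real.exp (A / 2 * x) := by
      have := Real.quadratic_le_exp_of_nonneg (x := A / 2 * x) (by positivity)
      have h4 : (A / 2 * x) ^ 2 / 2 ≤ Real.exp (A / 2 * x) := by
        have : 0 ≤ A / 2 * x := by positivity
        linarith
      rw [div_mul_eq_mul_div, le_div_iff₀ (by positivity)]
      nlinarith
    calc (θ * (Y ω ^ 2 - 1)) ^ 2 * Real.exp |θ * (Y ω ^ 2 - 1)|
        ≤ (θ ^ 2 * (8 / A ^ 2 * Real.exp (A / 2 * x))) * Real.exp (A / 2 * x) := by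
          refine mul_le_mul ?_ (Real.exp_le_exp.2 h1) (Real.exp_pos _).le (by positivity)
          rw [mul_pow]
          exact mul_le_mul_of_nonneg_left (h2.trans h3) (sq_nonneg θ)
      _ = 8 * θ ^ 2 / A ^ 2 * (Real.exp (A / 2 * x) * Real.exp (A / 2 * x)) := by ring
      _ = 8 * θ ^ 2 / A ^ 2 * Real.exp A * Real.exp (A * Y ω ^ 2) := by
          rw [← Real.exp_add, mul_assoc, ← Real.exp_add]
          congr 2
          rw [hx]; ring
  have hdom : Integrable (fun ω => 1 + θ * (Y ω ^ 2 - 1) +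
      8 * θ ^ 2 / A ^ 2 * Real.exp A * Real.exp (A * Y ω ^ 2)) P :=
    ((integrable_const _).add ((hsq.sub (integrable_const _)).const_mul _)).add (hI.const_mul _)
  have hint' : Integrable (fun ω => Real.exp (θ * (Y ω ^ 2 - 1))) P := by
    refine hdom.mono' ?_ (Eventually.of_forall fun ω => ?_)
    · exact (Real.measurable_exp.comp_aemeasurable
        (((hY.pow_const 2).sub_const 1).const_mul θ)).aestronglyMeasurable
    · rw [Real.norm_eq_abs, abs_of_pos (Real.exp_pos _)]; exact hpt ω
  refine ⟨hint', ?_⟩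
  calc mgf (fun ω => Y ω ^ 2 - 1) P θ
      ≤ ∫ ω, (1 + θ * (Y ω ^ 2 - 1) +
          8 * θ ^ 2 / A ^ 2 * Real.exp A * Real.exp (A * Y ω ^ 2)) ∂P :=
        integral_mono hint' hdom hpt
    _ = 1 + 8 * θ ^ 2 / A ^ 2 * Real.exp A * ∫ ω, Real.exp (A * Y ω ^ 2) ∂P := by
        have i1 : Integrable (fun ω => θ * (Y ω ^ 2 - 1)) P :=
          (hsq.sub (integrable_const 1)).const_mul θ
        have i2 : Integrable (fun ω => 1 + θ * (Y ω ^ 2 - 1)) P := (integrable_const 1).add i1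
        rw [integral_add i2 (hI.const_mul _), integral_add (integrable_const _) i1,
          integral_const_mul, integral_const_mul, integral_sub hsq (integrable_const _), hvar]
        simp
    _ ≤ 1 + 8 * θ ^ 2 / A ^ 2 * Real.exp A * 2 := by gcongr
    _ = 16 * Real.exp A / A ^ 2 * θ ^ 2 + 1 := by ring
    _ ≤ Real.exp (16 * Real.exp A / A ^ 2 * θ ^ 2) := Real.add_one_le_exp _

/-- Chernoff's bound for a sum of independent variables with `E exp (θ X) ≤ exp (Λ θ ^ 2)`. -/
theorem measureReal_sum_ge_le [IsProbabilityMeasure P] {n : ℕ} {X : Fin n → Ω → ℝ} {Λ θ η : ℝ}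
    (hind : iIndepFun X P) (hm : ∀ t, AEMeasurable (X t) P) (hθ : 0 ≤ θ)
    (hint : ∀ t, Integrable (fun ω => Real.exp (θ * X t ω)) P)
    (hmgf : ∀ t, mgf (X t) P θ ≤ Real.exp (Λ * θ ^ 2)) :
    P.real {ω | n * η ≤ ∑ t, X t ω} ≤ Real.exp (-(n * (θ * η - Λ * θ ^ 2))) := by
  have hsum := hind.mgf_sum₀ (t := θ) hm Finset.univ
  have hpos : ∀ t, 0 < mgf (X t) P θ := fun t => mgf_pos (hint t)
  have hI : Integrable (fun ω => Real.exp (θ * (∑ t, X t) ω)) P := by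
    by_contra h
    rw [mgf_undef h] at hsum
    exact (Finset.prod_pos fun t _ => hpos t).ne hsum
  have h1 := measure_ge_le_exp_mul_mgf (X := ∑ t, X t) (n * η) hθ hI
  simp only [Finset.sum_apply] at h1
  refine h1.trans ?_
  rw [hsum]
  have h2 : ∏ t, mgf (X t) P θ ≤ Real.exp (Λ * θ ^ 2) ^ n := by
    calc ∏ t, mgf (X t) P θ ≤ ∏ _t : Fin n, Real.exp (Λ * θ ^ 2) :=
          Finset.prod_le_prod (fun t _ => (hpos t).le) fun t _ => hmgf t
      _ = _ := by simp
  calc Real.exp (-θ * (n * η)) * ∏ t, mgf (X t) P θ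
      ≤ Real.exp (-θ * (n * η)) * Real.exp (Λ * θ ^ 2) ^ n :=
        mul_le_mul_of_nonneg_left h2 (Real.exp_pos _).le
    _ = Real.exp (-(n * (θ * η - Λ * θ ^ 2))) := by
        rw [← Real.exp_nat_mul, ← Real.exp_add]; congr 1; ring

/-- Two-sided deviation bound for the empirical second moment of a sub-Gaussian variable with unit
second moment. -/
theorem measureReal_sum_sq_sub_one_le [IsProbabilityMeasure P] {n : ℕ} {Y : Fin n → Ω → ℝ}
    (hind : iIndepFun Y P) (hm : ∀ t, AEMeasurable (Y t) P) (hγ : 0 < γ)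
    (hint : ∀ i t, Integrable (fun ω => Real.exp (t * Y i ω)) P)
    (hle : ∀ i t, ∫ ω, Real.exp (t * Y i ω) ∂P ≤ Real.exp (t ^ 2 * γ ^ 2 / 2))
    (hvar : ∀ i, ∫ ω, Y i ω ^ 2 ∂P = 1) {A : ℝ}
    (hA : A = 1 / (2 * Real.exp 1 * γ ^ 2)) {θ η : ℝ} (hθ0 : 0 ≤ θ) (hθ : θ ≤ A / 2) :
    P.real {ω | n * η ≤ |∑ t, (Y t ω ^ 2 - 1)|} ≤
      2 * Real.exp (-(n * (θ * η - 16 * Real.exp A / A ^ 2 * θ ^ 2))) := by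
  have hsub : {ω | n * η ≤ |∑ t, (Y t ω ^ 2 - 1)|} ⊆
      {ω | n * η ≤ ∑ t, (Y t ω ^ 2 - 1)} ∪ {ω | n * η ≤ ∑ t, -(Y t ω ^ 2 - 1)} := by
    intro ω hω
    simp only [Set.mem_ofPred_eq, Set.mem_union, Finset.sum_neg_distrib] at *
    exact le_abs.1 hω
  have h1 := fun i => mgf_sq_sub_one_le (hm i) hγ (hint i) (hle i) (hvar i) hA
    (θ := θ) (by rwa [abs_of_nonneg hθ0])
  have h2 := fun i => mgf_sq_sub_one_le (hm i) hγ (hint i) (hle i) (hvar i) hA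
    (θ := -θ) (by rwa [abs_neg, abs_of_nonneg hθ0])
  have b1 := measureReal_sum_ge_le (X := fun t ω => Y t ω ^ 2 - 1) (η := η)
    (hind.comp (fun _ y => y ^ 2 - 1) fun _ => by fun_prop)
    (fun t => ((hm t).pow_const 2).sub_const 1) hθ0 (fun i => (h1 i).1) (fun i => (h1 i).2)
  have b2 := measureReal_sum_ge_le (X := fun t ω => -(Y t ω ^ 2 - 1)) (η := η)
    (Λ := 16 * Real.exp A / A ^ 2)
    (hind.comp (fun _ y => -(y ^ 2 - 1)) fun _ => by fun_prop)
    (fun t => (((hm t).pow_const 2).sub_const 1).neg) hθ0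
    (fun i => (h2 i).1.congr (Eventually.of_forall fun ω => by simp only [mul_neg, neg_mul]))
    (fun i => by
      have h := (h2 i).2
      rw [neg_sq] at h
      refine le_trans (le_of_eq ?_) h
      simp only [mgf, mul_neg, neg_mul])
  calc P.real _ ≤ P.real _ := measureReal_mono hsub
    _ ≤ _ := measureReal_union_le _ _
    _ ≤ _ := by linarith

end Scalar

/-! ### Quadratic forms on a grid -/

section Net

/-- Rounding of `m * y` towards zero. -/
def truncInt (m : ℕ) (y : ℝ) : ℤ := if 0 ≤ y then ⌊m * y⌋ else ⌈m * y⌉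

/-- Rounding towards zero does not increase the norm, which keeps the grid inside the unit ball. -/
theorem truncInt_spec {m : ℕ} (hm : 0 < m) {y : ℝ} (hy : |y| ≤ 1) :
    truncInt m y ∈ Finset.Icc (-(m : ℤ)) m ∧ |(truncInt m y : ℝ) / m| ≤ |y| ∧
      |y - (truncInt m y : ℝ) / m| ≤ 1 / m := by
  have hm' : (0 : ℝ) < m := Nat.cast_pos.2 hm
  obtain ⟨hy1, hy2⟩ := abs_le.1 hy
  unfold truncInt
  split_ifs with h
  · have h1 := Int.floor_le (m * y)
    have h2 := Int.lt_floor_add_one (m * y)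
    have h0 : 0 ≤ ⌊m * y⌋ := Int.floor_nonneg.2 (by positivity)
    have h0' : (0 : ℝ) ≤ ⌊m * y⌋ := by exact_mod_cast h0
    refine ⟨Finset.mem_Icc.2 ⟨by omega, ?_⟩, ?_, ?_⟩
    · have : (⌊m * y⌋ : ℝ) ≤ (m : ℤ) := by
        push_cast; nlinarith
      exact_mod_cast this
    · rw [abs_of_nonneg (by positivity), abs_of_nonneg h, div_le_iff₀ hm']
      linarith
    · rw [abs_le]
      constructor
      · have : (⌊m * y⌋ : ℝ) / m ≤ y := by rw [div_le_iff₀ hm']; linarith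
        have : 0 < 1 / (m : ℝ) := by positivity
        linarith
      · rw [sub_le_iff_le_add, ← add_div, le_div_iff₀ hm']; linarith
  · push Not at h
    have h1 := Int.le_ceil (m * y)
    have h2 := Int.ceil_lt_add_one (m * y)
    have h0 : ⌈m * y⌉ ≤ 0 := Int.ceil_le.2 (by push_cast; nlinarith)
    have h0' : (⌈m * y⌉ : ℝ) ≤ 0 := by exact_mod_cast h0
    refine ⟨Finset.mem_Icc.2 ⟨?_, by omega⟩, ?_, ?_⟩
    · have : ((-(m : ℤ) : ℤ) : ℝ) ≤ (⌈m * y⌉ : ℝ) := by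
        push_cast; nlinarith
      exact_mod_cast this
    · rw [abs_of_nonpos (div_nonpos_of_nonpos_of_nonneg h0' hm'.le), abs_of_neg h, neg_le_neg_iff,
        le_div_iff₀ hm']
      linarith
    · rw [abs_le]
      constructor
      · have : (⌈m * y⌉ : ℝ) / m ≤ y + 1 / m := by
          rw [div_le_iff₀ hm', add_mul, one_div_mul_cancel hm'.ne']; linarith
        linarith
      · have : y ≤ (⌈m * y⌉ : ℝ) / m := by rw [le_div_iff₀ hm']; linarith
        have : 0 < 1 / (m : ℝ) := by positivity
        linarith

/-- A quadratic form on a space of dimension at most `s` is controlled by its values on a finite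
grid. The grid has `s ^ s` points up to constants rather than `C ^ s`, which costs nothing in a
union bound that already pays for the choice of `s` coordinates. -/
theorem exists_grid {F : Type*} [NormedAddCommGroup F] [InnerProductSpace ℝ F]
    [FiniteDimensional ℝ F] (V : Submodule ℝ F) {s : ℕ} (hs : 1 ≤ s)
    (hV : Module.finrank ℝ V ≤ s) :
    ∃ N : Finset F, N.card ≤ (8 * s + 1) ^ s ∧
      ∀ Q : F →ₗ[ℝ] F →ₗ[ℝ] ℝ, (∀ v w, Q v w = Q w v) → ∀ t : ℝ, 0 ≤ t →
        (∀ v ∈ N, |Q v v| ≤ t * ‖v‖ ^ 2) → ∀ v ∈ V, |Q v v| ≤ 3 * t * ‖v‖ ^ 2 := by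
  classical
  set d := Module.finrank ℝ V
  let b := stdOrthonormalBasis ℝ V
  set m : ℕ := 4 * s with hm
  have hm0 : 0 < m := by omega
  have hmR : (0 : ℝ) < m := Nat.cast_pos.2 hm0
  let comb : (Fin d → ℝ) → F := fun c => ∑ i, c i • (b i : F)
  have hcombV : ∀ c, comb c ∈ V := fun c =>
    Submodule.sum_mem _ fun i _ => Submodule.smul_mem _ _ (b i).2
  have hnorm : ∀ c, ‖comb c‖ ^ 2 = ∑ i, c i ^ 2 := by
    intro c
    have h1 : comb c = ((∑ i, c i • b i : V) : F) := by simp [comb]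
    have h2 := b.orthonormal.inner_sum c c Finset.univ
    rw [h1, ← Submodule.coe_norm, ← real_inner_self_eq_norm_sq, h2]
    simp [sq]
    rfl
  have hrep : ∀ v ∈ V, ∃ c, comb c = v := by
    intro v hv
    refine ⟨fun i => inner ℝ (b i) (⟨v, hv⟩ : V), ?_⟩
    have h := congrArg (Subtype.val) (b.sum_repr' (⟨v, hv⟩ : V))
    simpa [comb] using h
  let N : Finset F := (Fintype.piFinset fun _ : Fin d => Finset.Icc (-(m : ℤ)) m).image
    fun z => comb fun i => (z i : ℝ) / m
  refine ⟨N, ?_, ?_⟩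
  · calc N.card ≤ (Fintype.piFinset fun _ : Fin d => Finset.Icc (-(m : ℤ)) m).card :=
          Finset.card_image_le
      _ = (8 * s + 1) ^ d := by
          rw [Fintype.card_piFinset]
          simp only [Int.card_Icc, Finset.prod_const, Finset.card_univ, Fintype.card_fin]
          congr 1
          omega
      _ ≤ (8 * s + 1) ^ s := Nat.pow_le_pow_right (by omega) hV
  intro Q hQ t ht hN
  obtain ⟨C, hC0, hC⟩ : ∃ C : ℝ, 0 ≤ C ∧ ∀ v, |Q v v| ≤ C * ‖v‖ ^ 2 := by
    let Q' : F →L[ℝ] F →L[ℝ] ℝ := LinearMap.toContinuousLinearMap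
      ((LinearMap.toContinuousLinearMap : (F →ₗ[ℝ] ℝ) ≃ₗ[ℝ] (F →L[ℝ] ℝ)).toLinearMap ∘ₗ Q)
    refine ⟨‖Q'‖, norm_nonneg Q', fun v => ?_⟩
    have := Q'.le_opNorm₂ v v
    rw [Real.norm_eq_abs, mul_assoc, ← sq] at this
    exact this
  set S : Set ℝ := {r | ∃ v ∈ V, ‖v‖ ≤ 1 ∧ r = |Q v v|} with hS
  have hbdd : BddAbove S := by
    refine ⟨C, ?_⟩
    rintro r ⟨v, -, hv, rfl⟩
    refine (hC v).trans ?_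
    have : ‖v‖ ^ 2 ≤ 1 := pow_le_one₀ (norm_nonneg _) hv
    nlinarith
  have hne : S.Nonempty := ⟨0, 0, V.zero_mem, by simp, by simp⟩
  set q := sSup S with hq
  have hq0 : 0 ≤ q := le_csSup hbdd ⟨0, V.zero_mem, by simp, by simp⟩
  have hqv : ∀ v ∈ V, |Q v v| ≤ q * ‖v‖ ^ 2 := by
    intro v hv
    by_cases hv0 : v = 0
    · simp [hv0]
    have hpos : 0 < ‖v‖ := norm_pos_iff.2 hv0
    have h1 : |Q (‖v‖⁻¹ • v) (‖v‖⁻¹ • v)| ≤ q :=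
      le_csSup hbdd ⟨_, V.smul_mem _ hv, by
        rw [norm_smul, norm_inv, norm_norm, inv_mul_cancel₀ hpos.ne'], rfl⟩
    simp only [map_smul, LinearMap.smul_apply, smul_eq_mul, abs_mul, abs_inv, abs_norm] at h1
    rw [← mul_assoc, ← sq, inv_pow, inv_mul_le_iff₀ (by positivity)] at h1
    linarith
  -- rounding a point of the unit ball changes the form by a fraction of the supremum `q` itself
  have hstep : q ≤ t + 5 / 8 * q := by
    refine csSup_le hne ?_
    rintro r ⟨v, hv, hv1, rfl⟩
    obtain ⟨c, rfl⟩ := hrep v hv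
    have hc1 : ∑ i, c i ^ 2 ≤ 1 := by
      rw [← hnorm]; exact pow_le_one₀ (norm_nonneg _) hv1
    have hci : ∀ i, |c i| ≤ 1 := by
      intro i
      rw [← sq_le_one_iff_abs_le_one]
      exact (Finset.single_le_sum (f := fun i => c i ^ 2) (fun i _ => sq_nonneg _)
        (Finset.mem_univ i)).trans hc1
    have hsp := fun i => truncInt_spec hm0 (hci i)
    set w := comb fun i => (truncInt m (c i) : ℝ) / m with hw
    have hwV : w ∈ V := hcombV _
    have hwN : w ∈ N := Finset.mem_image.2
      ⟨fun i => truncInt m (c i), Fintype.mem_piFinset.2 fun i => (hsp i).1, rfl⟩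
    have hw1 : ‖w‖ ^ 2 ≤ 1 := by
      rw [hw, hnorm]
      refine le_trans (Finset.sum_le_sum fun i _ => ?_) hc1
      exact sq_le_sq.2 (hsp i).2.1
    have hdiff : ‖comb c - w‖ ^ 2 ≤ 1 / 16 := by
      have : comb c - w = comb fun i => c i - (truncInt m (c i) : ℝ) / m := by
        simp only [hw, comb, sub_smul, Finset.sum_sub_distrib]
      rw [this, hnorm]
      calc ∑ i, (c i - (truncInt m (c i) : ℝ) / m) ^ 2 ≤ ∑ _i : Fin d, (1 / (m : ℝ)) ^ 2 := by
            refine Finset.sum_le_sum fun i _ => ?_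
            rw [← sq_abs]
            exact pow_le_pow_left₀ (abs_nonneg _) (hsp i).2.2 2
        _ = d * (1 / (m : ℝ)) ^ 2 := by simp
        _ ≤ s * (1 / (m : ℝ)) ^ 2 := by gcongr
        _ ≤ 1 / 16 := by
            rw [hm]; push_cast
            have : (1 : ℝ) ≤ s := by exact_mod_cast hs
            rw [div_pow, one_pow, mul_one_div, div_le_div_iff₀ (by positivity) (by norm_num)]
            nlinarith
    have hsum : ‖comb c + w‖ ^ 2 ≤ 4 := by
      have h1 : ‖w‖ ≤ 1 := by
        rw [← abs_of_nonneg (norm_nonneg w)]; exact sq_le_one_iff_abs_le_one _ |>.1 hw1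
      have := norm_add_le (comb c) w
      have h0 := norm_nonneg (comb c + w)
      nlinarith
    -- `Q v v - Q w w = Q (v - w) (v + w)`, bounded by polarization after rescaling
    have hpol : Q (comb c) (comb c) - Q w w =
        (Q ((2 : ℝ) • (comb c - w) + (1 / 2 : ℝ) • (comb c + w))
            ((2 : ℝ) • (comb c - w) + (1 / 2 : ℝ) • (comb c + w)) -
          Q ((2 : ℝ) • (comb c - w) - (1 / 2 : ℝ) • (comb c + w))
            ((2 : ℝ) • (comb c - w) - (1 / 2 : ℝ) • (comb c + w))) / 4 := by
      simp only [map_add, map_sub, map_smul, LinearMap.add_apply, LinearMap.sub_apply,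
        LinearMap.smul_apply, smul_eq_mul, hQ w (comb c)]
      ring
    have hV1 : comb c - w ∈ V := V.sub_mem hv hwV
    have hV2 : comb c + w ∈ V := V.add_mem hv hwV
    have e1 := hqv _ (V.add_mem (V.smul_mem (2 : ℝ) hV1) (V.smul_mem (1 / 2 : ℝ) hV2))
    have e2 := hqv _ (V.sub_mem (V.smul_mem (2 : ℝ) hV1) (V.smul_mem (1 / 2 : ℝ) hV2))
    have hpar := parallelogram_law_with_norm ℝ ((2 : ℝ) • (comb c - w))
      ((1 / 2 : ℝ) • (comb c + w))
    rw [norm_smul (2 : ℝ), norm_smul (1 / 2 : ℝ)] at hpar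
    norm_num at hpar
    have hNw := hN w hwN
    have h3 : |Q (comb c) (comb c)| ≤ |Q w w| + |Q (comb c) (comb c) - Q w w| := by
      have := abs_add_le (Q w w) (Q (comb c) (comb c) - Q w w)
      simpa using this
    have h4 : |Q (comb c) (comb c) - Q w w| ≤ 5 / 8 * q := by
      rw [hpol, abs_div, abs_of_pos (by norm_num : (0 : ℝ) < 4), div_le_iff₀ (by norm_num)]
      refine (abs_sub _ _).trans ?_
      refine (add_le_add e1 e2).trans ?_
      rw [← mul_add]
      norm_num
      have : ‖(2 : ℝ) • (comb c - w) + (1 / 2 : ℝ) • (comb c + w)‖ ^ 2 +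
          ‖(2 : ℝ) • (comb c - w) - (1 / 2 : ℝ) • (comb c + w)‖ ^ 2 ≤ 5 / 2 := by
        norm_num
        nlinarith
      norm_num at this
      nlinarith
    nlinarith
  intro v hv
  refine (hqv v hv).trans ?_
  have : q ≤ 3 * t := by linarith
  gcongr

end Net

/-! ### Concentration of the sample covariance matrix on sparse vectors -/

section Sparse

/-- The quadratic form `aᵀ M a`. -/
def quad {ι : Type*} [Fintype ι] (M : Matrix ι ι ℝ) (a : ι → ℝ) : ℝ := a ⬝ᵥ (M *ᵥ a)

open scoped MatrixOrder in
theorem exists_eq_transpose_mul_self {ι : Type*} [Fintype ι] [DecidableEq ι] {M : Matrix ι ι ℝ}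
    (hM : M.PosSemidef) : ∃ G : Matrix ι ι ℝ, M = Gᵀ * G := by
  obtain ⟨G, hG⟩ := CStarAlgebra.nonneg_iff_eq_star_mul_self.mp hM.nonneg
  exact ⟨G, by rw [hG, Matrix.star_eq_conjTranspose, Matrix.conjTranspose_eq_transpose_of_trivial]⟩

theorem quad_sub {ι : Type*} [Fintype ι] (M N : Matrix ι ι ℝ) (a : ι → ℝ) :
    quad (M - N) a = quad M a - quad N a := by
  simp [quad, Matrix.sub_mulVec, dotProduct_sub]

theorem quad_smul {ι : Type*} [Fintype ι] (M : Matrix ι ι ℝ) (r : ℝ) (a : ι → ℝ) :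
    quad M (r • a) = r ^ 2 * quad M a := by
  simp only [quad, Matrix.mulVec_smul, dotProduct_smul, smul_dotProduct, smul_eq_mul]; ring

theorem quad_eq_sum {ι : Type*} [Fintype ι] (M : Matrix ι ι ℝ) (a : ι → ℝ) :
    quad M a = ∑ i, ∑ j, a i * M i j * a j := by
  simp only [quad, dotProduct, Matrix.mulVec, Finset.mul_sum, mul_assoc]

theorem quad_sampleCov {n p : ℕ} (X : Fin n → Fin p → ℝ) (a : Fin p → ℝ) :
    quad (sampleCov X) a = (n : ℝ)⁻¹ * ∑ t, (a ⬝ᵥ X t) ^ 2 := by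
  unfold quad sampleCov
  rw [Matrix.smul_mulVec, dotProduct_smul, smul_eq_mul, ← Matrix.mulVec_mulVec,
    Matrix.dotProduct_mulVec, Matrix.vecMul_transpose]
  congr 1
  simp only [dotProduct, Matrix.mulVec, Matrix.of_apply, sq]
  refine Finset.sum_congr rfl fun t _ => ?_
  congr 1 <;> exact Finset.sum_congr rfl fun _ _ => mul_comm _ _

/-- The scale of the deviations of an `s`-sparse sample second moment from its mean. -/
def devScale (s p n : ℕ) : ℝ :=
  √(s * Real.log (max (p : ℝ) n) / n) + s * Real.log (max (p : ℝ) n) / n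

/-- The Chernoff exponent exceeds `7 x` for deviations of the order `√x + x`: the parameter is `√x`
if that is admissible, and the largest admissible one otherwise. -/
theorem exists_exponent {a₀ Λ x : ℝ} (ha : 0 < a₀) (hΛ : 0 ≤ Λ) (hx : 0 ≤ x) :
    ∃ θ, 0 ≤ θ ∧ θ ≤ a₀ ∧
      7 * x ≤ θ * ((7 + Λ) * (1 + 1 / a₀) * (√x + x)) - Λ * θ ^ 2 := by
  have hs0 := Real.sqrt_nonneg x
  have hs := Real.sq_sqrt hx
  have hinv : 0 < 1 / a₀ := by positivity
  rcases le_or_gt (√x) a₀ with h | h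
  · refine ⟨√x, hs0, h, ?_⟩
    have : (7 + Λ) * x ≤ √x * ((7 + Λ) * (1 + 1 / a₀) * (√x + x)) := by
      calc (7 + Λ) * x = √x * ((7 + Λ) * 1 * (√x + 0)) := by nlinarith
        _ ≤ √x * ((7 + Λ) * (1 + 1 / a₀) * (√x + x)) := by
          gcongr
          linarith
    nlinarith
  · refine ⟨a₀, ha.le, le_rfl, ?_⟩
    have h1 : (7 + Λ) * x ≤ a₀ * ((7 + Λ) * (1 + 1 / a₀) * (√x + x)) := by
      calc (7 + Λ) * x = a₀ * ((7 + Λ) * (0 + 1 / a₀) * (0 + x)) := by field_simp; ring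
        _ ≤ a₀ * ((7 + Λ) * (1 + 1 / a₀) * (√x + x)) := by
          gcongr
          norm_num
    have h2 : a₀ ^ 2 ≤ x := by rw [← hs]; gcongr
    nlinarith

/-- With `M = max p n`, the `p ^ s` choices of coordinates and the `(8 s + 1) ^ s` grid points are
at most `M ^ (6 s)` events, each of probability at most `2 M ^ (-7 s)`. -/
theorem union_count_le {s p n : ℕ} (hs : 1 ≤ s) (hsp : s ≤ p) (hn : 2 ≤ n) :
    ((p : ℝ) ^ s * ((8 * s + 1 : ℕ) : ℝ) ^ s) *
      (2 * Real.exp (-(7 * (s * Real.log (max (p : ℝ) n))))) ≤ 2 / n := by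
  set M : ℝ := max (p : ℝ) n with hM
  have hn' : (2 : ℝ) ≤ n := by exact_mod_cast hn
  have hM2 : 2 ≤ M := hn'.trans (le_max_right _ _)
  have hM0 : 0 < M := by linarith
  have hpM : (p : ℝ) ≤ M := le_max_left _ _
  have hsM : (s : ℝ) ≤ M := le_trans (by exact_mod_cast hsp) hpM
  have hexp : Real.exp (-(7 * (s * Real.log M))) = (M ^ (7 * s))⁻¹ := by
    rw [Real.exp_neg]
    congr 1
    have : 7 * (s * Real.log M) = ((7 * s : ℕ) : ℝ) * Real.log M := by push_cast; ring
    rw [this, Real.exp_nat_mul, Real.exp_log hM0]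
  have h1 : ((8 * s + 1 : ℕ) : ℝ) ≤ M ^ 5 := by
    push_cast
    have h16 : (2 : ℝ) ^ 4 ≤ M ^ 4 := by gcongr
    calc 8 * (s : ℝ) + 1 ≤ 16 * M := by linarith
      _ ≤ M ^ 4 * M := by nlinarith
      _ = M ^ 5 := by ring
  rw [hexp]
  calc ((p : ℝ) ^ s * ((8 * s + 1 : ℕ) : ℝ) ^ s) * (2 * (M ^ (7 * s))⁻¹)
      ≤ (M ^ s * (M ^ 5) ^ s) * (2 * (M ^ (7 * s))⁻¹) := by gcongr
    _ = 2 * (M ^ s)⁻¹ := by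
        rw [← pow_mul, ← pow_add]
        have : M ^ (7 * s) = M ^ (s + 5 * s) * M ^ s := by rw [← pow_add]; congr 1; ring
        rw [this]
        field_simp
    _ ≤ 2 * (n : ℝ)⁻¹ := by
        have : (n : ℝ) ≤ M ^ s :=
          (le_max_right _ _).trans (le_self_pow₀ (by linarith) (by omega))
        gcongr
    _ = 2 / n := by rw [div_eq_mul_inv]

variable {Ω Ω' : Type*} [MeasurableSpace Ω] [MeasurableSpace Ω'] {P : Measure Ω} {P' : Measure Ω'}

/-- Deviation of the sample second moment in one direction. -/
theorem measureReal_quad_sampleCov_sub_le [IsProbabilityMeasure P] {n p : ℕ} {γ : ℝ} (hγ : 0 < γ)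
    {X : Fin n → Ω → Fin p → ℝ} {Y : Ω' → Fin p → ℝ} {S : Matrix (Fin p) (Fin p) ℝ}
    (hn : 0 < n) (hX : IsIIDSample P P' X Y)
    (hint : ∀ a : Fin p → ℝ, Integrable (fun ω => Real.exp (a ⬝ᵥ Y ω)) P')
    (hle : ∀ a : Fin p → ℝ, ∫ ω, Real.exp (a ⬝ᵥ Y ω) ∂P' ≤ Real.exp (quad S a * γ ^ 2 / 2))
    (hvar : ∀ a : Fin p → ℝ, ∫ ω, (a ⬝ᵥ Y ω) ^ 2 ∂P' = quad S a)
    {A : ℝ} (hA : A = 1 / (2 * Real.exp 1 * γ ^ 2)) {θ η : ℝ} (hθ0 : 0 ≤ θ) (hθ : θ ≤ A / 2)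
    (a : Fin p → ℝ) (ha : 0 < quad S a) :
    P.real {ω | η * quad S a < |quad (sampleCov (fun t => X t ω) - S) a|} ≤
      2 * Real.exp (-(n * (θ * η - 16 * Real.exp A / A ^ 2 * θ ^ 2))) := by
  have hn' : (0 : ℝ) < n := Nat.cast_pos.2 hn
  set r : ℝ := (√(quad S a))⁻¹ with hr
  have hr2 : r ^ 2 * quad S a = 1 := by
    rw [hr, inv_pow, Real.sq_sqrt ha.le, inv_mul_cancel₀ ha.ne']
  set b : Fin p → ℝ := r • a with hb
  have hqb : quad S b = 1 := by rw [hb, quad_smul, hr2]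
  have hmeasf : ∀ c : Fin p → ℝ, Measurable fun x : Fin p → ℝ => c ⬝ᵥ x := fun c => by
    unfold dotProduct; fun_prop
  have hid : ∀ (t : Fin n) (g : (Fin p → ℝ) → ℝ), Measurable g →
      (∫ ω, g (X t ω) ∂P = ∫ ω, g (Y ω) ∂P' ∧
        (Integrable (fun ω => g (Y ω)) P' → Integrable (fun ω => g (X t ω)) P)) := by
    intro t g hg
    have h := (hX.2 t).comp hg
    exact ⟨h.integral_eq, fun hi => h.integrable_iff.2 hi⟩
  have key := measureReal_sum_sq_sub_one_le (P := P) (Y := fun t ω => b ⬝ᵥ X t ω) (η := η)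
    (hX.1.comp (fun _ x => b ⬝ᵥ x) fun _ => hmeasf b)
    (fun t => (hmeasf b).comp_aemeasurable (hX.2 t).aemeasurable_fst) hγ
    (fun i t => by
      have := (hid i (fun x => Real.exp ((t • b) ⬝ᵥ x)) (hmeasf _).exp).2 (hint (t • b))
      simpa only [smul_dotProduct, smul_eq_mul] using this)
    (fun i t => by
      have := (hid i (fun x => Real.exp ((t • b) ⬝ᵥ x)) (hmeasf _).exp).1
      have h2 := hle (t • b)
      rw [← this, quad_smul, hqb, mul_one] at h2
      simpa only [smul_dotProduct, smul_eq_mul] using h2)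
    (fun i => by
      rw [(hid i (fun x => (b ⬝ᵥ x) ^ 2) ((hmeasf b).pow_const 2)).1, hvar, hqb])
    hA hθ0 hθ
  refine le_trans (measureReal_mono fun ω hω => ?_) key
  simp only [Set.mem_ofPred_eq] at hω ⊢
  have h1 : ∑ t, ((b ⬝ᵥ X t ω) ^ 2 - 1) =
      n * (r ^ 2 * quad (sampleCov (fun t => X t ω) - S) a) := by
    rw [quad_sub, mul_sub, hr2, ← quad_smul, ← hb, quad_sampleCov, Finset.sum_sub_distrib, mul_sub,
      mul_inv_cancel_left₀ hn'.ne']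
    simp
  rw [h1, abs_mul, abs_of_pos hn', abs_mul, abs_of_nonneg (sq_nonneg r)]
  refine mul_le_mul_of_nonneg_left ?_ hn'.le
  have h2 := mul_le_mul_of_nonneg_left hω.le (sq_nonneg r)
  calc η = r ^ 2 * (η * quad S a) := by
        rw [mul_left_comm, hr2, mul_one]
    _ ≤ _ := h2

/-- With probability at least `1 - 2 / n`, the sample covariance matrix is close to `S`, relative to
`S`, in all `s`-sparse directions. -/
theorem sparse_concentration {γ : ℝ} (hγ : 0 < γ) :
    ∃ H : ℝ, 0 < H ∧ ∀ {n p s : ℕ} {Ω : Type*} {Ω' : Type*} [MeasurableSpace Ω]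
      [MeasurableSpace Ω'] {P : Measure Ω} {P' : Measure Ω'} [IsProbabilityMeasure P]
      {X : Fin n → Ω → Fin p → ℝ} {Y : Ω' → Fin p → ℝ} {S : Matrix (Fin p) (Fin p) ℝ},
      2 ≤ n → 1 ≤ s → s ≤ p → IsIIDSample P P' X Y → S.PosDef →
      (∀ a : Fin p → ℝ, Integrable (fun ω => Real.exp (a ⬝ᵥ Y ω)) P') →
      (∀ a : Fin p → ℝ, ∫ ω, Real.exp (a ⬝ᵥ Y ω) ∂P' ≤ Real.exp (quad S a * γ ^ 2 / 2)) →
      (∀ a : Fin p → ℝ, ∫ ω, (a ⬝ᵥ Y ω) ^ 2 ∂P' = quad S a) →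
      P {ω | ¬ ∀ a : Fin p → ℝ, (Finset.univ.filter fun i => a i ≠ 0).card ≤ s →
        |quad (sampleCov (fun t => X t ω) - S) a| ≤ H * devScale s p n * quad S a} ≤
      ENNReal.ofReal (2 / n) := by
  classical
  set A : ℝ := 1 / (2 * Real.exp 1 * γ ^ 2) with hA
  have hA0 : 0 < A := by rw [hA]; positivity
  set Λ : ℝ := 16 * Real.exp A / A ^ 2 with hΛ
  have hΛ0 : 0 ≤ Λ := by positivity
  refine ⟨3 * ((7 + Λ) * (1 + 1 / (A / 2))), by positivity, ?_⟩
  intro n p s Ω Ω' _ _ P P' _ X Y S hn hs hsp hX hS hint hle hvar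
  have hn0 : 0 < n := by omega
  have hn' : (0 : ℝ) < n := Nat.cast_pos.2 hn0
  obtain ⟨G, hG⟩ := exists_eq_transpose_mul_self hS.posSemidef
  have hGdet : IsUnit G.det := by
    have := hS.det_pos
    rw [hG, Matrix.det_mul, Matrix.det_transpose] at this
    exact isUnit_iff_ne_zero.2 fun h => by simp [h] at this
  have hGG : ∀ v : Fin p → ℝ, G *ᵥ (G⁻¹ *ᵥ v) = v := fun v => by
    rw [Matrix.mulVec_mulVec, Matrix.mul_nonsing_inv _ hGdet, Matrix.one_mulVec]
  have hGG' : ∀ v : Fin p → ℝ, G⁻¹ *ᵥ (G *ᵥ v) = v := fun v => by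
    rw [Matrix.mulVec_mulVec, Matrix.nonsing_inv_mul _ hGdet, Matrix.one_mulVec]
  have hquadS : ∀ v : EuclideanSpace ℝ (Fin p), quad S (G⁻¹ *ᵥ v.ofLp) = ‖v‖ ^ 2 := by
    intro v
    unfold quad
    rw [hG, ← Matrix.mulVec_mulVec, Matrix.dotProduct_mulVec, Matrix.vecMul_transpose, hGG,
      EuclideanSpace.real_norm_sq_eq]
    simp [dotProduct, sq]
  let V : (Fin s → Fin p) → Submodule ℝ (EuclideanSpace ℝ (Fin p)) := fun σ =>
    Submodule.span ℝ (Set.range fun a : Fin s =>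
      (WithLp.toLp 2 (G *ᵥ Pi.single (σ a) 1) : EuclideanSpace ℝ (Fin p)))
  have hV : ∀ σ, Module.finrank ℝ (V σ) ≤ s := fun σ => by
    have := finrank_range_le_card (R := ℝ)
      (b := fun a : Fin s => (WithLp.toLp 2 (G *ᵥ Pi.single (σ a) 1) : EuclideanSpace ℝ (Fin p)))
    simpa [Set.finrank] using this
  choose N hNcard hN using fun σ => exists_grid (V σ) hs (hV σ)
  set x : ℝ := s * Real.log (max (p : ℝ) n) / n with hx
  have hx0 : 0 ≤ x := by
    have : (1 : ℝ) ≤ max (p : ℝ) n := le_max_of_le_right (by exact_mod_cast (by omega : 1 ≤ n))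
    have := Real.log_nonneg this
    positivity
  set η : ℝ := (7 + Λ) * (1 + 1 / (A / 2)) * (√x + x) with hη
  have hη0 : 0 ≤ η := by positivity
  obtain ⟨θ, hθ0, hθ, hθx⟩ := exists_exponent (a₀ := A / 2) (by positivity) hΛ0 hx0
  rw [← hη] at hθx
  let bad : EuclideanSpace ℝ (Fin p) → Set Ω := fun v => {ω | η * quad S (G⁻¹ *ᵥ v.ofLp) <
    |quad (sampleCov (fun t => X t ω) - S) (G⁻¹ *ᵥ v.ofLp)|}
  have hbad : ∀ v, P (bad v) ≤
      ENNReal.ofReal (2 * Real.exp (-(7 * (s * Real.log (max (p : ℝ) n))))) := by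
    intro v
    by_cases hv : v = 0
    · have : bad v = ∅ := by
        ext ω; simp [bad, hv, quad]
      rw [this]; simp
    have h := measureReal_quad_sampleCov_sub_le hγ hn0 hX hint hle hvar hA hθ0 hθ
      (η := η) (G⁻¹ *ᵥ v.ofLp) (by rw [hquadS]; have := norm_pos_iff.2 hv; positivity)
    rw [← ENNReal.ofReal_toReal (measure_ne_top P (bad v))]
    refine ENNReal.ofReal_le_ofReal (h.trans ?_)
    refine mul_le_mul_of_nonneg_left (Real.exp_le_exp.2 (neg_le_neg ?_)) zero_le_two
    have : (n : ℝ) * x = s * Real.log (max (p : ℝ) n) := by rw [hx]; field_simp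
    rw [← this]
    nlinarith
  have hsub : {ω | ¬ ∀ a : Fin p → ℝ, (Finset.univ.filter fun i => a i ≠ 0).card ≤ s →
        |quad (sampleCov (fun t => X t ω) - S) a| ≤
          3 * ((7 + Λ) * (1 + 1 / (A / 2))) * devScale s p n * quad S a} ⊆
      ⋃ σ ∈ (Finset.univ : Finset (Fin s → Fin p)), ⋃ v ∈ N σ, bad v := by
    intro ω hω
    by_contra hnot
    apply hω
    intro a ha
    -- the support of `a` is contained in the range of some `σ`
    obtain ⟨σ, hσ⟩ : ∃ σ : Fin s → Fin p, ∀ i, a i ≠ 0 → i ∈ Set.range σ := by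
      have hp0 : 0 < p := by omega
      set T := Finset.univ.filter fun i => a i ≠ 0
      let e := T.equivFin
      refine ⟨fun k => if h : k.1 < T.card then (e.symm ⟨k.1, h⟩).1 else ⟨0, hp0⟩,
        fun i hi => ?_⟩
      have hiT : i ∈ T := by simp [T, hi]
      refine ⟨⟨(e ⟨i, hiT⟩).1, lt_of_lt_of_le (e ⟨i, hiT⟩).2 ha⟩, ?_⟩
      simp
    set D := sampleCov (fun t => X t ω) - S with hD
    let Q : (EuclideanSpace ℝ (Fin p)) →ₗ[ℝ] EuclideanSpace ℝ (Fin p) →ₗ[ℝ] ℝ := LinearMap.mk₂ ℝ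
      (fun v w => (G⁻¹ *ᵥ v.ofLp) ⬝ᵥ (D *ᵥ (G⁻¹ *ᵥ w.ofLp)))
      (fun v v' w => by
        simp only [WithLp.ofLp_add, Matrix.mulVec_add, add_dotProduct])
      (fun c v w => by
        simp only [WithLp.ofLp_smul, Matrix.mulVec_smul, smul_dotProduct])
      (fun v w w' => by
        simp only [WithLp.ofLp_add, Matrix.mulVec_add, dotProduct_add])
      (fun c v w => by
        simp only [WithLp.ofLp_smul, Matrix.mulVec_smul, dotProduct_smul])
    have hQQ : ∀ v, Q v v = quad D (G⁻¹ *ᵥ v.ofLp) := fun v => rfl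
    have hDsymm : Dᵀ = D := by
      have h1 : Sᵀ = S := by rw [hG]; simp
      rw [hD, Matrix.transpose_sub, h1]
      simp [sampleCov]
    have hsymm : ∀ v w, Q v w = Q w v := fun v w => by
      change (G⁻¹ *ᵥ v.ofLp) ⬝ᵥ (D *ᵥ (G⁻¹ *ᵥ w.ofLp)) =
        (G⁻¹ *ᵥ w.ofLp) ⬝ᵥ (D *ᵥ (G⁻¹ *ᵥ v.ofLp))
      rw [Matrix.dotProduct_mulVec, ← Matrix.mulVec_transpose, hDsymm, dotProduct_comm]
    have hall : ∀ v ∈ N σ, |Q v v| ≤ η * ‖v‖ ^ 2 := by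
      intro v hv
      by_contra hc
      push Not at hc
      apply hnot
      simp only [Set.mem_iUnion]
      refine ⟨σ, Finset.mem_univ _, v, hv, ?_⟩
      change η * quad S (G⁻¹ *ᵥ v.ofLp) < |quad D (G⁻¹ *ᵥ v.ofLp)|
      rw [hquadS, ← hQQ]
      exact hc
    have hmem : (WithLp.toLp 2 (G *ᵥ a) : EuclideanSpace ℝ (Fin p)) ∈ V σ := by
      have : (WithLp.toLp 2 (G *ᵥ a) : EuclideanSpace ℝ (Fin p)) =
          ∑ i, a i • (WithLp.toLp 2 (G *ᵥ Pi.single i 1) : EuclideanSpace ℝ (Fin p)) := by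
        have h0 : a = ∑ i, a i • Pi.single (M := fun _ => ℝ) i 1 := by
          ext j; simp [Finset.sum_apply, Pi.single_apply]
        conv_lhs => rw [h0]
        rw [Matrix.mulVec_sum]
        simp [Matrix.mulVec_smul]
      rw [this]
      refine Submodule.sum_mem _ fun i _ => ?_
      by_cases hi : a i = 0
      · rw [hi, zero_smul]; exact Submodule.zero_mem _
      · obtain ⟨k, rfl⟩ := hσ i hi
        exact Submodule.smul_mem _ _ (Submodule.subset_span ⟨k, rfl⟩)
    have hfin := hN σ Q hsymm η hη0 hall _ hmem
    rw [hQQ, ← hquadS] at hfin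
    simp only [hGG'] at hfin
    refine hfin.trans (le_of_eq ?_)
    rw [hη, devScale]; ring
  calc P _ ≤ P (⋃ σ ∈ (Finset.univ : Finset (Fin s → Fin p)), ⋃ v ∈ N σ, bad v) :=
        measure_mono hsub
    _ ≤ ∑ σ : Fin s → Fin p, P (⋃ v ∈ N σ, bad v) := measure_biUnion_finset_le _ _
    _ ≤ ∑ σ : Fin s → Fin p, ∑ v ∈ N σ, P (bad v) :=
        Finset.sum_le_sum fun σ _ => measure_biUnion_finset_le _ _
    _ ≤ ∑ _σ : Fin s → Fin p, ((8 * s + 1) ^ s : ℕ) *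
          ENNReal.ofReal (2 * Real.exp (-(7 * (s * Real.log (max (p : ℝ) n))))) := by
        refine Finset.sum_le_sum fun σ _ => ?_
        refine (Finset.sum_le_sum fun v _ => hbad v).trans ?_
        rw [Finset.sum_const, nsmul_eq_mul]
        gcongr
        exact hNcard σ
    _ = ENNReal.ofReal (((p : ℝ) ^ s * ((8 * s + 1 : ℕ) : ℝ) ^ s) *
          (2 * Real.exp (-(7 * (s * Real.log (max (p : ℝ) n)))))) := by
        have h1 : ENNReal.ofReal ((p : ℝ) ^ s * ((8 * s + 1 : ℕ) : ℝ) ^ s) =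
            ((p ^ s * (8 * s + 1) ^ s : ℕ) : ℝ≥0∞) := by
          rw [← ENNReal.ofReal_natCast]; push_cast; rfl
        rw [Finset.sum_const, nsmul_eq_mul, ← mul_assoc,
          ENNReal.ofReal_mul (p := (p : ℝ) ^ s * _) (by positivity), h1]
        simp
    _ ≤ ENNReal.ofReal (2 / n) := ENNReal.ofReal_le_ofReal (union_count_le hs hsp hn)

end Sparse

/-! ### Second moments of the factor model -/

namespace FactorModel

variable {p K : ℕ} {Ω : Type*} [MeasurableSpace Ω] {P : Measure Ω}

theorem X_apply (M : FactorModel p K P) (ω : Ω) (i : Fin p) :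
    M.X ω i = ∑ k, M.A i k * M.Z ω k + M.E ω i := by
  simp [X, Matrix.mulVec, dotProduct]

theorem memLp_X (M : FactorModel p K P) (i : Fin p) : MemLp (fun ω => M.X ω i) 2 P := by
  simp_rw [X_apply]
  exact (memLp_finsetSum _ fun k _ => (M.memLp_Z k).const_mul _).add (M.memLp_E i)

theorem SigmaZ_posSemidef (M : FactorModel p K P) : M.SigmaZ.PosSemidef := by
  have iZZ : ∀ k l, Integrable (fun ω => M.Z ω k * M.Z ω l) P := fun k l =>
    (M.memLp_Z k).integrable_mul (M.memLp_Z l)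
  refine Matrix.PosSemidef.of_dotProduct_mulVec_nonneg ?_ fun x => ?_
  · ext k l
    simp [SigmaZ, Matrix.conjTranspose_apply, mul_comm]
  · have h : star x ⬝ᵥ (M.SigmaZ *ᵥ x) = ∫ ω, (x ⬝ᵥ M.Z ω) ^ 2 ∂P := by
      have e : ∀ ω, (x ⬝ᵥ M.Z ω) ^ 2 = ∑ k, ∑ l, x k * x l * (M.Z ω k * M.Z ω l) := fun ω => by
        rw [sq, dotProduct, Finset.sum_mul_sum]
        exact Finset.sum_congr rfl fun k _ => Finset.sum_congr rfl fun l _ => by ring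
      simp_rw [e]
      rw [integral_finsetSum _ fun k _ => integrable_finsetSum _ fun l _ => (iZZ k l).const_mul _,
        star_trivial]
      refine (quad_eq_sum M.SigmaZ x).trans (Finset.sum_congr rfl fun k _ => ?_)
      rw [integral_finsetSum _ fun l _ => (iZZ k l).const_mul _]
      refine Finset.sum_congr rfl fun l _ => ?_
      rw [integral_const_mul]
      simp only [SigmaZ, Matrix.of_apply]
      ring
    rw [h]
    exact integral_nonneg fun ω => sq_nonneg _

/-- A square root of `Σ_Z`: `Σ_Z = Lᵀ L`. -/
def L (M : FactorModel p K P) : Matrix (Fin K) (Fin K) ℝ :=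
  (exists_eq_transpose_mul_self M.SigmaZ_posSemidef).choose

theorem SigmaZ_eq (M : FactorModel p K P) : M.SigmaZ = M.Lᵀ * M.L :=
  (exists_eq_transpose_mul_self M.SigmaZ_posSemidef).choose_spec

/-- The factor `Z_k` seen as a vector: the `ζ_k` have Gram matrix `Σ_Z`. -/
def zeta (M : FactorModel p K P) (k : Fin K) : EuclideanSpace ℝ (Fin K) :=
  WithLp.toLp 2 (M.Lᵀ k)

theorem inner_zeta (M : FactorModel p K P) (k l : Fin K) :
    inner ℝ (M.zeta k) (M.zeta l) = M.SigmaZ k l := by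
  rw [SigmaZ_eq, EuclideanSpace.inner_eq_star_dotProduct]
  simp only [zeta, star_trivial, Matrix.mul_apply, dotProduct, Matrix.transpose_apply]
  exact Finset.sum_congr rfl fun _ _ => mul_comm _ _

theorem inner_sum_zeta (M : FactorModel p K P) (x y : Fin K → ℝ) :
    inner ℝ (∑ k, x k • M.zeta k) (∑ k, y k • M.zeta k) = ∑ k, ∑ l, x k * M.SigmaZ k l * y l := by
  rw [sum_inner]
  refine Finset.sum_congr rfl fun k _ => ?_
  rw [inner_sum]
  refine Finset.sum_congr rfl fun l _ => ?_
  rw [inner_smul_left, inner_smul_right, inner_zeta]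
  simp; ring

/-- The standard deviation of `X_i`. -/
def sd (M : FactorModel p K P) (i : Fin p) : ℝ := √(M.Sigma i i)

/-- The common part of the normalized variable `X_i`, seen as a vector: the `β_i` have Gram matrix
`B Σ_Z Bᵀ`. -/
def beta (M : FactorModel p K P) (i : Fin p) : EuclideanSpace ℝ (Fin K) :=
  ∑ k, M.B i k • M.zeta k

theorem inner_sum_A (M : FactorModel p K P) (i j : Fin p) :
    inner ℝ (∑ k, M.A i k • M.zeta k) (∑ k, M.A j k • M.zeta k) =
      (M.A * M.SigmaZ * M.Aᵀ) i j := by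
  rw [inner_sum_zeta]
  simp only [Matrix.mul_apply, Matrix.transpose_apply, Finset.sum_mul]
  rw [Finset.sum_comm]

theorem inner_beta (M : FactorModel p K P) (i j : Fin p) :
    inner ℝ (M.beta i) (M.beta j) = (M.B * M.SigmaZ * M.Bᵀ) i j := by
  unfold beta
  rw [inner_sum_zeta]
  simp only [Matrix.mul_apply, Matrix.transpose_apply, Finset.sum_mul]
  rw [Finset.sum_comm]

variable [IsProbabilityMeasure P]

theorem integral_X (M : FactorModel p K P) (i : Fin p) : ∫ ω, M.X ω i ∂P = 0 := by
  simp_rw [X_apply]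
  have hZ : ∀ k, Integrable (fun ω => M.A i k * M.Z ω k) P := fun k =>
    ((M.memLp_Z k).integrable (by norm_num)).const_mul _
  rw [integral_add (integrable_finsetSum _ fun k _ => hZ k)
    ((M.memLp_E i).integrable (by norm_num)), integral_finsetSum _ fun k _ => hZ k, M.mean_E]
  simp [integral_const_mul, M.mean_Z]

theorem Sigma_eq_integral (M : FactorModel p K P) (i j : Fin p) :
    M.Sigma i j = ∫ ω, M.X ω i * M.X ω j ∂P := by
  simp [Sigma, covariance, integral_X]

theorem Sigma_apply (M : FactorModel p K P) (i j : Fin p) :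
    M.Sigma i j = (M.A * M.SigmaZ * M.Aᵀ) i j + ∫ ω, M.E ω i * M.E ω j ∂P := by
  rw [Sigma_eq_integral]
  have iZZ : ∀ k l, Integrable (fun ω => M.Z ω k * M.Z ω l) P := fun k l =>
    (M.memLp_Z k).integrable_mul (M.memLp_Z l)
  have iZE : ∀ k l, Integrable (fun ω => M.Z ω k * M.E ω l) P := fun k l =>
    (M.memLp_Z k).integrable_mul (M.memLp_E l)
  have iEE : ∀ k l, Integrable (fun ω => M.E ω k * M.E ω l) P := fun k l =>
    (M.memLp_E k).integrable_mul (M.memLp_E l)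
  have hexp : ∀ ω, M.X ω i * M.X ω j =
      (∑ k, ∑ l, M.A i k * M.A j l * (M.Z ω k * M.Z ω l)) +
      (∑ k, M.A i k * (M.Z ω k * M.E ω j)) + (∑ l, M.A j l * (M.Z ω l * M.E ω i)) +
      M.E ω i * M.E ω j := by
    intro ω
    rw [X_apply, X_apply, add_mul, mul_add, mul_add, Finset.sum_mul_sum, Finset.sum_mul,
      Finset.mul_sum]
    have h1 : ∀ k l, M.A i k * M.Z ω k * (M.A j l * M.Z ω l) =
        M.A i k * M.A j l * (M.Z ω k * M.Z ω l) := fun k l => by ring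
    have h2 : ∀ k, M.A i k * M.Z ω k * M.E ω j = M.A i k * (M.Z ω k * M.E ω j) := fun k => by ring
    have h3 : ∀ k, M.E ω i * (M.A j k * M.Z ω k) = M.A j k * (M.Z ω k * M.E ω i) := fun k => by
      ring
    simp only [h1, h2, h3]
    ring
  simp_rw [hexp]
  have i1 : Integrable (fun ω => ∑ k, ∑ l, M.A i k * M.A j l * (M.Z ω k * M.Z ω l)) P :=
    integrable_finsetSum _ fun k _ => integrable_finsetSum _ fun l _ => (iZZ k l).const_mul _
  have i2 : Integrable (fun ω => ∑ k, M.A i k * (M.Z ω k * M.E ω j)) P :=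
    integrable_finsetSum _ fun k _ => (iZE k j).const_mul _
  have i3 : Integrable (fun ω => ∑ k, M.A j k * (M.Z ω k * M.E ω i)) P :=
    integrable_finsetSum _ fun k _ => (iZE k i).const_mul _
  have i12 : Integrable (fun ω => (∑ k, ∑ l, M.A i k * M.A j l * (M.Z ω k * M.Z ω l)) +
      ∑ k, M.A i k * (M.Z ω k * M.E ω j)) P := i1.add i2
  have i123 : Integrable (fun ω => (∑ k, ∑ l, M.A i k * M.A j l * (M.Z ω k * M.Z ω l)) +
      (∑ k, M.A i k * (M.Z ω k * M.E ω j)) + ∑ k, M.A j k * (M.Z ω k * M.E ω i)) P := i12.add i3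
  rw [integral_add i123 (iEE i j), integral_add i12 i3, integral_add i1 i2,
    integral_finsetSum _ fun k _ => (iZE k j).const_mul _,
    integral_finsetSum _ fun k _ => (iZE k i).const_mul _,
    integral_finsetSum _ fun k _ => integrable_finsetSum _ fun l _ => (iZZ k l).const_mul _]
  have e1 : ∀ k, ∫ ω, ∑ l, M.A i k * M.A j l * (M.Z ω k * M.Z ω l) ∂P =
      ∑ l, M.A i k * M.A j l * M.SigmaZ k l := fun k => by
    rw [integral_finsetSum _ fun l _ => (iZZ k l).const_mul _]
    simp only [integral_const_mul, SigmaZ, Matrix.of_apply]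
  simp_rw [integral_const_mul, M.uncorr_Z_E, e1]
  simp only [mul_zero, Finset.sum_const_zero, add_zero]
  congr 1
  simp only [Matrix.mul_apply, Matrix.transpose_apply, Finset.sum_mul]
  rw [Finset.sum_comm]
  exact Finset.sum_congr rfl fun k _ => Finset.sum_congr rfl fun l _ => by ring

theorem integral_dotProduct_X_sq (M : FactorModel p K P) (a : Fin p → ℝ) :
    ∫ ω, (a ⬝ᵥ M.X ω) ^ 2 ∂P = quad M.Sigma a := by
  have iXX : ∀ k l, Integrable (fun ω => M.X ω k * M.X ω l) P := fun k l =>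
    (M.memLp_X k).integrable_mul (M.memLp_X l)
  have e : ∀ ω, (a ⬝ᵥ M.X ω) ^ 2 = ∑ k, ∑ l, a k * a l * (M.X ω k * M.X ω l) := fun ω => by
    rw [sq, dotProduct, Finset.sum_mul_sum]
    exact Finset.sum_congr rfl fun k _ => Finset.sum_congr rfl fun l _ => by ring
  simp_rw [e]
  rw [integral_finsetSum _ fun k _ => integrable_finsetSum _ fun l _ => (iXX k l).const_mul _,
    quad_eq_sum]
  refine Finset.sum_congr rfl fun k _ => ?_
  rw [integral_finsetSum _ fun l _ => (iXX k l).const_mul _]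
  refine Finset.sum_congr rfl fun l _ => ?_
  rw [integral_const_mul, Sigma_eq_integral]
  ring

theorem Sigma_isSymm (M : FactorModel p K P) : M.Sigmaᵀ = M.Sigma := by
  ext i j
  simp only [Matrix.transpose_apply, Sigma_eq_integral, mul_comm]

theorem Sigma_self_pos (M : FactorModel p K P) (i : Fin p) : 0 < M.Sigma i i := by
  rw [Sigma_apply, ← inner_sum_A, real_inner_self_eq_norm_sq]
  have := M.var_E_pos i
  positivity

theorem sd_pos (M : FactorModel p K P) (i : Fin p) : 0 < M.sd i :=
  Real.sqrt_pos.2 (M.Sigma_self_pos i)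

theorem sd_sq (M : FactorModel p K P) (i : Fin p) : M.sd i ^ 2 = M.Sigma i i :=
  Real.sq_sqrt (M.Sigma_self_pos i).le

theorem sd_smul_beta (M : FactorModel p K P) (i : Fin p) :
    M.sd i • M.beta i = ∑ k, M.A i k • M.zeta k := by
  unfold beta
  rw [Finset.smul_sum]
  refine Finset.sum_congr rfl fun k _ => ?_
  rw [smul_smul]
  congr 1
  have := (M.sd_pos i).ne'
  simp only [B, Matrix.of_apply]
  change M.sd i * (M.A i k / M.sd i) = _
  field_simp

theorem Sigma_of_ne (M : FactorModel p K P) {i j : Fin p} (h : i ≠ j) :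
    M.Sigma i j = M.sd i * M.sd j * inner ℝ (M.beta i) (M.beta j) := by
  rw [Sigma_apply, M.uncorr_E i j h, add_zero, ← inner_sum_A, ← sd_smul_beta, ← sd_smul_beta,
    inner_smul_left, inner_smul_right]
  simp; ring

theorem R_apply (M : FactorModel p K P) (i j : Fin p) :
    M.R i j = M.Sigma i j / (M.sd i * M.sd j) := by
  simp only [R, corr, Matrix.of_apply, sd]
  rw [Real.sqrt_mul (M.Sigma_self_pos i).le]

theorem R_self (M : FactorModel p K P) (i : Fin p) : M.R i i = 1 := by
  rw [R_apply, ← sq, sd_sq, div_self (M.Sigma_self_pos i).ne']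

theorem R_of_ne (M : FactorModel p K P) {i j : Fin p} (h : i ≠ j) :
    M.R i j = inner ℝ (M.beta i) (M.beta j) := by
  rw [R_apply, M.Sigma_of_ne h]
  have h1 := (M.sd_pos i).ne'
  have h2 := (M.sd_pos j).ne'
  field_simp

theorem R_comm (M : FactorModel p K P) (i j : Fin p) : M.R i j = M.R j i := by
  have := congrFun (congrFun M.Sigma_isSymm j) i
  rw [Matrix.transpose_apply] at this
  rw [R_apply, R_apply, this, mul_comm (M.sd i)]

theorem norm_beta_le_one (M : FactorModel p K P) (i : Fin p) : ‖M.beta i‖ ≤ 1 := by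
  have h1 : M.Sigma i i = M.sd i ^ 2 * ‖M.beta i‖ ^ 2 + ∫ ω, M.E ω i * M.E ω i ∂P := by
    rw [Sigma_apply, ← inner_sum_A, ← sd_smul_beta, real_inner_self_eq_norm_sq, norm_smul,
      mul_pow, Real.norm_eq_abs, sq_abs]
  rw [← sd_sq] at h1
  have h2 := M.var_E_pos i
  have h3 : 0 < M.sd i ^ 2 := by have := M.sd_pos i; positivity
  have h4 : ‖M.beta i‖ ^ 2 ≤ 1 := by
    by_contra hc
    push Not at hc
    nlinarith
  exact (sq_le_one_iff₀ (norm_nonneg _)).1 h4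

/-- The quadratic form of `R` is that of `B Σ_Z Bᵀ` plus a diagonal part. -/
theorem quad_R (M : FactorModel p K P) (x : Fin p → ℝ) :
    quad M.R x = ‖∑ i, x i • M.beta i‖ ^ 2 + ∑ i, (1 - ‖M.beta i‖ ^ 2) * x i ^ 2 := by
  have h : ∀ i j, M.R i j = inner ℝ (M.beta i) (M.beta j) +
      if i = j then 1 - ‖M.beta i‖ ^ 2 else 0 := by
    intro i j
    split_ifs with hij
    · rw [← hij, R_self, real_inner_self_eq_norm_sq]; ring
    · rw [R_of_ne M hij, add_zero]
  rw [quad_eq_sum, ← real_inner_self_eq_norm_sq, sum_inner, ← Finset.sum_add_distrib]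
  refine Finset.sum_congr rfl fun i _ => ?_
  simp_rw [h, mul_add, add_mul]
  rw [Finset.sum_add_distrib, inner_sum]
  congr 1
  · refine Finset.sum_congr rfl fun j _ => ?_
    rw [inner_smul_left, inner_smul_right]
    simp; ring
  · simp; ring

theorem quad_Sigma (M : FactorModel p K P) (a : Fin p → ℝ) :
    quad M.Sigma a = quad M.R fun i => M.sd i * a i := by
  rw [quad_eq_sum, quad_eq_sum]
  refine Finset.sum_congr rfl fun i _ => Finset.sum_congr rfl fun j _ => ?_
  rw [R_apply]
  have h1 := (M.sd_pos i).ne'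
  have h2 := (M.sd_pos j).ne'
  field_simp

theorem Sigma_posDef (M : FactorModel p K P) : M.Sigma.PosDef := by
  refine Matrix.PosDef.of_dotProduct_mulVec_pos ?_ fun x hx => ?_
  · rw [Matrix.IsHermitian, Matrix.conjTranspose_eq_transpose_of_trivial, Sigma_isSymm]
  · rw [star_trivial]
    change 0 < quad M.Sigma x
    have h : quad M.Sigma x = ‖∑ k, (∑ i, x i * M.A i k) • M.zeta k‖ ^ 2 +
        ∑ i, x i ^ 2 * ∫ ω, M.E ω i * M.E ω i ∂P := by
      have e1 : ∑ k, (∑ i, x i * M.A i k) • M.zeta k = ∑ i, x i • ∑ k, M.A i k • M.zeta k := by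
        simp_rw [Finset.sum_smul, Finset.smul_sum, smul_smul]
        rw [Finset.sum_comm]
      rw [e1, quad_eq_sum, ← real_inner_self_eq_norm_sq, sum_inner, ← Finset.sum_add_distrib]
      refine Finset.sum_congr rfl fun i _ => ?_
      simp_rw [Sigma_apply, mul_add, add_mul]
      rw [Finset.sum_add_distrib, inner_sum]
      congr 1
      · refine Finset.sum_congr rfl fun j _ => ?_
        rw [inner_smul_left, inner_smul_right, inner_sum_A]
        simp; ring
      · rw [Finset.sum_eq_single i]
        · ring
        · intro j _ hj
          rw [M.uncorr_E i j hj.symm]; ring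
        · simp
    rw [h]
    obtain ⟨i, hi⟩ := Function.ne_iff.1 hx
    have hnn : ∀ i ∈ Finset.univ, 0 ≤ x i ^ 2 * ∫ ω, M.E ω i * M.E ω i ∂P := fun i _ =>
      mul_nonneg (sq_nonneg _) (M.var_E_pos i).le
    have hp : 0 < ∑ i, x i ^ 2 * ∫ ω, M.E ω i * M.E ω i ∂P :=
      Finset.sum_pos' hnn ⟨i, Finset.mem_univ _,
        mul_pos (by have : x i ≠ 0 := hi; positivity) (M.var_E_pos i)⟩
    positivity

open scoped MatrixOrder in
/-- Sub-Gaussianity of the whitened vector, read off for linear combinations of `X`, with the test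
vector `u = Σ^{1/2} a`. -/
theorem IsSubGaussian.dotProduct {M : FactorModel p K P} {γ : ℝ} (h : M.IsSubGaussian γ)
    (a : Fin p → ℝ) :
    Integrable (fun ω => Real.exp (a ⬝ᵥ M.X ω)) P ∧
      ∫ ω, Real.exp (a ⬝ᵥ M.X ω) ∂P ≤ Real.exp (quad M.Sigma a * γ ^ 2 / 2) := by
  have hs : IsSelfAdjoint M.Sigma := M.Sigma_posDef.isHermitian
  have hc : ∀ f : ℝ → ℝ, ContinuousOn f (spectrum ℝ M.Sigma) := fun f =>
    (Matrix.finite_real_spectrum (A := M.Sigma)).continuousOn f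
  have hsym : ∀ f : ℝ → ℝ, (cfc f M.Sigma)ᵀ = cfc f M.Sigma := fun f => by
    have : IsSelfAdjoint (cfc f M.Sigma) := cfc_predicate f M.Sigma
    simpa [IsSelfAdjoint, Matrix.star_eq_conjTranspose] using this
  have hpos : ∀ x ∈ spectrum ℝ M.Sigma, 0 < x := by
    intro x hx
    obtain ⟨i, rfl⟩ := Set.ext_iff.mp
      M.Sigma_posDef.isHermitian.spectrum_real_eq_range_eigenvalues x |>.mp hx
    exact M.Sigma_posDef.eigenvalues_pos i
  set S := cfc (fun x : ℝ => √x) M.Sigma with hS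
  have h1 : invSqrt M.Sigma * S = 1 := by
    rw [invSqrt, hS, ← cfc_mul _ _ _ (hc _) (hc _), ← cfc_one ℝ M.Sigma]
    refine cfc_congr fun x hx => ?_
    have := Real.sqrt_pos.2 (hpos x hx)
    simp [this.ne']
  have h1' : S * invSqrt M.Sigma = 1 := mul_eq_one_comm.1 h1
  have h2 : S * S = M.Sigma := by
    rw [hS, ← cfc_mul _ _ _ (hc _) (hc _)]
    conv_rhs => rw [← cfc_id' ℝ M.Sigma]
    exact cfc_congr fun x hx => Real.mul_self_sqrt (hpos x hx).le
  have h3 := h (S *ᵥ a)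
  have e1 : ∀ ω, (S *ᵥ a) ⬝ᵥ (invSqrt M.Sigma *ᵥ M.X ω) = a ⬝ᵥ M.X ω := by
    intro ω
    rw [Matrix.dotProduct_mulVec, ← Matrix.mulVec_transpose, Matrix.mulVec_mulVec]
    have : (invSqrt M.Sigma)ᵀ = invSqrt M.Sigma := hsym _
    rw [this, h1, Matrix.one_mulVec]
  have e2 : (S *ᵥ a) ⬝ᵥ (S *ᵥ a) = quad M.Sigma a := by
    rw [Matrix.dotProduct_mulVec, ← Matrix.mulVec_transpose, Matrix.mulVec_mulVec, hsym, h2,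
      dotProduct_comm]
    rfl
  simp only [e1, e2] at h3
  exact h3

end FactorModel

/-! ### Normalized `ℓ_q` norms and scores -/

section Score

variable {ι : Type*} [Fintype ι]

/-- The `ℓ_q` norm with respect to the uniform probability on the index set. -/
def avgNorm (q : ℝ≥0∞) (v : ι → ℝ) : ℝ := (Fintype.card ι : ℝ) ^ (-(q⁻¹).toReal) * lqNorm q v

theorem avgNorm_add_le {q : ℝ≥0∞} (hq : 1 ≤ q) (u v : ι → ℝ) :
    avgNorm q (u + v) ≤ avgNorm q u + avgNorm q v := by
  have : Fact (1 ≤ q) := ⟨hq⟩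
  unfold avgNorm lqNorm
  rw [← mul_add, WithLp.toLp_add]
  exact mul_le_mul_of_nonneg_left (norm_add_le _ _) (by positivity)

theorem avgNorm_nonneg {q : ℝ≥0∞} (hq : 1 ≤ q) (v : ι → ℝ) : 0 ≤ avgNorm q v := by
  have : Fact (1 ≤ q) := ⟨hq⟩
  unfold avgNorm lqNorm
  positivity

theorem avgNorm_le_of_forall_abs_le [Nonempty ι] {q : ℝ≥0∞} (hq : 1 ≤ q) {v : ι → ℝ} {t : ℝ}
    (h : ∀ l, |v l| ≤ t) : avgNorm q v ≤ t := by
  have ht : 0 ≤ t := (abs_nonneg _).trans (h (Classical.arbitrary ι))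
  have hm : (0 : ℝ) < Fintype.card ι := Nat.cast_pos.2 Fintype.card_pos
  by_cases hq' : q = ∞
  · subst hq'
    simp only [avgNorm, lqNorm, ENNReal.inv_top, ENNReal.toReal_zero, neg_zero, Real.rpow_zero,
      one_mul, PiLp.norm_eq_ciSup]
    exact ciSup_le h
  have hr : 0 < q.toReal := ENNReal.toReal_pos (by positivity) hq'
  set r := q.toReal
  rw [avgNorm, lqNorm, PiLp.norm_eq_sum hr, ENNReal.toReal_inv]
  have h1 : ∑ l, ‖v l‖ ^ r ≤ Fintype.card ι * t ^ r := by
    calc ∑ l, ‖v l‖ ^ r ≤ ∑ _l : ι, t ^ r := Finset.sum_le_sum fun l _ =>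
          Real.rpow_le_rpow (norm_nonneg _) (h l) hr.le
      _ = _ := by simp
  calc (Fintype.card ι : ℝ) ^ (-r⁻¹) * (∑ l, ‖v l‖ ^ r) ^ (1 / r)
      ≤ (Fintype.card ι : ℝ) ^ (-r⁻¹) * (Fintype.card ι * t ^ r) ^ (1 / r) := by
        refine mul_le_mul_of_nonneg_left ?_ (by positivity)
        exact Real.rpow_le_rpow (Finset.sum_nonneg fun _ _ => by positivity) h1 (by positivity)
    _ = t := by
        rw [Real.mul_rpow hm.le (by positivity), ← Real.rpow_mul ht, mul_one_div_cancel hr.ne',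
          Real.rpow_one, ← mul_assoc, ← Real.rpow_add hm, one_div, neg_add_cancel, Real.rpow_zero,
          one_mul]

/-- The mean of the absolute values is the smallest of the normalized norms. -/
theorem sum_abs_le_card_mul_avgNorm [Nonempty ι] {q : ℝ≥0∞} (hq : 1 ≤ q) (v : ι → ℝ) :
    ∑ l, |v l| ≤ Fintype.card ι * avgNorm q v := by
  have hm : (0 : ℝ) < Fintype.card ι := Nat.cast_pos.2 Fintype.card_pos
  by_cases hq' : q = ∞
  · subst hq'
    simp only [avgNorm, lqNorm, ENNReal.inv_top, ENNReal.toReal_zero, neg_zero, Real.rpow_zero,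
      one_mul, PiLp.norm_eq_ciSup]
    calc ∑ l, |v l| ≤ ∑ _l : ι, ⨆ i, ‖v i‖ := Finset.sum_le_sum fun l _ =>
          le_ciSup (f := fun i => ‖v i‖) (Set.finite_range _).bddAbove l
      _ = _ := by simp
  have hr : 0 < q.toReal := ENNReal.toReal_pos (by positivity) hq'
  have hr1 : 1 ≤ q.toReal := by
    have := ENNReal.toReal_mono hq' hq
    simpa using this
  set r := q.toReal
  rw [avgNorm, lqNorm, PiLp.norm_eq_sum hr, ENNReal.toReal_inv]
  have h1 := Real.rpow_sum_le_const_mul_sum_rpow Finset.univ v hr1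
  have hs : 0 ≤ ∑ l, |v l| := Finset.sum_nonneg fun _ _ => abs_nonneg _
  have h2 := Real.rpow_le_rpow (by positivity) h1 (by positivity : 0 ≤ r⁻¹)
  rw [← Real.rpow_mul hs, mul_inv_cancel₀ hr.ne', Real.rpow_one,
    Real.mul_rpow (by positivity) (Finset.sum_nonneg fun _ _ => by positivity),
    ← Real.rpow_mul (by positivity), Finset.card_univ] at h2
  refine h2.trans (le_of_eq ?_)
  rw [← mul_assoc, one_div]
  congr 1
  rw [sub_mul, mul_inv_cancel₀ hr.ne', one_mul, sub_eq_add_neg, Real.rpow_add hm, Real.rpow_one]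

theorem avgNorm_two_sq [Nonempty ι] (v : ι → ℝ) :
    Fintype.card ι * avgNorm 2 v ^ 2 = ∑ l, v l ^ 2 := by
  have hm : (0 : ℝ) < Fintype.card ι := Nat.cast_pos.2 Fintype.card_pos
  have h1 : lqNorm 2 v ^ 2 = ∑ l, v l ^ 2 := EuclideanSpace.real_norm_sq_eq _
  rw [avgNorm, mul_pow, h1, ← Real.rpow_natCast, ← Real.rpow_mul hm.le, ← mul_assoc]
  have : -(2⁻¹ : ℝ≥0∞).toReal * ((2 : ℕ) : ℝ) = -1 := by
    rw [ENNReal.toReal_inv]; norm_num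
  rw [this, Real.rpow_neg_one, mul_inv_cancel₀ hm.ne', one_mul]

theorem lqNorm_div_lqNorm [Nonempty ι] (q : ℝ≥0∞) (u v : ι → ℝ) :
    lqNorm q u / lqNorm q v = avgNorm q u / avgNorm q v := by
  have hm : (0 : ℝ) < Fintype.card ι := Nat.cast_pos.2 Fintype.card_pos
  have : (Fintype.card ι : ℝ) ^ (-(q⁻¹).toReal) ≠ 0 := (Real.rpow_pos_of_pos hm _).ne'
  unfold avgNorm
  rw [mul_div_mul_left _ _ this]

variable {p : ℕ}

theorem card_off_pair {i j : Fin p} (h : i ≠ j) :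
    Fintype.card {l : Fin p // l ≠ i ∧ l ≠ j} = p - 2 := by
  classical
  rw [Fintype.card_subtype]
  have : (Finset.univ.filter fun l : Fin p => l ≠ i ∧ l ≠ j) = ({i, j} : Finset (Fin p))ᶜ := by
    ext l; simp
  rw [this, Finset.card_compl, Finset.card_pair h, Fintype.card_fin]

theorem card_off_pair_cast (hp : 2 < p) {i j : Fin p} (h : i ≠ j) :
    (Fintype.card {l : Fin p // l ≠ i ∧ l ≠ j} : ℝ) = (p : ℝ) - 2 := by
  rw [card_off_pair h, Nat.cast_sub hp.le]; norm_num

theorem nonempty_off_pair (hp : 2 < p) {i j : Fin p} (h : i ≠ j) :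
    Nonempty {l : Fin p // l ≠ i ∧ l ≠ j} := by
  rw [← Fintype.card_pos_iff, card_off_pair h]; omega

theorem score_eq_iInf (hp : 2 < p) (q : ℝ≥0∞) (R : Matrix (Fin p) (Fin p) ℝ) {i j : Fin p}
    (h : i ≠ j) :
    score q R i j = ⨅ ab : {ab : ℝ × ℝ // max |ab.1| |ab.2| = 1},
      avgNorm q (ab.1.1 • rowDel R i j i + ab.1.2 • rowDel R i j j) := by
  have hp' : (0 : ℝ) ≤ (p : ℝ) - 2 := by
    have : (2 : ℝ) < p := by exact_mod_cast hp
    linarith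
  unfold score
  rw [Real.mul_iInf_of_nonneg (by positivity)]
  simp only [avgNorm, card_off_pair_cast hp h]

instance : Nonempty {ab : ℝ × ℝ // max |ab.1| |ab.2| = 1} := ⟨⟨(1, 1), by simp⟩⟩

theorem score_le_of {q : ℝ≥0∞} (hq : 1 ≤ q) (hp : 2 < p) {R : Matrix (Fin p) (Fin p) ℝ}
    {i j : Fin p} (h : i ≠ j) {a b t : ℝ} (hab : max |a| |b| = 1)
    (ht : avgNorm q (a • rowDel R i j i + b • rowDel R i j j) ≤ t) : score q R i j ≤ t := by
  rw [score_eq_iInf hp q R h]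
  refine ciInf_le_of_le ⟨0, ?_⟩ (⟨(a, b), hab⟩ : {ab : ℝ × ℝ // max |ab.1| |ab.2| = 1}) ht
  rintro _ ⟨ab, rfl⟩
  exact avgNorm_nonneg hq _

theorem exists_of_score_lt {q : ℝ≥0∞} (hp : 2 < p) {R : Matrix (Fin p) (Fin p) ℝ}
    {i j : Fin p} (h : i ≠ j) {t : ℝ} (ht : score q R i j < t) :
    ∃ a b : ℝ, max |a| |b| = 1 ∧ avgNorm q (a • rowDel R i j i + b • rowDel R i j j) < t := by
  rw [score_eq_iInf hp q R h] at ht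
  obtain ⟨⟨⟨a, b⟩, hab⟩, h⟩ := exists_lt_of_ciInf_lt ht
  exact ⟨a, b, hab, h⟩

theorem avgNorm_off_comm {q : ℝ≥0∞} (hq : 1 ≤ q) (R : Matrix (Fin p) (Fin p) ℝ)
    (i j : Fin p) (a b : ℝ) :
    avgNorm q (a • rowDel R i j i + b • rowDel R i j j) =
      avgNorm q (b • rowDel R j i j + a • rowDel R j i i) := by
  let e : {l : Fin p // l ≠ i ∧ l ≠ j} ≃ {l : Fin p // l ≠ j ∧ l ≠ i} :=
    Equiv.subtypeEquivRight fun l => and_comm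
  have key : ∀ v : {l : Fin p // l ≠ j ∧ l ≠ i} → ℝ, lqNorm q (v ∘ e) = lqNorm q v := by
    intro v
    unfold lqNorm
    rcases q.trichotomy with rfl | rfl | hq'
    · simp at hq
    · rw [PiLp.norm_eq_ciSup, PiLp.norm_eq_ciSup]
      exact e.surjective.iSup_comp (fun l => ‖v l‖)
    · rw [PiLp.norm_eq_sum hq', PiLp.norm_eq_sum hq']
      congr 1
      exact e.sum_comp fun l => ‖v l‖ ^ q.toReal
  unfold avgNorm
  rw [Fintype.card_congr e, ← key]
  congr 2
  ext l
  simp [rowDel, e]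
  ring

theorem score_comm {q : ℝ≥0∞} (hq : 1 ≤ q) (hp : 2 < p) (R : Matrix (Fin p) (Fin p) ℝ)
    {i j : Fin p} (h : i ≠ j) : score q R i j = score q R j i := by
  have key : ∀ i j : Fin p, i ≠ j → score q R i j ≤ score q R j i := by
    intro i j h
    refine le_of_forall_pos_le_add fun ε hε => ?_
    obtain ⟨a, b, hab, hlt⟩ := exists_of_score_lt hp h.symm (lt_add_of_pos_right (score q R j i) hε)
    rw [avgNorm_off_comm hq] at hlt
    exact score_le_of hq hp h (by rwa [max_comm]) hlt.le
  exact le_antisymm (key i j h) (key j i h.symm)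

/-- Scores are stable under entrywise perturbations. -/
theorem score_le_score_add {q : ℝ≥0∞} (hq : 1 ≤ q) (hp : 2 < p) {R R' : Matrix (Fin p) (Fin p) ℝ}
    {e : ℝ} (he : ∀ i j, |R i j - R' i j| ≤ e) {i j : Fin p} (h : i ≠ j) :
    score q R i j ≤ score q R' i j + 2 * e := by
  have : Nonempty {l : Fin p // l ≠ i ∧ l ≠ j} := nonempty_off_pair hp h
  refine le_of_forall_pos_le_add fun ε hε => ?_
  obtain ⟨a, b, hab, hlt⟩ := exists_of_score_lt hp h (lt_add_of_pos_right (score q R' i j) hε)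
  refine score_le_of hq hp h hab ?_
  have ha : |a| ≤ 1 := hab ▸ le_max_left _ _
  have hb : |b| ≤ 1 := hab ▸ le_max_right _ _
  have e1 : a • rowDel R i j i + b • rowDel R i j j =
      (a • rowDel R' i j i + b • rowDel R' i j j) +
        fun l : {l : Fin p // l ≠ i ∧ l ≠ j} =>
          a * (R i l - R' i l) + b * (R j l - R' j l) := by
    ext l; simp [rowDel]; ring
  rw [e1]
  refine (avgNorm_add_le hq _ _).trans ?_
  have e2 : avgNorm q (fun l : {l : Fin p // l ≠ i ∧ l ≠ j} =>
      a * (R i l - R' i l) + b * (R j l - R' j l)) ≤ 2 * e := by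
    refine avgNorm_le_of_forall_abs_le hq fun l => ?_
    refine (abs_add_le _ _).trans ?_
    rw [abs_mul, abs_mul]
    have h1 := mul_le_mul ha (he i l) (abs_nonneg _) zero_le_one
    have h2 := mul_le_mul hb (he j l) (abs_nonneg _) zero_le_one
    linarith
  linarith

end Score

/-! ### Geometry of a regular factor model -/

namespace FactorModel

variable {p K : ℕ} {Ω : Type*} [MeasurableSpace Ω] {P : Measure Ω}

theorem lowRankDel_eq_gram (M : FactorModel p K P) (i j : Fin p) :
    M.lowRankDel i j = Matrix.of fun l m : {l : Fin p // l ≠ i ∧ l ≠ j} =>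
      inner ℝ (M.beta l) (M.beta m) := by
  ext l m
  simp [lowRankDel, inner_beta]

theorem TwoPure.exists_ne {M : FactorModel p K P} (h : M.TwoPure) : ∃ i j : Fin p, i ≠ j := by
  obtain ⟨i, -, j, -, hij⟩ := h ⟨0, M.one_le_K⟩
  exact ⟨i, j, hij⟩

/-- For `p = 2` the factor `1 / (p - 2)` is the junk value `0`, and the lower bound on `c_r` fails.
-/
theorem Regular.two_lt {M : FactorModel p K P} {q : ℝ≥0∞} {δ c C : ℝ}
    (h : M.Regular q δ c C) (hc : 0 < c) {i j : Fin p} (hij : i ≠ j) : 2 < p := by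
  by_contra hp
  have h2 : p = 2 := by
    have h1 := i.2
    have h2 := j.2
    have : i.1 ≠ j.1 := fun h => hij (Fin.ext h)
    omega
  have h3 := h.2.2.1 i j hij
  have h4 : (p : ℝ) - 2 = 0 := by rw [h2]; norm_num
  rw [h4] at h3
  norm_num at h3
  linarith

/-- The lower frame bound given by `c_r`. -/
theorem Regular.frame {M : FactorModel p K P} {q : ℝ≥0∞} {δ c C : ℝ}
    (h : M.Regular q δ c C) (hc : 0 < c) {i j : Fin p} (hij : i ≠ j)
    (w : EuclideanSpace ℝ (Fin K)) :
    c * ((p : ℝ) - 2) * ‖w‖ ^ 2 ≤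
      ∑ l : {l : Fin p // l ≠ i ∧ l ≠ j}, inner ℝ (M.beta l) w ^ 2 := by
  have hp : (2 : ℝ) < p := by exact_mod_cast h.two_lt hc hij
  have hp' : 0 < (p : ℝ) - 2 := by linarith
  have h3 := h.2.2.1 i j hij
  rw [lowRankDel_eq_gram, one_div, inv_mul_eq_div, lt_div_iff₀ hp'] at h3
  exact frame_of_kthEig_gram M.one_le_K _ (by positivity) h3.le w

/-- The lower frame bound of the `ζ_k`, given by `c_z`. -/
theorem Regular.le_norm_sum_zeta {M : FactorModel p K P} {q : ℝ≥0∞} {δ c C : ℝ}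
    (h : M.Regular q δ c C) (x : Fin K → ℝ) :
    c * ∑ k, x k ^ 2 ≤ ‖∑ k, x k • M.zeta k‖ ^ 2 := by
  have h1 := kthEig_card_mul_le_quad M.SigmaZ_posSemidef.isHermitian (Fintype.card_fin K) x
  have h2 : x ⬝ᵥ (M.SigmaZ *ᵥ x) = ‖∑ k, x k • M.zeta k‖ ^ 2 := by
    rw [← real_inner_self_eq_norm_sq, inner_sum_zeta]
    exact quad_eq_sum M.SigmaZ x
  have h3 : x ⬝ᵥ x = ∑ k, x k ^ 2 := by simp [dotProduct, sq]
  rw [h2, h3] at h1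
  refine le_trans ?_ h1
  exact mul_le_mul_of_nonneg_right h.2.1.le (Finset.sum_nonneg fun _ _ => sq_nonneg _)

/-- The indices whose rows have to be controlled: `I ∪ J̄₁`. -/
def IsActive (M : FactorModel p K P) (q : ℝ≥0∞) (δ : ℝ) (j : Fin p) : Prop :=
  M.IsPure j ∨ j ∈ M.Jbar q δ

theorem Regular.sq_le_norm_beta_sq {M : FactorModel p K P} {q : ℝ≥0∞} {δ c C : ℝ}
    (h : M.Regular q δ c C) (hc : 0 < c) {j : Fin p} (hj : M.IsActive q δ j) :
    c ^ 2 ≤ ‖M.beta j‖ ^ 2 := by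
  have h1 := h.le_norm_sum_zeta fun k => M.B j k
  have h2 := h.1 j hj
  have : c * c ≤ c * ∑ k, M.B j k ^ 2 := by gcongr
  unfold beta
  nlinarith

theorem mem_pureGroup {M : FactorModel p K P} {k : Fin K} {i : Fin p} :
    i ∈ M.pureGroup k ↔ M.A i k ≠ 0 ∧ ∀ k', k' ≠ k → M.A i k' = 0 := by
  simp [pureGroup]

theorem pureGroup_unique {M : FactorModel p K P} {k l : Fin K} {i : Fin p}
    (hk : i ∈ M.pureGroup k) (hl : i ∈ M.pureGroup l) : k = l := by
  by_contra h
  exact (mem_pureGroup.1 hk).1 ((mem_pureGroup.1 hl).2 k h)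

theorem beta_of_pure {M : FactorModel p K P} {k : Fin K} {i : Fin p}
    (h : i ∈ M.pureGroup k) : M.beta i = M.B i k • M.zeta k :=
  Finset.sum_eq_single k (fun l _ hl => by
    simp [B, (mem_pureGroup.1 h).2 l hl]) (by simp)

theorem Regular.lt_B_sq_of_pure {M : FactorModel p K P} {q : ℝ≥0∞} {δ c C : ℝ}
    (h : M.Regular q δ c C) {k : Fin K} {i : Fin p} (hi : i ∈ M.pureGroup k) :
    c < M.B i k ^ 2 := by
  have h2 := h.1 i (Or.inl ⟨k, hi⟩)
  rwa [Finset.sum_eq_single k (fun l _ hl => by simp [B, (mem_pureGroup.1 hi).2 l hl])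
    (by simp)] at h2

variable [IsProbabilityMeasure P]

/-- A linear combination of two rows of `R`, off the two diagonal entries, is the analysis of the
same combination of the vectors `β`. -/
theorem comb_rowDel (M : FactorModel p K P) (i j : Fin p) (a b : ℝ)
    (l : {l : Fin p // l ≠ i ∧ l ≠ j}) :
    (a • rowDel M.R i j i + b • rowDel M.R i j j) l =
      inner ℝ (M.beta l) (a • M.beta i + b • M.beta j) := by
  simp only [rowDel, Pi.add_apply, Pi.smul_apply, smul_eq_mul]
  rw [M.R_of_ne l.2.1.symm, M.R_of_ne l.2.2.symm, inner_add_right, inner_smul_right,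
    inner_smul_right, real_inner_comm (M.beta i), real_inner_comm (M.beta j)]

theorem abs_inner_beta_le (M : FactorModel p K P) (l : Fin p) (w : EuclideanSpace ℝ (Fin K)) :
    |inner ℝ (M.beta l) w| ≤ ‖w‖ :=
  (abs_real_inner_le_norm _ _).trans
    (mul_le_of_le_one_left (norm_nonneg _) (M.norm_beta_le_one l))

theorem score_le_of_norm_le {M : FactorModel p K P} {q : ℝ≥0∞} (hq : 1 ≤ q) (hp : 2 < p)
    {i j : Fin p} (hij : i ≠ j) {a b t : ℝ} (hab : max |a| |b| = 1)
    (h : ‖a • M.beta i + b • M.beta j‖ ≤ t) : score q M.R i j ≤ t := by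
  have : Nonempty {l : Fin p // l ≠ i ∧ l ≠ j} := nonempty_off_pair hp hij
  refine score_le_of hq hp hij hab (avgNorm_le_of_forall_abs_le hq fun l => ?_)
  rw [comb_rowDel]
  exact (M.abs_inner_beta_le _ _).trans h

/-- A small score means that the two vectors `β` are nearly parallel, whatever the value of `q`: by
the frame bound, `‖w‖²` is at most a multiple of the mean of `⟨β_l, w⟩² ≤ ‖w‖ |⟨β_l, w⟩|`, and the
mean of `|⟨β_l, w⟩|` is at most any normalized `ℓ_q` norm. -/
theorem Regular.exists_norm_le_of_score_lt {M : FactorModel p K P} {q q' : ℝ≥0∞} {δ c C : ℝ}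
    (h : M.Regular q δ c C) (hc : 0 < c) (hq : 1 ≤ q') {i j : Fin p} (hij : i ≠ j) {t : ℝ}
    (ht : score q' M.R i j < t) :
    ∃ a b : ℝ, max |a| |b| = 1 ∧ ‖a • M.beta i + b • M.beta j‖ ≤ t / c := by
  have hp := h.two_lt hc hij
  have : Nonempty {l : Fin p // l ≠ i ∧ l ≠ j} := nonempty_off_pair hp hij
  obtain ⟨a, b, hab, hlt⟩ := exists_of_score_lt hp hij ht
  refine ⟨a, b, hab, ?_⟩
  set w := a • M.beta i + b • M.beta j with hw
  set v := a • rowDel M.R i j i + b • rowDel M.R i j j with hv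
  have hvl : ∀ l, v l = inner ℝ (M.beta l) w := fun l => M.comb_rowDel i j a b l
  have h1 := h.frame hc hij w
  have h2 := sum_abs_le_card_mul_avgNorm hq v
  rw [card_off_pair_cast hp hij] at h2
  have hp' : 0 < (p : ℝ) - 2 := by
    have : (2 : ℝ) < p := by exact_mod_cast hp
    linarith
  have h3 : ∑ l : {l : Fin p // l ≠ i ∧ l ≠ j}, inner ℝ (M.beta l) w ^ 2 ≤
      ‖w‖ * ∑ l, |v l| := by
    rw [Finset.mul_sum]
    refine Finset.sum_le_sum fun l _ => ?_
    rw [hvl, ← sq_abs, sq]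
    exact mul_le_mul_of_nonneg_right (M.abs_inner_beta_le _ _) (abs_nonneg _)
  have h4 : c * ((p : ℝ) - 2) * ‖w‖ ^ 2 ≤ ‖w‖ * (((p : ℝ) - 2) * avgNorm q' v) :=
    h1.trans (h3.trans (mul_le_mul_of_nonneg_left h2 (norm_nonneg _)))
  rw [le_div_iff₀ hc]
  rcases (norm_nonneg w).eq_or_lt with h0 | h0
  · rw [← h0, zero_mul]
    exact (avgNorm_nonneg hq v).trans hlt.le
  · have h5 : ((p : ℝ) - 2) * ‖w‖ * (‖w‖ * c) ≤ ((p : ℝ) - 2) * ‖w‖ * avgNorm q' v := by nlinarith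
    exact (le_of_mul_le_mul_left h5 (by positivity)).trans hlt.le

/-- Two pure variables of the same group have score zero. -/
theorem score_le_zero_of_pure {M : FactorModel p K P} {q : ℝ≥0∞} (hq : 1 ≤ q) (hp : 2 < p)
    {k : Fin K} {i j : Fin p} (hij : i ≠ j) (hi : i ∈ M.pureGroup k) (hj : j ∈ M.pureGroup k) :
    score q M.R i j ≤ 0 := by
  have key : ∀ {i j : Fin p}, i ≠ j → i ∈ M.pureGroup k → j ∈ M.pureGroup k →
      |M.B i k| ≤ |M.B j k| → M.B j k ≠ 0 → score q M.R i j ≤ 0 := by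
    intro i j hij hi hj hle hne
    refine score_le_of_norm_le hq hp hij (a := 1) (b := -(M.B i k / M.B j k)) ?_ ?_
    · rw [abs_one, abs_neg, abs_div]
      exact max_eq_left (div_le_one_of_le₀ hle (abs_nonneg _))
    · have h0 : 1 * M.B i k + -(M.B i k / M.B j k) * M.B j k = 0 := by field_simp; ring
      rw [beta_of_pure hi, beta_of_pure hj, smul_smul, smul_smul, ← add_smul, h0, zero_smul,
        norm_zero]
  have hB : ∀ {i : Fin p}, i ∈ M.pureGroup k → M.B i k ≠ 0 := fun {i} hi => by
    simp only [B, Matrix.of_apply]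
    exact div_ne_zero (mem_pureGroup.1 hi).1 (M.sd_pos i).ne'
  rcases le_total |M.B i k| |M.B j k| with h | h
  · exact key hij hi hj h (hB hj)
  · rw [score_comm hq hp _ hij]
    exact key hij.symm hj hi h (hB hi)

end FactorModel

/-! ### The denoised diagonal -/

theorem avgNorm_smul {ι : Type*} [Fintype ι] {q : ℝ≥0∞} (hq : 1 ≤ q) (t : ℝ) (v : ι → ℝ) :
    avgNorm q (t • v) = |t| * avgNorm q v := by
  have : Fact (1 ≤ q) := ⟨hq⟩
  unfold avgNorm lqNorm
  rw [WithLp.toLp_smul, norm_smul, Real.norm_eq_abs]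
  ring

theorem abs_avgNorm_sub_le {ι : Type*} [Fintype ι] {q : ℝ≥0∞} (hq : 1 ≤ q) (u v : ι → ℝ) :
    |avgNorm q u - avgNorm q v| ≤ avgNorm q (u - v) := by
  have h1 := avgNorm_add_le hq (u - v) v
  have h2 := avgNorm_add_le hq (v - u) u
  have h3 : avgNorm q (v - u) = avgNorm q (u - v) := by
    have := avgNorm_smul hq (-1) (u - v)
    rw [neg_smul, one_smul, neg_sub, abs_neg, abs_one, one_mul] at this
    exact this
  rw [sub_add_cancel] at h1 h2
  rw [abs_le]
  constructor <;> linarith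

/-- Error propagation for the ratio estimator: `r ≈ τ m` is multiplied by `x / y ≈ τ`, and the
product estimates `N ≈ τ² m`. -/
theorem abs_mul_div_sub_le {r x y τ m N y₀ T E : ℝ} (hy₀ : 0 < y₀) (hE : 0 ≤ E) (hE1 : E ≤ 1)
    (hτ : 0 ≤ τ) (hτT : τ ≤ T) (hm : 0 ≤ m) (hm1 : m ≤ 1) (hy : y₀ ≤ y)
    (hr : |r - τ * m| ≤ E) (hx : |x - τ * y| ≤ E) (hN : |N - τ ^ 2 * m| ≤ (2 * T + 1) * E) :
    |r * (x / y) - N| ≤ (T + 1 / y₀ + T / y₀ + (2 * T + 1)) * E := by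
  have hy' : 0 < y := hy₀.trans_le hy
  have hd : |x / y - τ| ≤ E / y₀ := by
    have : x / y - τ = (x - τ * y) / y := by field_simp
    rw [this, abs_div, abs_of_pos hy']
    gcongr
  have e : r * (x / y) - N = τ * m * (x / y - τ) + (r - τ * m) * τ +
      (r - τ * m) * (x / y - τ) + -(N - τ ^ 2 * m) := by ring
  have hT : 0 ≤ T := hτ.trans hτT
  have b1 : |τ * m * (x / y - τ)| ≤ T * 1 * (E / y₀) := by
    rw [abs_mul, abs_mul, abs_of_nonneg hτ, abs_of_nonneg hm]
    gcongr
  have b2 : |(r - τ * m) * τ| ≤ E * T := by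
    rw [abs_mul, abs_of_nonneg hτ]; gcongr
  have b3 : |(r - τ * m) * (x / y - τ)| ≤ 1 * (E / y₀) := by
    rw [abs_mul]
    exact mul_le_mul (hr.trans hE1) hd (abs_nonneg _) zero_le_one
  rw [e]
  refine (abs_add_le _ _).trans ?_
  rw [abs_neg]
  have b12 := (abs_add_three (τ * m * (x / y - τ)) ((r - τ * m) * τ)
    ((r - τ * m) * (x / y - τ)))
  calc _ ≤ T * 1 * (E / y₀) + E * T + 1 * (E / y₀) + (2 * T + 1) * E := by linarith
    _ = _ := by ring

namespace FactorModel

/-- For nearly parallel vectors `β_i`, `β_j`, the ratio estimator of the diagonal entry `‖β_i‖²`,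
computed from a perturbed correlation matrix, has an error of the order of the perturbation. -/
theorem exists_denoise_bound {c D : ℝ} (hc : 0 < c) (hD : 0 ≤ D) :
    ∃ C₄ δ₀ : ℝ, 0 < C₄ ∧ 0 < δ₀ ∧ ∀ {p K : ℕ} {Ω : Type*} [MeasurableSpace Ω] {P : Measure Ω}
      [IsProbabilityMeasure P] {M : FactorModel p K P} {q : ℝ≥0∞} {δ' C δ : ℝ}
      {i j : Fin p} {R' : Matrix (Fin p) (Fin p) ℝ} {a b : ℝ},
      M.Regular q δ' c C → i ≠ j → c ^ 2 ≤ ‖M.beta i‖ ^ 2 → c ^ 2 ≤ ‖M.beta j‖ ^ 2 →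
      max |a| |b| = 1 → ‖a • M.beta i + b • M.beta j‖ ≤ D * δ → 0 ≤ δ → δ ≤ δ₀ →
      (∀ i j, |R' i j - M.R i j| ≤ δ) →
      |(|R' i j| * (lqNorm 2 (rowDel R' i j i) / lqNorm 2 (rowDel R' i j j))) -
        ‖M.beta i‖ ^ 2| ≤ C₄ * δ := by
  set T : ℝ := 2 / c with hT
  have hT0 : 0 < T := by positivity
  set E₀ : ℝ := T * D + 1 + T with hE₀
  have hE₀pos : 0 < E₀ := by positivity
  set y₀ : ℝ := √(c ^ 3) / 2 with hy₀
  have hy₀pos : 0 < y₀ := by positivity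
  refine ⟨(T + 1 / y₀ + T / y₀ + (2 * T + 1)) * E₀, min (1 / E₀) (min y₀ (c / (2 * (D + 1)))),
    by positivity, by positivity, ?_⟩
  intro p K Ω _ P _ M q δ' C δ i j R' a b hreg hij hi hj hab hpar hδ0 hδ hR
  have hδE : E₀ * δ ≤ 1 := by
    have := hδ.trans (min_le_left _ _)
    rwa [le_div_iff₀ hE₀pos, mul_comm] at this
  have hδy : δ ≤ y₀ := hδ.trans ((min_le_right _ _).trans (min_le_left _ _))
  have hδc : D * δ ≤ c / 2 := by
    have h := hδ.trans ((min_le_right _ _).trans (min_le_right _ _))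
    rw [le_div_iff₀ (by positivity)] at h
    nlinarith
  have hp := hreg.two_lt hc hij
  have hne : Nonempty {l : Fin p // l ≠ i ∧ l ≠ j} := nonempty_off_pair hp hij
  have hi1 := M.norm_beta_le_one i
  have hj1 := M.norm_beta_le_one j
  have hci : c ≤ ‖M.beta i‖ := le_of_sq_le_sq hi (norm_nonneg _)
  have hcj : c ≤ ‖M.beta j‖ := le_of_sq_le_sq hj (norm_nonneg _)
  have hb1 : |b| ≤ 1 := hab ▸ le_max_right _ _
  -- the coefficient of `β_i` cannot be small
  have ha : c / 2 ≤ |a| := by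
    rcases max_choice |a| |b| with h | h
    · rw [← h, hab]; linarith
    · have h1 : ‖b • M.beta j‖ = ‖M.beta j‖ := by
        rw [norm_smul, Real.norm_eq_abs, ← h, hab, one_mul]
      have h2 : ‖b • M.beta j‖ ≤ ‖a • M.beta i + b • M.beta j‖ + ‖a • M.beta i‖ := by
        have := norm_sub_le (a • M.beta i + b • M.beta j) (a • M.beta i)
        rwa [add_sub_cancel_left] at this
      have h3 : ‖a • M.beta i‖ ≤ |a| := by
        rw [norm_smul, Real.norm_eq_abs]
        exact mul_le_of_le_one_right (abs_nonneg _) hi1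
      linarith
  have ha0 : a ≠ 0 := by
    rintro rfl
    rw [abs_zero] at ha
    linarith
  have hapos : 0 < |a| := abs_pos.2 ha0
  have hainv : |a|⁻¹ ≤ T := by
    rw [hT, inv_le_comm₀ hapos (by positivity), inv_div]; exact ha
  set t : ℝ := -b / a with ht
  set e : EuclideanSpace ℝ (Fin K) := a⁻¹ • (a • M.beta i + b • M.beta j) with he
  have hbe : M.beta i = t • M.beta j + e := by
    rw [he, smul_add, smul_smul, smul_smul, inv_mul_cancel₀ ha0, one_smul, ht, neg_div, neg_smul,
      div_eq_inv_mul]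
    abel
  have htT : |t| ≤ T := by
    rw [ht, abs_div, abs_neg, div_eq_mul_inv]
    calc |b| * |a|⁻¹ ≤ 1 * T := by gcongr
      _ = T := one_mul T
  have heT : ‖e‖ ≤ T * (D * δ) := by
    rw [he, norm_smul, norm_inv, Real.norm_eq_abs]
    gcongr
  have heE : ‖e‖ + (1 + |t|) * δ ≤ E₀ * δ := by
    rw [hE₀]; nlinarith
  have heE' : ‖e‖ ≤ E₀ * δ := by
    have : 0 ≤ (1 + |t|) * δ := by positivity
    linarith
  have hEδ0 : 0 ≤ E₀ * δ := by positivity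
  rw [lqNorm_div_lqNorm]
  set u := rowDel R' i j i with hu
  set v := rowDel R' i j j with hv
  rw [mul_assoc _ E₀ δ]
  refine abs_mul_div_sub_le (τ := |t|) (m := ‖M.beta j‖ ^ 2) hy₀pos hEδ0
    hδE (abs_nonneg t) htT (sq_nonneg _) (pow_le_one₀ (norm_nonneg _) hj1) ?_ ?_ ?_ ?_
  · -- lower bound for the denominator
    have h1 := hreg.frame hc hij (M.beta j)
    have h2 := avgNorm_two_sq (rowDel M.R i j j)
    have h3 : ∀ l : {l : Fin p // l ≠ i ∧ l ≠ j},
        rowDel M.R i j j l = inner ℝ (M.beta l) (M.beta j) := fun l => by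
      simp only [rowDel]
      rw [M.R_of_ne l.2.2.symm, real_inner_comm]
    simp_rw [h3] at h2
    rw [← h2, card_off_pair_cast hp hij] at h1
    have hp' : 0 < (p : ℝ) - 2 := by
      have : (2 : ℝ) < p := by exact_mod_cast hp
      linarith
    have h4 : c * ‖M.beta j‖ ^ 2 ≤ avgNorm 2 (rowDel M.R i j j) ^ 2 := by
      refine le_of_mul_le_mul_left ?_ hp'
      linarith
    have h5 : √(c ^ 3) ≤ avgNorm 2 (rowDel M.R i j j) := by
      refine (Real.sqrt_le_left (avgNorm_nonneg (by norm_num) _)).2 (le_trans ?_ h4)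
      nlinarith
    have h6 : |avgNorm 2 v - avgNorm 2 (rowDel M.R i j j)| ≤ δ :=
      (abs_avgNorm_sub_le (by norm_num) _ _).trans
        (avgNorm_le_of_forall_abs_le (by norm_num) fun l => hR j l)
    have := (abs_le.1 h6).1
    rw [hy₀]
    linarith
  · have h1 : M.R i j = t * ‖M.beta j‖ ^ 2 + inner ℝ e (M.beta j) := by
      rw [M.R_of_ne hij, hbe, inner_add_left, inner_smul_left, real_inner_self_eq_norm_sq]
      simp
    have h2 : |t| * ‖M.beta j‖ ^ 2 = |t * ‖M.beta j‖ ^ 2| := by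
      rw [abs_mul, abs_of_nonneg (sq_nonneg ‖M.beta j‖)]
    rw [h2]
    refine (abs_abs_sub_abs_le _ _).trans ?_
    have h3 : R' i j - t * ‖M.beta j‖ ^ 2 = (R' i j - M.R i j) + inner ℝ e (M.beta j) := by
      rw [h1]; ring
    rw [h3]
    refine (abs_add_le _ _).trans ?_
    have h4 : |inner ℝ e (M.beta j)| ≤ ‖e‖ :=
      (abs_real_inner_le_norm _ _).trans (mul_le_of_le_one_right (norm_nonneg _) hj1)
    have h5 : 0 ≤ |t| * δ := by positivity
    have := hR i j
    linarith
  · rw [← avgNorm_smul (by norm_num)]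
    refine (abs_avgNorm_sub_le (by norm_num) _ _).trans
      (avgNorm_le_of_forall_abs_le (by norm_num) fun l => ?_)
    have h1 : (u - t • v) l = (R' i l - M.R i l) + -(t * (R' j l - M.R j l)) +
        inner ℝ (M.beta l) e := by
      have h2 : M.R i l = t * M.R j l + inner ℝ (M.beta l) e := by
        rw [M.R_of_ne l.2.1.symm, M.R_of_ne l.2.2.symm]
        conv_lhs => rw [hbe]
        rw [inner_add_left, inner_smul_left, real_inner_comm e]
        simp
      simp only [hu, hv, rowDel, Pi.sub_apply, Pi.smul_apply, smul_eq_mul]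
      rw [h2]; ring
    rw [h1]
    refine (abs_add_three _ _ _).trans ?_
    rw [abs_neg, abs_mul]
    have h3 := hR i l
    have h4 := mul_le_mul_of_nonneg_left (hR j l) (abs_nonneg t)
    have h5 := M.abs_inner_beta_le l e
    linarith
  · have h1 : ‖M.beta i‖ ^ 2 - |t| ^ 2 * ‖M.beta j‖ ^ 2 =
        2 * (t * inner ℝ (M.beta j) e) + ‖e‖ ^ 2 := by
      rw [hbe, norm_add_sq_real, inner_smul_left, norm_smul, Real.norm_eq_abs, mul_pow, sq_abs]
      simp; ring
    rw [h1]
    refine (abs_add_le _ _).trans ?_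
    rw [abs_mul, abs_mul, abs_of_nonneg (sq_nonneg ‖e‖), abs_two]
    have h2 : |t| * |inner ℝ (M.beta j) e| ≤ T * (E₀ * δ) :=
      mul_le_mul htT ((M.abs_inner_beta_le j e).trans heE') (abs_nonneg _) hT0.le
    have h3 : ‖e‖ ^ 2 ≤ 1 * (E₀ * δ) := by
      rw [sq]
      exact mul_le_mul (heE'.trans hδE) heE' (norm_nonneg _) zero_le_one
    linarith

end FactorModel

/-! ### The estimated groups -/

theorem mem_parallelSet {p : ℕ} {H : Finset (Finset (Fin p))} {i : Fin p} :
    i ∈ parallelSet H ↔ ∃ g ∈ H, i ∈ g := by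
  simp [parallelSet, Finset.mem_sup]

namespace FactorModel

variable {p K : ℕ} {Ω : Type*} [MeasurableSpace Ω] {P : Measure Ω}

/-- The collection `H` consists of all groups of pure variables and of further groups that are
contained in `J̄₁`. -/
structure GroupSpec (M : FactorModel p K P) (q : ℝ≥0∞) (δ : ℝ) (H : Finset (Finset (Fin p))) :
    Prop where
  pure_mem : ∀ k, M.pureGroup k ∈ H
  eq_pure : ∀ g ∈ H, ∀ k, (g ∩ M.pureGroup k).Nonempty → g = M.pureGroup k
  nonempty : ∀ g ∈ H, g.Nonempty
  mem_Jbar : ∀ g ∈ H, ∀ i ∈ g, ¬ M.IsPure i → i ∈ M.Jbar q δ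

theorem GroupSpec.eq_of_mem {M : FactorModel p K P} {q : ℝ≥0∞} {δ : ℝ}
    {H : Finset (Finset (Fin p))} (h : M.GroupSpec q δ H) {g : Finset (Fin p)} (hg : g ∈ H)
    {k : Fin K} {i : Fin p} (hi : i ∈ g) (hik : i ∈ M.pureGroup k) : g = M.pureGroup k :=
  h.eq_pure g hg k ⟨i, Finset.mem_inter.2 ⟨hi, hik⟩⟩

theorem GroupSpec.isActive {M : FactorModel p K P} {q : ℝ≥0∞} {δ : ℝ}
    {H : Finset (Finset (Fin p))} (h : M.GroupSpec q δ H) {i : Fin p} (hi : i ∈ parallelSet H) :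
    M.IsActive q δ i := by
  obtain ⟨g, hg, hig⟩ := mem_parallelSet.1 hi
  by_cases hp : M.IsPure i
  · exact Or.inl hp
  · exact Or.inr (h.mem_Jbar g hg i hig hp)

variable [IsProbabilityMeasure P]

/-- If `R'` is entrywise within `δ / 2` of `R`, scores change by at most `δ`. Hence all pairs inside
a group of pure variables are joined, as their population score is zero, and a joined pair has
population score at most `4 δ`, so it either lies in such a group or consists of members of `J̄₁`.
-/
theorem groupSpec_parallelGroups {M : FactorModel p K P} {q : ℝ≥0∞} {δ : ℝ} (hq : 1 ≤ q)
    (hp : 2 < p) (hδ : 0 ≤ δ) (htwo : M.TwoPure) (hsep : M.Separated q δ)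
    {R' : Matrix (Fin p) (Fin p) ℝ} (hR : ∀ i j, |R' i j - M.R i j| ≤ δ / 2) :
    M.GroupSpec q δ (parallelGroups q R' δ) ∧
      ∀ g ∈ parallelGroups q R' δ, ∀ i ∈ g, ∃ l ∈ g, l ≠ i ∧ score q R' i l ≤ 2 * δ := by
  have hS : ∀ {i j : Fin p}, i ≠ j → score q R' i j ≤ 2 * δ → score q M.R i j ≤ 4 * δ := by
    intro i j hij h
    have := score_le_score_add hq hp (R := M.R) (R' := R')
      (fun i j => by rw [abs_sub_comm]; exact hR i j) hij
    linarith
  have hpure : ∀ {i j : Fin p}, i ≠ j → score q R' i j ≤ 2 * δ → ∀ k,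
      i ∈ M.pureGroup k → j ∈ M.pureGroup k := by
    intro i j hij h k hk
    by_contra hjk
    refine absurd (hsep i j ⟨k, hk⟩ ?_) (not_lt.2 (hS hij h))
    rintro ⟨l, hil, hjl⟩
    rw [pureGroup_unique hk hil] at hjk
    exact hjk hjl
  rw [parallelGroups_eq_groupFold]
  set J : Fin p × Fin p → Prop := fun ij => score q R' ij.1 ij.2 ≤ 2 * δ with hJ
  have hpartner := groupFold_partner (J := J) (orderedPairs p)
    fun x hx => (mem_orderedPairs.1 hx).ne
  have hpartner' : ∀ g ∈ groupFold J (orderedPairs p), ∀ i ∈ g, ∃ l ∈ g, l ≠ i ∧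
      score q R' i l ≤ 2 * δ := by
    intro g hg i hi
    obtain ⟨l, hl, hli, h | h⟩ := (hpartner g hg).2 i hi
    · exact ⟨l, hl, hli, h⟩
    · refine ⟨l, hl, hli, ?_⟩
      rw [score_comm hq hp R' hli.symm]
      exact h
  have hclass : ∀ k, M.pureGroup k ∈ groupFold J (orderedPairs p) ∧
      ∀ g ∈ groupFold J (orderedPairs p), (g ∩ M.pureGroup k).Nonempty →
        g = M.pureGroup k := by
    intro k
    refine groupFold_eq_class (htwo k) ?_ ?_
    · intro i j hij h
      refine ⟨hpure hij.ne h k, hpure hij.ne' ?_ k⟩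
      rw [score_comm hq hp R' hij.ne']
      exact h
    · intro i hi j hj hij
      have h1 := score_le_score_add hq hp hR hij.ne (q := q)
      have h2 := score_le_zero_of_pure hq hp hij.ne hi hj
      simp only [hJ]
      linarith
  refine ⟨⟨fun k => (hclass k).1, fun g hg k => (hclass k).2 g hg, fun g hg => (hpartner g hg).1,
    ?_⟩, hpartner'⟩
  intro g hg i hi hnp
  obtain ⟨l, hl, hli, h⟩ := hpartner' g hg i hi
  simp only [Jbar, Finset.mem_filter, Finset.mem_univ, true_and]
  refine ⟨hnp, l, ?_, hli, hS hli.symm h⟩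
  rintro ⟨k, hk⟩
  rw [(hclass k).2 g hg ⟨l, Finset.mem_inter.2 ⟨hl, hk⟩⟩] at hi
  exact hnp ⟨k, hi⟩

/-- On the estimated groups, the denoised diagonal is close to `‖β_i‖²`. -/
theorem exists_Mhat_bound {c : ℝ} (hc : 0 < c) :
    ∃ C₄ δ₀ : ℝ, 0 < C₄ ∧ 0 < δ₀ ∧ ∀ {p K : ℕ} {Ω : Type*} [MeasurableSpace Ω] {P : Measure Ω}
      [IsProbabilityMeasure P] {M : FactorModel p K P} {q : ℝ≥0∞} {C δ : ℝ}
      {R' : Matrix (Fin p) (Fin p) ℝ} {H : Finset (Finset (Fin p))} {jhat : Fin p → Fin p},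
      1 ≤ q → M.Regular q δ c C → 0 < δ → δ ≤ δ₀ →
      (∀ i j, |R' i j - M.R i j| ≤ δ / 2) → M.GroupSpec q δ H →
      (∀ g ∈ H, ∀ i ∈ g, ∃ l ∈ g, l ≠ i ∧ score q R' i l ≤ 2 * δ) →
      IsPartnerMap R' H jhat →
      ∀ i ∈ parallelSet H, |Mhat R' jhat i i - ‖M.beta i‖ ^ 2| ≤ C₄ * δ := by
  obtain ⟨C₄, δ₀, hC₄, hδ₀, hmain⟩ := exists_denoise_bound (c := c) (D := (4 / c + 3) / c) hc
    (by positivity)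
  refine ⟨C₄, δ₀, hC₄, hδ₀, ?_⟩
  intro p K Ω _ P _ M q C δ R' H jhat hq hreg hδ hδ' hR hspec hpart hjhat i hi
  obtain ⟨g, hg, hig, hjg, hji, hmin⟩ := hjhat i hi
  obtain ⟨l, hl, hli, hil⟩ := hpart g hg i hig
  have hp := hreg.two_lt hc hli
  have hR' : ∀ i j, |M.R i j - R' i j| ≤ δ / 2 := fun i j => by rw [abs_sub_comm]; exact hR i j
  have h1 : score q M.R i l < 4 * δ := by
    have := score_le_score_add hq hp hR' hli.symm (q := q)
    linarith
  obtain ⟨a, b, hab, hn⟩ := hreg.exists_norm_le_of_score_lt hc hq hli.symm h1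
  have h2 : score 2 M.R i l ≤ 4 * δ / c := score_le_of_norm_le (by norm_num) hp hli.symm hab hn
  have h3 := score_le_score_add (q := 2) (by norm_num) hp hR hli.symm
  have h4 := hmin l hl hli
  have h5 := score_le_score_add (q := 2) (by norm_num) hp hR' hji.symm
  have h6 : score 2 M.R i (jhat i) < (4 / c + 3) * δ := by
    have : 4 * δ / c = 4 / c * δ := by ring
    rw [add_mul]
    linarith
  obtain ⟨a, b, hab, hn⟩ := hreg.exists_norm_le_of_score_lt hc (by norm_num) hji.symm h6
  have hact : ∀ m ∈ g, c ^ 2 ≤ ‖M.beta m‖ ^ 2 := fun m hm =>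
    hreg.sq_le_norm_beta_sq hc (hspec.isActive (mem_parallelSet.2 ⟨g, hg, hm⟩))
  have := hmain hreg hji.symm (hact i hig) (hact _ hjg) hab
    (hn.trans (le_of_eq (by ring))) hδ.le hδ' fun i j => (hR i j).trans (by linarith)
  simpa [Mhat] using this

/-! ### Quadratic forms of the estimated matrices -/

/-- The matrix `D^{-1/2} S D^{-1/2}`, where `D = diag Σ`. -/
def scaled (M : FactorModel p K P) (S : Matrix (Fin p) (Fin p) ℝ) : Matrix (Fin p) (Fin p) ℝ :=
  Matrix.of fun i j => S i j / (M.sd i * M.sd j)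

/-- On vectors with at most `s` non-zero entries, the quadratic forms of `S` and `Σ` differ by a
factor between `1 - η` and `1 + η`. -/
def SparseClose (M : FactorModel p K P) (S : Matrix (Fin p) (Fin p) ℝ) (s : ℕ) (η : ℝ) : Prop :=
  ∀ a : Fin p → ℝ, (Finset.univ.filter fun i => a i ≠ 0).card ≤ s →
    |quad (S - M.Sigma) a| ≤ η * quad M.Sigma a

theorem quad_scaled (M : FactorModel p K P) (S : Matrix (Fin p) (Fin p) ℝ) (x : Fin p → ℝ) :
    quad (M.scaled S) x = quad S fun i => x i / M.sd i := by
  rw [quad_eq_sum, quad_eq_sum]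
  refine Finset.sum_congr rfl fun i _ => Finset.sum_congr rfl fun j _ => ?_
  have := (M.sd_pos i).ne'
  have := (M.sd_pos j).ne'
  simp only [scaled, Matrix.of_apply]
  field_simp

theorem SparseClose.scaled {M : FactorModel p K P} {S : Matrix (Fin p) (Fin p) ℝ} {s : ℕ} {η : ℝ}
    (h : M.SparseClose S s η) {x : Fin p → ℝ}
    (hx : (Finset.univ.filter fun i => x i ≠ 0).card ≤ s) :
    |quad (M.scaled S) x - quad M.R x| ≤ η * quad M.R x := by
  have h1 := h (fun i => x i / M.sd i) (by
    refine le_of_eq_of_le (congrArg Finset.card (Finset.filter_congr fun i _ => ?_)) hx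
    simp [(M.sd_pos i).ne'])
  have h2 : quad M.Sigma (fun i => x i / M.sd i) = quad M.R x := by
    rw [quad_Sigma]
    congr 1
    funext i
    rw [mul_div_cancel₀ _ (M.sd_pos i).ne']
  rwa [quad_sub, h2, ← quad_scaled] at h1

theorem quad_R_le (M : FactorModel p K P) (x : Fin p → ℝ) :
    quad M.R x ≤ ‖∑ i, x i • M.beta i‖ ^ 2 + ∑ i, x i ^ 2 := by
  rw [quad_R]
  refine add_le_add_right (Finset.sum_le_sum fun i _ => ?_) _
  have : 0 ≤ ‖M.beta i‖ ^ 2 * x i ^ 2 := by positivity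
  linarith

theorem quad_single {n : ℕ} (S : Matrix (Fin n) (Fin n) ℝ) (i : Fin n) :
    quad S (Pi.single i 1) = S i i := by
  simp [quad]

theorem quad_single_add {n : ℕ} {S : Matrix (Fin n) (Fin n) ℝ} (hS : ∀ i j, S i j = S j i)
    (i j : Fin n) :
    quad S (Pi.single i 1 + Pi.single j 1) - quad S (Pi.single i 1 - Pi.single j 1) =
      4 * S i j := by
  simp only [quad, Matrix.mulVec_add, Matrix.mulVec_sub, add_dotProduct, sub_dotProduct,
    dotProduct_add, dotProduct_sub]
  simp
  rw [hS j i]; ring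

theorem SparseClose.abs_scaled_sub_le {M : FactorModel p K P} {S : Matrix (Fin p) (Fin p) ℝ}
    {η : ℝ} (h : M.SparseClose S 2 η) (hS : ∀ i j, S i j = S j i) (i j : Fin p) :
    |M.scaled S i j - M.R i j| ≤ η := by
  have hcard : ∀ x : Fin p → ℝ, (∀ l, x l ≠ 0 → l ∈ ({i, j} : Finset (Fin p))) →
      (Finset.univ.filter fun i => x i ≠ 0).card ≤ 2 := fun x hx =>
    (Finset.card_le_card fun l hl => hx l (Finset.mem_filter.1 hl).2).trans Finset.card_le_two
  have hsupp : ∀ s : ℝ, ∀ l, (Pi.single i 1 + s • Pi.single j 1 : Fin p → ℝ) l ≠ 0 →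
      l ∈ ({i, j} : Finset (Fin p)) := by
    intro s l hl
    by_contra hl'
    simp only [Finset.mem_insert, Finset.mem_singleton, not_or] at hl'
    simp [hl'.1, hl'.2] at hl
  have h1 := h.scaled (hcard _ (hsupp 1))
  have h2 := h.scaled (hcard _ (hsupp (-1)))
  have e1 : (Pi.single i 1 + (1 : ℝ) • Pi.single j 1 : Fin p → ℝ) =
    Pi.single i 1 + Pi.single j 1 := by rw [one_smul]
  have e2 : (Pi.single i 1 + (-1 : ℝ) • Pi.single j 1 : Fin p → ℝ) =
    Pi.single i 1 - Pi.single j 1 := by rw [neg_one_smul, sub_eq_add_neg]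
  rw [e1] at h1
  rw [e2] at h2
  have hW : ∀ i j, M.scaled S i j = M.scaled S j i := fun i j => by
    simp only [FactorModel.scaled, Matrix.of_apply, hS i j, mul_comm]
  have h3 := quad_single_add hW i j
  have h4 := quad_single_add M.R_comm i j
  have h5 : quad M.R (Pi.single i 1 + Pi.single j 1) + quad M.R (Pi.single i 1 - Pi.single j 1)
      = 4 := by
    simp only [quad, Matrix.mulVec_add, Matrix.mulVec_sub, add_dotProduct, sub_dotProduct,
      dotProduct_add, dotProduct_sub]
    simp [R_self]
    ring
  rw [abs_le] at h1 h2 ⊢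
  have h6 : η * quad M.R (Pi.single i 1 + Pi.single j 1) +
    η * quad M.R (Pi.single i 1 - Pi.single j 1) = 4 * η := by rw [← mul_add, h5, mul_comm]
  constructor <;> linarith

theorem corr_eq_scaled (M : FactorModel p K P) {S : Matrix (Fin p) (Fin p) ℝ} (i j : Fin p) :
    corr S i j = M.scaled S i j / √(M.scaled S i i * M.scaled S j j) := by
  have hi := M.sd_pos i
  have hj := M.sd_pos j
  simp only [corr, FactorModel.scaled, Matrix.of_apply]
  have : S i i / (M.sd i * M.sd i) * (S j j / (M.sd j * M.sd j)) =
      S i i * S j j / (M.sd i * M.sd j) ^ 2 := by field_simp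
  rw [this, Real.sqrt_div' _ (sq_nonneg _), Real.sqrt_sq (by positivity), div_div_div_cancel_right₀
    (by positivity)]

theorem SparseClose.abs_corr_sub_le {M : FactorModel p K P} {S : Matrix (Fin p) (Fin p) ℝ}
    {η : ℝ} (h : M.SparseClose S 2 η) (hS : ∀ i j, S i j = S j i) (hη : η ≤ 1 / 2) (i j : Fin p) :
    |corr S i j - M.R i j| ≤ 4 * η := by
  have hW := h.abs_scaled_sub_le hS
  have hη0 : 0 ≤ η := (abs_nonneg _).trans (hW i j)
  have hd : ∀ i, 1 - η ≤ M.scaled S i i ∧ M.scaled S i i ≤ 1 + η := fun i => by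
    have := abs_le.1 (hW i i)
    rw [R_self] at this
    constructor <;> linarith
  rw [M.corr_eq_scaled]
  set g := √(M.scaled S i i * M.scaled S j j) with hg
  have hg1 : 1 - η ≤ g := by
    refine Real.le_sqrt_of_sq_le ?_
    rw [sq]
    exact mul_le_mul (hd i).1 (hd j).1 (by linarith) (by linarith [(hd i).1])
  have hg2 : g ≤ 1 + η := by
    refine (Real.sqrt_le_left (by linarith)).2 ?_
    rw [sq]
    exact mul_le_mul (hd i).2 (hd j).2 (by linarith [(hd j).1]) (by linarith)
  have hg0 : 0 < g := by linarith
  have hR1 : |M.R i j| ≤ 1 := by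
    by_cases hij : i = j
    · rw [hij, R_self, abs_one]
    · rw [M.R_of_ne hij]
      exact (M.abs_inner_beta_le i _).trans (M.norm_beta_le_one j)
  have e : M.scaled S i j / g - M.R i j =
      ((M.scaled S i j - M.R i j) + M.R i j * (1 - g)) / g := by field_simp; ring
  rw [e, abs_div, abs_of_pos hg0, div_le_iff₀ hg0]
  have h1 : |M.R i j * (1 - g)| ≤ 1 * η := by
    rw [abs_mul]
    refine mul_le_mul hR1 ?_ (abs_nonneg _) zero_le_one
    rw [abs_le]; constructor <;> linarith
  have := abs_add_le (M.scaled S i j - M.R i j) (M.R i j * (1 - g))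
  have := hW i j
  nlinarith

theorem ThetaHat_of_ne {S : Matrix (Fin p) (Fin p) ℝ} {jhat : Fin p → Fin p} {i j : Fin p}
    (h : i ≠ j) : ThetaHat S jhat i j = S i j := by
  simp [ThetaHat, Matrix.diagonal_mul_diagonal, Matrix.diagonal_apply_ne _ h]

theorem ThetaHat_self {S : Matrix (Fin p) (Fin p) ℝ} {jhat : Fin p → Fin p} {i : Fin p}
    (h : 0 ≤ S i i) : ThetaHat S jhat i i = S i i * Mhat (corr S) jhat i i := by
  simp only [ThetaHat, Matrix.diagonal_mul_diagonal, Matrix.sub_apply, Matrix.diagonal_apply_eq]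
  have := Real.mul_self_sqrt h
  linear_combination (-(1 - Mhat (corr S) jhat i i)) * this

theorem Mhat_eq_scaled (M : FactorModel p K P) {S : Matrix (Fin p) (Fin p) ℝ}
    {jhat : Fin p → Fin p} (hS : ∀ i, 0 < S i i) (i j : Fin p) :
    Mhat (corr S) jhat i j = M.scaled (ThetaHat S jhat) i j /
      (√(M.scaled S i i) * √(M.scaled S j j)) := by
  have hW : ∀ i, 0 < M.scaled S i i := fun i => by
    simp only [FactorModel.scaled, Matrix.of_apply]
    have := hS i
    have := M.sd_pos i
    positivity
  by_cases hij : i = j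
  · subst hij
    have h1 : M.scaled (ThetaHat S jhat) i i = M.scaled S i i * Mhat (corr S) jhat i i := by
      simp only [FactorModel.scaled, Matrix.of_apply, ThetaHat_self (hS i).le]
      ring
    rw [Real.mul_self_sqrt (hW i).le, h1, mul_div_cancel_left₀ _ (hW i).ne']
  · rw [← Real.sqrt_mul (hW i).le]
    have h1 : M.scaled (ThetaHat S jhat) i j = M.scaled S i j := by
      simp only [FactorModel.scaled, Matrix.of_apply, ThetaHat_of_ne hij]
    rw [h1, ← M.corr_eq_scaled]
    simp [Mhat, hij]

/-- On vectors supported in `Hset` with at most `s` non-zero entries, the quadratic form of `Θ`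
(after scaling) is close to `x ↦ ‖∑ x_i β_i‖²`, the form of the noiseless correlation matrix. -/
def FormApprox (M : FactorModel p K P) (Θ : Matrix (Fin p) (Fin p) ℝ) (Hset : Finset (Fin p))
    (s : ℕ) (ω : ℝ) : Prop :=
  ∀ x : Fin p → ℝ, (∀ i, x i ≠ 0 → i ∈ Hset) → (Finset.univ.filter fun i => x i ≠ 0).card ≤ s →
    |quad (M.scaled Θ) x - ‖∑ i, x i • M.beta i‖ ^ 2| ≤
      ω * (‖∑ i, x i • M.beta i‖ ^ 2 + ∑ i, x i ^ 2)

theorem SparseClose.formApprox {M : FactorModel p K P} {S : Matrix (Fin p) (Fin p) ℝ}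
    {s : ℕ} {η η₂ ε : ℝ} {Hset : Finset (Fin p)} {jhat : Fin p → Fin p}
    (h : M.SparseClose S s η) (h₂ : M.SparseClose S 2 η₂) (hη : 0 ≤ η) (hη₂ : η₂ ≤ 1 / 2)
    (hS : ∀ i j, S i j = S j i) (hε : ε ≤ 1)
    (hM : ∀ i ∈ Hset, |Mhat (corr S) jhat i i - ‖M.beta i‖ ^ 2| ≤ ε) :
    M.FormApprox (ThetaHat S jhat) Hset s (η + (2 * η₂ + ε)) := by
  intro x hx hcard
  have hW := h₂.abs_scaled_sub_le hS
  have hS0 : ∀ i, 0 ≤ S i i := fun i => by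
    have := abs_le.1 (hW i i)
    rw [R_self] at this
    have h1 : 0 ≤ M.scaled S i i := by linarith
    have h2 := M.sd_pos i
    have h3 : S i i = M.scaled S i i * (M.sd i * M.sd i) := by
      simp only [FactorModel.scaled, Matrix.of_apply]; field_simp
    rw [h3]; positivity
  have e1 : quad (M.scaled (ThetaHat S jhat)) x = quad (M.scaled S) x +
      ∑ i, M.scaled S i i * (Mhat (corr S) jhat i i - 1) * x i ^ 2 := by
    rw [quad_eq_sum, quad_eq_sum, ← Finset.sum_add_distrib]
    refine Finset.sum_congr rfl fun i _ => ?_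
    rw [← Finset.add_sum_erase _ _ (Finset.mem_univ i),
      ← Finset.add_sum_erase _ (fun j => x i * M.scaled S i j * x j) (Finset.mem_univ i)]
    have h1 : ∑ j ∈ Finset.univ.erase i, x i * M.scaled (ThetaHat S jhat) i j * x j =
        ∑ j ∈ Finset.univ.erase i, x i * M.scaled S i j * x j := by
      refine Finset.sum_congr rfl fun j hj => ?_
      simp only [FactorModel.scaled, Matrix.of_apply,
        ThetaHat_of_ne (Finset.ne_of_mem_erase hj).symm]
    rw [h1]
    simp only [FactorModel.scaled, Matrix.of_apply, ThetaHat_self (hS0 i)]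
    ring
  have e2 : quad (M.scaled (ThetaHat S jhat)) x - ‖∑ i, x i • M.beta i‖ ^ 2 =
      (quad (M.scaled S) x - quad M.R x) +
      ∑ i, ((M.scaled S i i - 1) * (Mhat (corr S) jhat i i - 1) +
        (Mhat (corr S) jhat i i - ‖M.beta i‖ ^ 2)) * x i ^ 2 := by
    have : ∑ i, ((M.scaled S i i - 1) * (Mhat (corr S) jhat i i - 1) +
        (Mhat (corr S) jhat i i - ‖M.beta i‖ ^ 2)) * x i ^ 2 =
        ∑ i, M.scaled S i i * (Mhat (corr S) jhat i i - 1) * x i ^ 2 +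
          ∑ i, (1 - ‖M.beta i‖ ^ 2) * x i ^ 2 := by
      rw [← Finset.sum_add_distrib]
      exact Finset.sum_congr rfl fun i _ => by ring
    rw [e1, quad_R, this]; ring
  have h1 := h.scaled hcard
  have h2 := mul_le_mul_of_nonneg_left (M.quad_R_le x) hη
  have h3 : |∑ i, ((M.scaled S i i - 1) * (Mhat (corr S) jhat i i - 1) +
        (Mhat (corr S) jhat i i - ‖M.beta i‖ ^ 2)) * x i ^ 2| ≤
      (2 * η₂ + ε) * ∑ i, x i ^ 2 := by
    rw [Finset.mul_sum]
    refine (Finset.abs_sum_le_sum_abs _ _).trans (Finset.sum_le_sum fun i _ => ?_)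
    by_cases hi : x i = 0
    · simp [hi]
    rw [abs_mul, abs_of_nonneg (sq_nonneg (x i))]
    refine mul_le_mul_of_nonneg_right ?_ (sq_nonneg _)
    have hm := hM i (hx i hi)
    have hw := hW i i
    rw [R_self] at hw
    refine (abs_add_le _ _).trans (add_le_add ?_ hm)
    rw [abs_mul, mul_comm]
    refine mul_le_mul ?_ hw (abs_nonneg _) (by norm_num)
    have hb := pow_le_one₀ (norm_nonneg (M.beta i)) (M.norm_beta_le_one i) (n := 2)
    have hb' := sq_nonneg ‖M.beta i‖
    have := abs_le.1 hm
    rw [abs_le]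
    constructor <;> linarith
  have h4 : 0 ≤ (2 * η₂ + ε) * ‖∑ i, x i • M.beta i‖ ^ 2 := by
    by_cases hi : ∃ i, x i ≠ 0
    · obtain ⟨i, hi⟩ := hi
      have := (abs_nonneg _).trans (hM i (hx i hi))
      have := (abs_nonneg _).trans (hW i i)
      positivity
    · push Not at hi
      simp [hi]
  rw [e2]
  refine (abs_add_le _ _).trans ?_
  rw [add_mul, mul_add (2 * η₂ + ε)]
  linarith

end FactorModel

/-! ### Schur complements as minima of quadratic forms -/

theorem pinv_eq_nonsing_inv {ι : Type*} [Fintype ι] [DecidableEq ι] {Q : Matrix ι ι ℝ}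
    (hQ : IsUnit Q.det) : pinv Q = Q⁻¹ := by
  have h : IsMoorePenrose Q Q⁻¹ := by
    refine ⟨?_, ?_, ?_, ?_⟩ <;> simp [Matrix.mul_nonsing_inv Q hQ, Matrix.nonsing_inv_mul Q hQ]
  have hex : ∃ N, IsMoorePenrose Q N := ⟨_, h⟩
  rw [pinv, dif_pos hex]
  exact hex.choose_spec.unique h

/-- Completing the square. -/
theorem quad_sub_two_mul {ι : Type*} [Fintype ι] [DecidableEq ι] {Q : Matrix ι ι ℝ}
    (hsymm : Qᵀ = Q) (hQ : IsUnit Q.det) (b u : ι → ℝ) :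
    quad Q u - 2 * (u ⬝ᵥ b) = quad Q (u - Q⁻¹ *ᵥ b) - b ⬝ᵥ (Q⁻¹ *ᵥ b) := by
  have h1 : Q *ᵥ (Q⁻¹ *ᵥ b) = b := by
    rw [Matrix.mulVec_mulVec, Matrix.mul_nonsing_inv Q hQ, Matrix.one_mulVec]
  have h2 : (Q⁻¹ *ᵥ b) ⬝ᵥ (Q *ᵥ u) = u ⬝ᵥ b := by
    rw [Matrix.dotProduct_mulVec, ← Matrix.mulVec_transpose, hsymm, h1, dotProduct_comm]
  simp only [quad, Matrix.mulVec_sub, sub_dotProduct, dotProduct_sub, h1, h2]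
  rw [dotProduct_comm b]
  ring

theorem quad_single_sub {p : ℕ} {Θ : Matrix (Fin p) (Fin p) ℝ} (hΘ : ∀ i j, Θ i j = Θ j i)
    {S : Finset (Fin p)} (j : Fin p) {v : Fin p → ℝ} (hv : ∀ i, v i ≠ 0 → i ∈ S) :
    quad Θ (Pi.single j 1 - v) = Θ j j +
      (quad (Θ.submatrix (Subtype.val : {s // s ∈ S} → Fin p) Subtype.val) (fun s => v s) -
        2 * ((fun s : {s // s ∈ S} => v s) ⬝ᵥ fun s => Θ s j)) := by
  have hsum : ∀ f : Fin p → ℝ, ∑ i, v i * f i = ∑ s : {s // s ∈ S}, v s * f s := by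
    intro f
    rw [Finset.sum_coe_sort S fun i => v i * f i]
    refine (Finset.sum_subset (Finset.subset_univ S) fun i _ hi => ?_).symm
    rw [not_imp_comm.1 (hv i) hi, zero_mul]
  have h1 : quad Θ v =
      quad (Θ.submatrix (Subtype.val : {s // s ∈ S} → Fin p) Subtype.val) (fun s => v s) := by
    simp only [quad, dotProduct, Matrix.mulVec, Matrix.submatrix_apply]
    rw [hsum]
    refine Finset.sum_congr rfl fun s _ => ?_
    congr 1
    simp_rw [mul_comm (Θ _ _)]
    exact hsum _
  have h2 : v ⬝ᵥ (Θ *ᵥ Pi.single j 1) = (fun s : {s // s ∈ S} => v s) ⬝ᵥ fun s => Θ s j := by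
    simp only [Matrix.mulVec_single, MulOpposite.op_one, one_smul]
    exact hsum _
  have h3 : Pi.single j 1 ⬝ᵥ (Θ *ᵥ v) = v ⬝ᵥ (Θ *ᵥ Pi.single j 1) := by
    rw [Matrix.dotProduct_mulVec, ← Matrix.mulVec_transpose, dotProduct_comm]
    congr 2
    ext a b
    exact hΘ b a
  have h4 := FactorModel.quad_single Θ j
  unfold quad at h1 h4 ⊢
  rw [← h1, ← h2, Matrix.mulVec_sub, sub_dotProduct, dotProduct_sub, dotProduct_sub, h3, h4]
  ring

/-- If `Θ` is positive definite on the vectors supported in `S`, the Schur complement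
`Θ_{jj|S}` is the minimum of the quadratic form of `Θ` over `e_j - v`, `v` supported in `S`. -/
theorem schurDiag_isLeast {p : ℕ} {Θ : Matrix (Fin p) (Fin p) ℝ} (hΘ : ∀ i j, Θ i j = Θ j i)
    {S : Finset (Fin p)} (hpos : ∀ v : Fin p → ℝ, (∀ i, v i ≠ 0 → i ∈ S) → v ≠ 0 → 0 < quad Θ v)
    (j : Fin p) :
    IsLeast {t | ∃ v : Fin p → ℝ, (∀ i, v i ≠ 0 → i ∈ S) ∧ t = quad Θ (Pi.single j 1 - v)}
      (schurDiag Θ S j) := by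
  classical
  set Q := Θ.submatrix (Subtype.val : {s // s ∈ S} → Fin p) Subtype.val with hQ
  have hsymm : Qᵀ = Q := by
    ext a b
    exact hΘ _ _
  set ext : ({s // s ∈ S} → ℝ) → Fin p → ℝ := fun u i => if h : i ∈ S then u ⟨i, h⟩ else 0
    with hext
  have hext_supp : ∀ u i, ext u i ≠ 0 → i ∈ S := by
    intro u i h
    by_contra hi
    simp [hext, hi] at h
  have hext_val : ∀ u, (fun s : {s // s ∈ S} => ext u s) = u := by
    intro u
    funext s
    simp [hext, s.2]
  have hquad : ∀ u, quad Θ (ext u) = quad Q u := by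
    intro u
    conv_rhs => rw [← hext_val u]
    simp only [quad, dotProduct, Matrix.mulVec, hQ, Matrix.submatrix_apply]
    rw [Finset.sum_coe_sort S fun i => ext u i * ∑ s : {s // s ∈ S}, Θ i s * ext u s]
    symm
    have : ∀ i, ∑ s : {s // s ∈ S}, Θ i s * ext u s = ∑ k, Θ i k * ext u k := by
      intro i
      rw [Finset.sum_coe_sort S fun k => Θ i k * ext u k]
      refine Finset.sum_subset (Finset.subset_univ S) fun k _ hk => ?_
      rw [not_imp_comm.1 (hext_supp u k) hk, mul_zero]
    simp_rw [this]
    refine Finset.sum_subset (Finset.subset_univ S) fun k _ hk => ?_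
    rw [not_imp_comm.1 (hext_supp u k) hk, zero_mul]
  have hQpos : ∀ u, u ≠ 0 → 0 < quad Q u := by
    intro u hu
    rw [← hquad]
    refine hpos _ (hext_supp u) fun h0 => hu ?_
    rw [← hext_val u, h0]
    rfl
  have hdet : IsUnit Q.det := by
    rw [isUnit_iff_ne_zero]
    intro h0
    obtain ⟨u, hu, hu0⟩ := Matrix.exists_mulVec_eq_zero_iff.2 h0
    have := hQpos u hu
    rw [quad, hu0, dotProduct_zero] at this
    exact lt_irrefl _ this
  set b : {s // s ∈ S} → ℝ := fun s => Θ s j with hb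
  have hschur : schurDiag Θ S j = Θ j j - b ⬝ᵥ (Q⁻¹ *ᵥ b) := by
    have : (fun s : {s // s ∈ S} => Θ j s) = b := funext fun s => hΘ _ _
    rw [schurDiag, this, ← hQ, pinv_eq_nonsing_inv hdet]
  constructor
  · refine ⟨ext (Q⁻¹ *ᵥ b), hext_supp _, ?_⟩
    rw [quad_single_sub hΘ j (hext_supp _), hext_val, ← hQ, quad_sub_two_mul hsymm hdet, hschur,
      sub_self]
    simp [quad]
    ring
  · rintro t ⟨v, hv, rfl⟩
    rw [quad_single_sub hΘ j hv, ← hQ, quad_sub_two_mul hsymm hdet, hschur]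
    have : 0 ≤ quad Q ((fun s : {s // s ∈ S} => v s) - Q⁻¹ *ᵥ b) := by
      by_cases h0 : (fun s : {s // s ∈ S} => v s) - Q⁻¹ *ᵥ b = 0
      · rw [h0]; simp [quad]
      · exact (hQpos _ h0).le
    linarith

/-- The residual map of the orthogonal projection onto a subspace. -/
theorem exists_residual {E : Type*} [NormedAddCommGroup E] [InnerProductSpace ℝ E]
    [FiniteDimensional ℝ E] (U : Submodule ℝ E) :
    ∃ T : E →ₗ[ℝ] E, (∀ u ∈ U, T u = 0) ∧ (∀ x, x - T x ∈ U) ∧ (∀ x, ‖T x‖ ≤ ‖x‖) ∧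
      ∀ x, ‖x - T x‖ ≤ ‖x‖ := by
  have h : ∀ x, x - Uᗮ.starProjection x = U.starProjection x := fun x => by
    rw [Submodule.starProjection_orthogonal_val, sub_sub_cancel]
  refine ⟨(Uᗮ.starProjection : E →L[ℝ] E), fun u hu => ?_, fun x => ?_, fun x => ?_, fun x => ?_⟩
  · change Uᗮ.starProjection u = 0
    rw [Submodule.starProjection_orthogonal_val, Submodule.starProjection_eq_self_iff.2 hu,
      sub_self]
  · change x - Uᗮ.starProjection x ∈ U
    rw [h]; exact Submodule.starProjection_apply_mem _ _
  · exact Submodule.norm_starProjection_apply_le _ _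
  · change ‖x - Uᗮ.starProjection x‖ ≤ _
    rw [h]; exact Submodule.norm_starProjection_apply_le _ _

namespace FactorModel

variable {p K : ℕ} {Ω : Type*} [MeasurableSpace Ω] {P : Measure Ω} [IsProbabilityMeasure P]

theorem quad_eq_quad_scaled (M : FactorModel p K P) (Θ : Matrix (Fin p) (Fin p) ℝ) (j : Fin p)
    (v : Fin p → ℝ) :
    quad Θ (Pi.single j 1 - v) =
      M.sd j ^ 2 * quad (M.scaled Θ) (Pi.single j 1 - fun i => M.sd i / M.sd j * v i) := by
  have hj := (M.sd_pos j).ne'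
  rw [quad_scaled, ← quad_smul]
  congr 1
  funext i
  have hi := (M.sd_pos i).ne'
  simp only [Pi.sub_apply, Pi.smul_apply, smul_eq_mul]
  by_cases hij : i = j
  · subst hij
    simp
    field_simp
  · simp [hij]
    field_simp

/-- The Schur complement of the estimate approximates the squared norm of the residual of
`Σ_k A_jk ζ_k` after projection onto the span of the `β_i`, `i ∈ S`. -/
theorem FormApprox.abs_schurDiag_sub_le {M : FactorModel p K P} {Θ : Matrix (Fin p) (Fin p) ℝ}
    {Hset S : Finset (Fin p)} {s : ℕ} {ω c : ℝ} (h : M.FormApprox Θ Hset s ω) (hω : 0 ≤ ω)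
    (hc : 0 < c) (hωc : ω * (1 + 4 / c ^ 2) ≤ 1) (hΘ : ∀ i j, Θ i j = Θ j i)
    (hS : S ⊆ Hset) (hcard : S.card + 1 ≤ s)
    (hlow : ∀ v : Fin p → ℝ, (∀ i, v i ≠ 0 → i ∈ S) →
      c ^ 2 * ∑ i, v i ^ 2 ≤ ‖∑ i, v i • M.beta i‖ ^ 2)
    {T : EuclideanSpace ℝ (Fin K) →ₗ[ℝ] EuclideanSpace ℝ (Fin K)}
    (hT0 : ∀ u ∈ Submodule.span ℝ (M.beta '' S), T u = 0)
    (hTsub : ∀ x, x - T x ∈ Submodule.span ℝ (M.beta '' S)) (hT1 : ∀ x, ‖T x‖ ≤ ‖x‖)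
    (hT2 : ∀ x, ‖x - T x‖ ≤ ‖x‖) {j : Fin p} (hj : j ∈ Hset) :
    |schurDiag Θ S j - M.sd j ^ 2 * ‖T (M.beta j)‖ ^ 2| ≤
      (3 + 8 / c ^ 2) * ω * M.sd j ^ 2 := by
  have hsd := M.sd_pos j
  -- positive definiteness on `S`
  have hform : ∀ v : Fin p → ℝ, (∀ i, v i ≠ 0 → i ∈ S) →
      |quad (M.scaled Θ) v - ‖∑ i, v i • M.beta i‖ ^ 2| ≤
        ω * (‖∑ i, v i • M.beta i‖ ^ 2 + ∑ i, v i ^ 2) := by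
    intro v hv
    refine h v (fun i hi => hS (hv i hi)) ?_
    refine (Finset.card_le_card (t := S) fun i hi => hv i (Finset.mem_filter.1 hi).2).trans ?_
    omega
  have hpos : ∀ v : Fin p → ℝ, (∀ i, v i ≠ 0 → i ∈ S) → v ≠ 0 → 0 < quad Θ v := by
    intro v hv hv0
    have e : quad Θ v = quad (M.scaled Θ) fun i => M.sd i * v i := by
      rw [quad_scaled]
      congr 1
      funext i
      rw [mul_div_cancel_left₀ _ (M.sd_pos i).ne']
    rw [e]
    set w : Fin p → ℝ := fun i => M.sd i * v i with hw
    have hwS : ∀ i, w i ≠ 0 → i ∈ S := fun i hi => hv i fun h0 => hi (by simp [hw, h0])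
    have hw0 : 0 < ∑ i, w i ^ 2 := by
      obtain ⟨i, hi⟩ := Function.ne_iff.1 hv0
      refine Finset.sum_pos' (fun _ _ => sq_nonneg _) ⟨i, Finset.mem_univ i, ?_⟩
      have := M.sd_pos i
      have : w i ≠ 0 := mul_ne_zero this.ne' hi
      positivity
    have h1 := hform w hwS
    have h2 := hlow w hwS
    set F := ‖∑ i, w i • M.beta i‖ ^ 2
    set N := ∑ i, w i ^ 2
    have h3 : ω ≤ 1 := by
      have : 0 ≤ ω * (4 / c ^ 2) := by positivity
      linarith
    have h4 : ω * (4 / c ^ 2) * c ^ 2 = 4 * ω := by field_simp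
    have h5 : ω * c ^ 2 + 4 * ω ≤ c ^ 2 := by
      have := mul_le_mul_of_nonneg_right hωc (sq_nonneg c)
      nlinarith
    have h6 : (1 - ω) * (c ^ 2 * N) ≤ (1 - ω) * F := mul_le_mul_of_nonneg_left h2 (by linarith)
    have h7 : 0 < c ^ 2 - ω * c ^ 2 - ω := by
      rcases hω.eq_or_lt with h0 | h0
      · rw [← h0]; have := pow_pos hc 2; linarith
      · linarith
    have := (abs_le.1 h1).1
    nlinarith [mul_pos h7 hw0]
  have hleast := schurDiag_isLeast hΘ hpos j
  -- the form at `e_j - v`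
  have hform' : ∀ v : Fin p → ℝ, (∀ i, v i ≠ 0 → i ∈ S) →
      |quad (M.scaled Θ) (Pi.single j 1 - v) - ‖M.beta j - ∑ i, v i • M.beta i‖ ^ 2| ≤
        ω * (‖M.beta j - ∑ i, v i • M.beta i‖ ^ 2 + (2 + 2 * ∑ i, v i ^ 2)) := by
    intro v hv
    have hsupp : ∀ i, (Pi.single j 1 - v : Fin p → ℝ) i ≠ 0 → i ∈ insert j S := by
      intro i hi
      by_contra hi'
      rw [Finset.mem_insert, not_or] at hi'
      apply hi
      have : v i = 0 := not_imp_comm.1 (hv i) hi'.2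
      simp [hi'.1, this]
    have h1 := h (Pi.single j 1 - v) (fun i hi => by
        rcases Finset.mem_insert.1 (hsupp i hi) with rfl | hi'
        · exact hj
        · exact hS hi')
      (((Finset.card_le_card (t := insert j S) fun i hi =>
        hsupp i (Finset.mem_filter.1 hi).2).trans (Finset.card_insert_le _ _)).trans hcard)
    have h2 : ∑ i, (Pi.single j 1 - v : Fin p → ℝ) i • M.beta i =
        M.beta j - ∑ i, v i • M.beta i := by
      simp [sub_smul, Finset.sum_sub_distrib, Pi.single_apply, ite_smul]
    rw [h2] at h1
    refine h1.trans (mul_le_mul_of_nonneg_left (add_le_add_right ?_ _) hω)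
    have h3 : ∑ i, (Pi.single j 1 : Fin p → ℝ) i ^ 2 = 1 := by
      simp [Pi.single_apply, ite_pow]
    have : ∑ i, (Pi.single j 1 - v : Fin p → ℝ) i ^ 2 ≤
        ∑ i, (2 * (Pi.single j 1 : Fin p → ℝ) i ^ 2 + 2 * v i ^ 2) := by
      refine Finset.sum_le_sum fun i _ => ?_
      rw [Pi.sub_apply]
      nlinarith [sq_nonneg ((Pi.single j 1 : Fin p → ℝ) i + v i)]
    rwa [Finset.sum_add_distrib, ← Finset.mul_sum, ← Finset.mul_sum, h3, mul_one] at this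
  have hmem : ∀ v : Fin p → ℝ, (∀ i, v i ≠ 0 → i ∈ S) →
      ∑ i, v i • M.beta i ∈ Submodule.span ℝ (M.beta '' S) := by
    intro v hv
    refine Submodule.sum_mem _ fun i _ => ?_
    by_cases hi : v i = 0
    · rw [hi, zero_smul]; exact Submodule.zero_mem _
    · exact Submodule.smul_mem _ _ (Submodule.subset_span ⟨i, hv i hi, rfl⟩)
  have hρ1 : ‖T (M.beta j)‖ ≤ 1 := (hT1 _).trans (M.norm_beta_le_one j)
  have hρsq : ‖T (M.beta j)‖ ^ 2 ≤ 1 := pow_le_one₀ (norm_nonneg _) hρ1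
  have e8 : (2 : ℝ) * (4 / c ^ 2) = 8 / c ^ 2 := by ring
  set ρ := ‖T (M.beta j)‖ ^ 2 with hρ
  rw [abs_le]
  constructor
  · -- lower bound, at the minimizer of the estimated form
    obtain ⟨v, hv, hval⟩ := hleast.1
    rw [M.quad_eq_quad_scaled] at hval
    set w : Fin p → ℝ := fun i => M.sd i / M.sd j * v i with hw
    have hwS : ∀ i, w i ≠ 0 → i ∈ S := fun i hi => hv i fun h0 => hi (by simp [hw, h0])
    have h1 := (abs_le.1 (hform' w hwS)).1
    have h2 := hlow w hwS
    have h3 : ρ ≤ ‖M.beta j - ∑ i, w i • M.beta i‖ ^ 2 := by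
      have : T (M.beta j) = T (M.beta j - ∑ i, w i • M.beta i) := by
        rw [map_sub, hT0 _ (hmem w hwS), sub_zero]
      rw [hρ, this]
      gcongr
      exact hT1 _
    have h4 : ‖∑ i, w i • M.beta i‖ ^ 2 ≤ 2 * ‖M.beta j - ∑ i, w i • M.beta i‖ ^ 2 + 2 := by
      have h5 := norm_sub_le (M.beta j) (M.beta j - ∑ i, w i • M.beta i)
      rw [sub_sub_cancel] at h5
      have h6 := M.norm_beta_le_one j
      have h7 := norm_nonneg (∑ i, w i • M.beta i)
      have h8 := norm_nonneg (M.beta j - ∑ i, w i • M.beta i)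
      nlinarith [sq_nonneg (‖M.beta j - ∑ i, w i • M.beta i‖ - 1)]
    set F := ‖M.beta j - ∑ i, w i • M.beta i‖ ^ 2 with hF
    have hF0 : 0 ≤ F := sq_nonneg _
    set N := ∑ i, w i ^ 2
    have h5 : N ≤ (2 * F + 2) / c ^ 2 := by
      rw [le_div_iff₀ (by positivity)]; linarith
    have h6 : ω * (F + (2 + 2 * N)) ≤ ω * (F + (2 + 2 * ((2 * F + 2) / c ^ 2))) := by gcongr
    have h7 : ω * (F + (2 + 2 * ((2 * F + 2) / c ^ 2))) =
        ω * (1 + 4 / c ^ 2) * F + ω * (2 + 4 / c ^ 2) := by ring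
    have h8 : (1 - ω * (1 + 4 / c ^ 2)) * ρ ≤ (1 - ω * (1 + 4 / c ^ 2)) * F :=
      mul_le_mul_of_nonneg_left h3 (by linarith)
    have h9 : ω * (1 + 4 / c ^ 2) * ρ ≤ ω * (1 + 4 / c ^ 2) * 1 := by gcongr
    have h10 : ρ - (3 + 8 / c ^ 2) * ω ≤ quad (M.scaled Θ) (Pi.single j 1 - w) := by
      have : (3 + 8 / c ^ 2) * ω = ω * (1 + 4 / c ^ 2) * 1 + ω * (2 + 4 / c ^ 2) := by ring
      linarith
    rw [hval]
    have := mul_le_mul_of_nonneg_left h10 (sq_nonneg (M.sd j))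
    linarith
  · -- upper bound, at the projection of `β_j`
    obtain ⟨v', hv'⟩ := (Submodule.mem_span_image_finset_iff_exists_fun' ℝ).1 (hTsub (M.beta j))
    set w : Fin p → ℝ := fun i => if i ∈ S then v' i else 0 with hw
    have hwS : ∀ i, w i ≠ 0 → i ∈ S := by
      intro i hi
      by_contra hi'
      simp [hw, hi'] at hi
    have hwsum : ∑ i, w i • M.beta i = M.beta j - T (M.beta j) := by
      rw [← hv']
      simp [hw, ite_smul, Finset.sum_ite_mem]
    have h1 := (abs_le.1 (hform' w hwS)).2
    have h2 := hlow w hwS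
    rw [hwsum, sub_sub_cancel, ← hρ] at h1
    rw [hwsum] at h2
    have h3 : ‖M.beta j - T (M.beta j)‖ ^ 2 ≤ 1 :=
      pow_le_one₀ (norm_nonneg _) ((hT2 _).trans (M.norm_beta_le_one j))
    set N := ∑ i, w i ^ 2
    have h4 : N ≤ 1 / c ^ 2 := by
      rw [le_div_iff₀ (by positivity)]; linarith
    have h5 : ω * (ρ + (2 + 2 * N)) ≤ ω * (1 + (2 + 2 * (1 / c ^ 2))) := by gcongr
    have h6 : quad (M.scaled Θ) (Pi.single j 1 - w) ≤ ρ + (3 + 8 / c ^ 2) * ω := by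
      have h7 : ω * (1 + (2 + 2 * (1 / c ^ 2))) = (3 + 2 / c ^ 2) * ω := by ring
      have h8 : (3 + 2 / c ^ 2) * ω ≤ (3 + 8 / c ^ 2) * ω := by gcongr; norm_num
      linarith
    have h7 : schurDiag Θ S j ≤ M.sd j ^ 2 * quad (M.scaled Θ) (Pi.single j 1 - w) := by
      refine hleast.2 ⟨fun i => M.sd j / M.sd i * w i, fun i hi => hwS i fun h0 => hi ?_, ?_⟩
      · simp [h0]
      · have e : (fun i => M.sd i / M.sd j * (M.sd j / M.sd i * w i)) = w := by
          funext i
          have := (M.sd_pos i).ne'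
          field_simp
        rw [M.quad_eq_quad_scaled Θ j fun i => M.sd j / M.sd i * w i, e]
    have := mul_le_mul_of_nonneg_left h6 (sq_nonneg (M.sd j))
    linarith

end FactorModel

/-! ### Pruning selects pure variables of distinct groups -/

namespace FactorModel

variable {p K : ℕ} {Ω : Type*} [MeasurableSpace Ω] {P : Measure Ω}

/-- A function that maps every pure variable to its factor. -/
def IsFactorOf (M : FactorModel p K P) (τ : Fin p → Fin K) : Prop :=
  ∀ i, M.IsPure i → i ∈ M.pureGroup (τ i)

theorem exists_isFactorOf (M : FactorModel p K P) : ∃ τ, M.IsFactorOf τ := by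
  classical
  have hK : 0 < K := M.one_le_K
  refine ⟨fun i => if h : M.IsPure i then h.choose else ⟨0, hK⟩, fun i h => ?_⟩
  simp only [dif_pos h]
  exact h.choose_spec

theorem IsFactorOf.eq {M : FactorModel p K P} {τ : Fin p → Fin K} (h : M.IsFactorOf τ) {i : Fin p}
    {k : Fin K} (hi : i ∈ M.pureGroup k) : τ i = k :=
  pureGroup_unique (h i ⟨k, hi⟩) hi

/-- A collection that consists of the groups of `r` distinct factors. -/
theorem recovers_of_injective {M : FactorModel p K P} {r : ℕ} {σ : Fin r → Fin K}
    (hσ : Function.Injective σ) {Ihat : Finset (Finset (Fin p))}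
    (h : ∀ g, g ∈ Ihat ↔ ∃ a, g = M.pureGroup (σ a)) : M.Recovers r Ihat := by
  classical
  have hr : r ≤ K := by simpa using Fintype.card_le_of_injective σ hσ
  have hK : 0 < K := M.one_le_K
  refine ⟨hr, ?_⟩
  obtain ⟨e, he⟩ := Set.MapsTo.exists_equiv_extend_of_card_eq (t := (Finset.univ : Finset (Fin K)))
    (α := Fin K) (by simp) (s := {a : Fin K | a.val < r})
    (f := fun a => if h : a.val < r then σ ⟨a, h⟩ else ⟨0, hK⟩) (by intro a _; simp) (by
      intro a ha b hb hab
      simp only [Set.mem_ofPred_eq] at ha hb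
      simp only [dif_pos ha, dif_pos hb] at hab
      exact Fin.ext (Fin.mk.inj_iff.1 (hσ hab)))
  refine ⟨e.trans (Equiv.subtypeUnivEquiv fun x => Finset.mem_univ x), ?_⟩
  have hval : ∀ a : Fin K, ∀ ha : a.val < r,
      (e.trans (Equiv.subtypeUnivEquiv fun x => Finset.mem_univ x)) a = σ ⟨a, ha⟩ := by
    intro a ha
    have := he a ha
    simp only [dif_pos ha] at this
    simpa using this
  ext g
  rw [h]
  simp only [Finset.mem_image, Finset.mem_filter, Finset.mem_univ, true_and]
  constructor
  · rintro ⟨a, rfl⟩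
    exact ⟨⟨a, a.2.trans_le hr⟩, a.2, by rw [hval _ a.2]⟩
  · rintro ⟨a, ha, rfl⟩
    exact ⟨⟨a, ha⟩, by rw [hval a ha]⟩

/-- All groups of pure variables. -/
theorem recovers_all {M : FactorModel p K P} {Ihat : Finset (Finset (Fin p))}
    (h : ∀ g, g ∈ Ihat ↔ ∃ k, g = M.pureGroup k) : M.Recovers K Ihat :=
  recovers_of_injective (σ := id) Function.injective_id h

theorem pureGroup_injective {M : FactorModel p K P} (h : M.TwoPure) :
    Function.Injective M.pureGroup := by
  intro k l hkl
  obtain ⟨i, hi, -⟩ := h k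
  exact pureGroup_unique hi (hkl ▸ hi)

theorem sum_abs_A_of_pure {M : FactorModel p K P} {k : Fin K} {i : Fin p}
    (h : i ∈ M.pureGroup k) : ∑ l, |M.A i l| = |M.A i k| := by
  rw [mem_pureGroup] at h
  refine Finset.sum_eq_single_of_mem k (Finset.mem_univ k) fun l _ hl => ?_
  rw [h.2 l hl, abs_zero]

theorem abs_A_le_xi {M : FactorModel p K P} {k : Fin K} {i : Fin p}
    (h : i ∈ M.pureGroup k) : |M.A i k| ≤ M.xi k := by
  rw [← sum_abs_A_of_pure h]
  exact le_ciSup (f := fun i : {i : Fin p // i ∈ M.pureGroup k} => ∑ l, |M.A i l|)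
    (Set.finite_range _).bddAbove ⟨i, h⟩

theorem exists_abs_A_eq_xi {M : FactorModel p K P} (h : M.TwoPure) (k : Fin K) :
    ∃ i ∈ M.pureGroup k, |M.A i k| = M.xi k := by
  obtain ⟨i₀, hi₀, -⟩ := h k
  have : Nonempty {i : Fin p // i ∈ M.pureGroup k} := ⟨⟨i₀, hi₀⟩⟩
  obtain ⟨i, hi⟩ := exists_eq_ciSup_of_finite
    (f := fun i : {i : Fin p // i ∈ M.pureGroup k} => ∑ l, |M.A i l|)
  exact ⟨i, i.2, (sum_abs_A_of_pure i.2).symm.trans hi⟩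

theorem xi_pos {M : FactorModel p K P} (h : M.TwoPure) (k : Fin K) : 0 < M.xi k := by
  obtain ⟨i, hi, -⟩ := h k
  exact (abs_pos.2 (mem_pureGroup.1 hi).1).trans_le (abs_A_le_xi hi)

theorem B_of_ne_factor {M : FactorModel p K P} {k l : Fin K} {i : Fin p}
    (h : i ∈ M.pureGroup k) (hl : l ≠ k) : M.B i l = 0 := by
  simp [B, (mem_pureGroup.1 h).2 l hl]

/-- If every selected index that follows pure variables of distinct factors is a pure variable of
a new factor, the kept groups are the groups of `r` distinct factors. -/
theorem recovers_of_selection {M : FactorModel p K P} {q : ℝ≥0∞} {δ : ℝ} {τ : Fin p → Fin K}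
    (hτ : M.IsFactorOf τ) {H : Finset (Finset (Fin p))} (hH : M.GroupSpec q δ H) {r : ℕ}
    (hr : r ≤ K) {i : Fin r → Fin p} (hi : ∀ a, i a ∈ parallelSet H)
    (hstep : ∀ (a : Fin r) (S : Finset (Fin p)),
      S = (Finset.univ.filter fun b : Fin r => b < a).image i → S ⊆ parallelSet H →
      (∀ j ∈ S, M.IsPure j) → Set.InjOn τ S → S.card < K →
      M.IsPure (i a) ∧ ∀ j ∈ S, τ j ≠ τ (i a))
    {Ihat : Finset (Finset (Fin p))} (hI : ∀ g, g ∈ Ihat ↔ g ∈ H ∧ ∃ a, i a ∈ g) :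
    M.Recovers r Ihat := by
  classical
  have hall : ∀ n (a : Fin r), a.val = n →
      M.IsPure (i a) ∧ ∀ b, b < a → τ (i b) ≠ τ (i a) := by
    intro n
    induction n using Nat.strong_induction_on with
    | _ n ih =>
      intro a ha
      have hb : ∀ b, b < a → M.IsPure (i b) ∧ ∀ b', b' < b → τ (i b') ≠ τ (i b) := fun b hb =>
        ih b.val (ha ▸ hb) b rfl
      have h := hstep a _ rfl (by
          intro j hj
          obtain ⟨b, -, rfl⟩ := Finset.mem_image.1 hj
          exact hi b) (by
          intro j hj
          obtain ⟨b, hb', rfl⟩ := Finset.mem_image.1 hj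
          exact (hb b (Finset.mem_filter.1 hb').2).1) (by
          intro j hj j' hj' hjj
          obtain ⟨b, hb1, rfl⟩ := Finset.mem_image.1 (Finset.mem_coe.1 hj)
          obtain ⟨b', hb2, rfl⟩ := Finset.mem_image.1 (Finset.mem_coe.1 hj')
          rcases lt_trichotomy b b' with h | h | h
          · exact absurd hjj ((hb b' (Finset.mem_filter.1 hb2).2).2 b h)
          · rw [h]
          · exact absurd hjj.symm ((hb b (Finset.mem_filter.1 hb1).2).2 b' h)) (by
          refine Finset.card_image_le.trans_lt ?_
          have : (Finset.univ.filter fun b : Fin r => b < a) = Finset.Iio a := by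
            ext b; simp
          rw [this, Fin.card_Iio]
          exact a.2.trans_le hr)
      exact ⟨h.1, fun b hb' => h.2 _ (Finset.mem_image.2 ⟨b, by simpa using hb', rfl⟩)⟩
  refine recovers_of_injective (σ := fun a => τ (i a)) ?_ ?_
  · intro a b hab
    rcases lt_trichotomy a b with h | h | h
    · exact absurd hab ((hall b.val b rfl).2 a h)
    · exact h
    · exact absurd hab.symm ((hall a.val a rfl).2 b h)
  · intro g
    rw [hI]
    constructor
    · rintro ⟨hg, a, ha⟩
      exact ⟨a, hH.eq_of_mem hg ha (hτ _ (hall a.val a rfl).1)⟩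
    · rintro ⟨a, rfl⟩
      exact ⟨hH.pure_mem _, a, hτ _ (hall a.val a rfl).1⟩

theorem card_groups_ge {M : FactorModel p K P} {q : ℝ≥0∞} {δ : ℝ} (htwo : M.TwoPure)
    {H : Finset (Finset (Fin p))} (hH : M.GroupSpec q δ H) : K ≤ H.card := by
  classical
  have h1 : (Finset.univ.image M.pureGroup).card = K := by
    rw [Finset.card_image_of_injective _ (pureGroup_injective htwo)]; simp
  rw [← h1]
  refine Finset.card_le_card fun g hg => ?_
  obtain ⟨k, -, rfl⟩ := Finset.mem_image.1 hg
  exact hH.pure_mem k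

theorem eq_of_card_groups_le {M : FactorModel p K P} {q : ℝ≥0∞} {δ : ℝ} (htwo : M.TwoPure)
    {H : Finset (Finset (Fin p))} (hH : M.GroupSpec q δ H) (h : H.card ≤ K) (g : Finset (Fin p)) :
    g ∈ H ↔ ∃ k, g = M.pureGroup k := by
  classical
  have h1 : (Finset.univ.image M.pureGroup).card = K := by
    rw [Finset.card_image_of_injective _ (pureGroup_injective htwo)]; simp
  have h2 : Finset.univ.image M.pureGroup = H := by
    refine Finset.eq_of_subset_of_card_le (fun g hg => ?_) (h.trans h1.ge)
    obtain ⟨k, -, rfl⟩ := Finset.mem_image.1 hg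
    exact hH.pure_mem k
  rw [← h2]
  simp [eq_comm]

/-- Without groups in `J̄₁` there are only the groups of pure variables. -/
theorem card_groups_le_of_Jbar_eq_empty {M : FactorModel p K P} {q : ℝ≥0∞} {δ : ℝ}
    {H : Finset (Finset (Fin p))} (hH : M.GroupSpec q δ H) (hJ : M.Jbar q δ = ∅) :
    H.card ≤ K := by
  classical
  have h1 : H ⊆ Finset.univ.image M.pureGroup := by
    intro g hg
    obtain ⟨i, hi⟩ := hH.nonempty g hg
    by_cases hp : M.IsPure i
    · obtain ⟨k, hk⟩ := hp
      exact Finset.mem_image.2 ⟨k, Finset.mem_univ k, (hH.eq_of_mem hg hi hk).symm⟩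
    · have := hH.mem_Jbar g hg i hi hp
      rw [hJ] at this
      simp at this
  refine (Finset.card_le_card h1).trans (Finset.card_image_le.trans ?_)
  simp

theorem sum_smul_beta (M : FactorModel p K P) (v : Fin p → ℝ) (S : Finset (Fin p)) :
    ∑ i ∈ S, v i • M.beta i = ∑ l, (∑ i ∈ S, v i * M.B i l) • M.zeta l := by
  simp only [beta, Finset.smul_sum, smul_smul, Finset.sum_smul]
  exact Finset.sum_comm

/-- Pure variables of distinct factors have linearly independent vectors `β_i`, with a uniform
bound. -/
theorem Regular.sq_mul_sum_le_norm_sum_beta {M : FactorModel p K P} {q : ℝ≥0∞} {δ c C : ℝ}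
    (hreg : M.Regular q δ c C) (hc : 0 < c) {τ : Fin p → Fin K} (hτ : M.IsFactorOf τ)
    {S : Finset (Fin p)} (hpure : ∀ i ∈ S, M.IsPure i) (hinj : Set.InjOn τ S) (v : Fin p → ℝ)
    (hv : ∀ i, v i ≠ 0 → i ∈ S) :
    c ^ 2 * ∑ i, v i ^ 2 ≤ ‖∑ i, v i • M.beta i‖ ^ 2 := by
  classical
  rw [← Finset.sum_subset (Finset.subset_univ S) (fun i _ hi => by
      rw [not_imp_comm.1 (hv i) hi]; ring),
    ← Finset.sum_subset (Finset.subset_univ S) (fun i _ hi => by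
      rw [not_imp_comm.1 (hv i) hi, zero_smul]), sum_smul_beta]
  refine le_trans ?_ (hreg.le_norm_sum_zeta _)
  rw [sq c, mul_assoc]
  refine mul_le_mul_of_nonneg_left ?_ hc.le
  have h1 : ∑ l ∈ S.image τ, (∑ i ∈ S, v i * M.B i l) ^ 2 ≤
      ∑ l, (∑ i ∈ S, v i * M.B i l) ^ 2 :=
    Finset.sum_le_sum_of_subset_of_nonneg (Finset.subset_univ _) fun _ _ _ => sq_nonneg _
  refine le_trans ?_ h1
  rw [Finset.sum_image hinj, Finset.mul_sum]
  refine Finset.sum_le_sum fun i hi => ?_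
  have h2 : ∑ j ∈ S, v j * M.B j (τ i) = v i * M.B i (τ i) := by
    refine Finset.sum_eq_single_of_mem i hi fun j hj hji => ?_
    rw [B_of_ne_factor (hτ j (hpure j hj)) (fun h => hji (hinj hj hi h.symm)), mul_zero]
  rw [h2, mul_pow, mul_comm]
  exact mul_le_mul_of_nonneg_left (hreg.lt_B_sq_of_pure (hτ i (hpure i hi))).le (sq_nonneg _)

variable [IsProbabilityMeasure P]

/-- As `‖B_i‖² = ‖A_i‖² / Σ_ii` is bounded below, a bound on the row of `A` is one on the variance.
-/
theorem Sigma_self_mul_le {M : FactorModel p K P} {q : ℝ≥0∞} {δ c C X : ℝ}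
    (hreg : M.Regular q δ c C) {j : Fin p} (hj : M.IsActive q δ j)
    (hX : ∑ k, M.A j k ^ 2 ≤ X) : c * M.sd j ^ 2 ≤ X := by
  have h1 := hreg.1 j hj
  have h2 : ∑ k, M.B j k ^ 2 = (∑ k, M.A j k ^ 2) / M.sd j ^ 2 := by
    rw [Finset.sum_div]
    refine Finset.sum_congr rfl fun k _ => ?_
    simp only [B, sd, Matrix.of_apply, div_pow]
  have h3 := M.sd_pos j
  rw [h2, lt_div_iff₀ (by positivity)] at h1
  linarith

/-- One step of pruning: if pure variables of distinct factors have been selected, and not all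
factors are represented yet, the next selected index is a pure variable of a new factor. With `T`
the residual map of the selected directions and `m = max_k ξ_k ‖T ζ_k‖`, the row of a pure variable
of the best factor reaches `m²`, while rows in `J̄₁` stay below `(1 - ε) m²` by the triangle
inequality, and those of factors already represented vanish. -/
theorem IsFactorOf.maximizer_isPure {M : FactorModel p K P} {q : ℝ≥0∞} {δ c C C₀ ε ω : ℝ}
    {τ : Fin p → Fin K} (hτ : M.IsFactorOf τ) (htwo : M.TwoPure) (hreg : M.Regular q δ c C)
    (hc : 0 < c) (hratio : M.ScaleRatio C₀) (hC₀ : 0 < C₀)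
    (hnon : M.ScaleNonPure q δ ε) (hε : 0 < ε) (hε1 : ε < 1)
    {H : Finset (Finset (Fin p))} (hH : M.GroupSpec q δ H) {Θ : Matrix (Fin p) (Fin p) ℝ}
    (hΘ : ∀ i j, Θ i j = Θ j i) (hform : M.FormApprox Θ (parallelSet H) K ω) (hω : 0 ≤ ω)
    (hω1 : ω * (1 + 4 / c ^ 2) ≤ 1) (hω2 : 2 * ((3 + 8 / c ^ 2) * ω / c) < ε * (c / C₀ ^ 2))
    {S : Finset (Fin p)} (hS : S ⊆ parallelSet H) (hpure : ∀ i ∈ S, M.IsPure i)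
    (hinj : Set.InjOn τ S) (hcard : S.card < K) {j : Fin p} (hj : j ∈ parallelSet H)
    (hmax : ∀ i ∈ parallelSet H, schurDiag Θ S i ≤ schurDiag Θ S j) :
    M.IsPure j ∧ ∀ i ∈ S, τ i ≠ τ j := by
  classical
  have hlow : ∀ v : Fin p → ℝ, (∀ i, v i ≠ 0 → i ∈ S) →
      c ^ 2 * ∑ i, v i ^ 2 ≤ ‖∑ i, v i • M.beta i‖ ^ 2 :=
    hreg.sq_mul_sum_le_norm_sum_beta hc hτ hpure hinj
  obtain ⟨T, hT0, hTsub, hT1, hT2⟩ := exists_residual (Submodule.span ℝ (M.beta '' S))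
  have hschur : ∀ i ∈ parallelSet H,
      |schurDiag Θ S i - M.sd i ^ 2 * ‖T (M.beta i)‖ ^ 2| ≤ (3 + 8 / c ^ 2) * ω * M.sd i ^ 2 :=
    fun i hi => hform.abs_schurDiag_sub_le hω hc hω1 hΘ hS hcard hlow hT0 hTsub hT1 hT2 hi
  have hV : ∀ i, M.sd i ^ 2 * ‖T (M.beta i)‖ ^ 2 = ‖∑ k, M.A i k • T (M.zeta k)‖ ^ 2 := by
    intro i
    have h1 := congrArg T (M.sd_smul_beta i)
    simp only [map_smul, map_sum] at h1
    rw [← h1, norm_smul, mul_pow, Real.norm_eq_abs, sq_abs]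
  -- factors that are represented in `S` have no residual, the others a large one
  have hTin : ∀ i ∈ S, T (M.zeta (τ i)) = 0 := by
    intro i hi
    refine hT0 _ ?_
    have h1 := beta_of_pure (hτ i (hpure i hi))
    have h2 : M.B i (τ i) ≠ 0 := by
      intro h0
      have := hreg.lt_B_sq_of_pure (hτ i (hpure i hi))
      rw [h0] at this
      norm_num at this
      linarith
    have h3 : M.zeta (τ i) = (M.B i (τ i))⁻¹ • M.beta i := by
      rw [h1, smul_smul, inv_mul_cancel₀ h2, one_smul]
    rw [h3]
    exact Submodule.smul_mem _ _ (Submodule.subset_span ⟨i, hi, rfl⟩)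
  have hTout : ∀ k, (∀ i ∈ S, τ i ≠ k) → c ≤ ‖T (M.zeta k)‖ ^ 2 := by
    intro k hk
    obtain ⟨v, hv⟩ := (Submodule.mem_span_image_finset_iff_exists_fun' ℝ).1 (hTsub (M.zeta k))
    rw [sum_smul_beta] at hv
    have h1 : T (M.zeta k) =
        ∑ l, ((Pi.single k 1 : Fin K → ℝ) l - ∑ i ∈ S, v i * M.B i l) • M.zeta l := by
      simp_rw [sub_smul]
      rw [Finset.sum_sub_distrib, hv]
      simp [Pi.single_apply, ite_smul]
    rw [h1]
    refine le_trans ?_ (hreg.le_norm_sum_zeta _)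
    have h2 : (1 : ℝ) ≤ ∑ l, ((Pi.single k 1 : Fin K → ℝ) l - ∑ i ∈ S, v i * M.B i l) ^ 2 := by
      refine le_trans (le_of_eq ?_) (Finset.single_le_sum
        (f := fun l => ((Pi.single k 1 : Fin K → ℝ) l - ∑ i ∈ S, v i * M.B i l) ^ 2)
        (fun _ _ => sq_nonneg _) (Finset.mem_univ k))
      have : ∑ i ∈ S, v i * M.B i k = 0 := Finset.sum_eq_zero fun i hi => by
        rw [B_of_ne_factor (hτ i (hpure i hi)) (hk i hi).symm, mul_zero]
      simp [this]
    nlinarith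
  have hK : Nonempty (Fin K) := ⟨⟨0, M.one_le_K⟩⟩
  obtain ⟨k₀, hk₀⟩ : ∃ k, ∀ i ∈ S, τ i ≠ k := by
    obtain ⟨k, hk⟩ : ∃ k, k ∉ S.image τ := by
      by_contra! hall
      have h1 := Finset.card_le_card (s := (Finset.univ : Finset (Fin K))) fun k _ => hall k
      rw [Finset.card_univ, Fintype.card_fin] at h1
      have := Finset.card_image_le (s := S) (f := τ)
      omega
    exact ⟨k, fun i hi h => hk (Finset.mem_image.2 ⟨i, hi, h⟩)⟩
  obtain ⟨k₁, hk₁⟩ := Finite.exists_max fun k => M.xi k * ‖T (M.zeta k)‖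
  obtain ⟨k₂, hk₂⟩ := Finite.exists_max M.xi
  set m := M.xi k₁ * ‖T (M.zeta k₁)‖ with hm
  set X := M.xi k₂ with hX
  have hX0 : 0 < X := xi_pos htwo k₂
  -- a factor that is not represented, with comparable scales, gives `m²` the order of `X²`
  have hm2 : c / C₀ ^ 2 * X ^ 2 ≤ m ^ 2 := by
    have h1 : X ≤ C₀ * M.xi k₀ := hratio k₂ k₀
    have h2 := xi_pos htwo k₀
    have h3 : (M.xi k₀ * ‖T (M.zeta k₀)‖) ^ 2 ≤ m ^ 2 := by
      gcongr
      exact hk₁ k₀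
    refine le_trans ?_ h3
    rw [mul_pow, div_mul_eq_mul_div, div_le_iff₀ (by positivity)]
    have h4 : X ^ 2 ≤ C₀ ^ 2 * M.xi k₀ ^ 2 := by rw [← mul_pow]; gcongr
    have h5 := hTout k₀ hk₀
    calc c * X ^ 2 ≤ ‖T (M.zeta k₀)‖ ^ 2 * (C₀ ^ 2 * M.xi k₀ ^ 2) := by gcongr
      _ = _ := by ring
  -- the variance of the active variables is at most of the order `X²`
  have hsum : ∀ j ∈ M.Jbar q δ, ∑ k, |M.A j k| / M.xi k ≤ 1 := by
    intro j hj
    have h1 := hnon j hj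
    refine le_of_sq_le_sq (b := 1) ?_ zero_le_one
    linarith
  have hsd : ∀ i ∈ parallelSet H, M.sd i ^ 2 ≤ X ^ 2 / c := by
    intro i hi
    rw [le_div_iff₀ hc, mul_comm]
    refine Sigma_self_mul_le hreg (hH.isActive hi) ?_
    rcases hH.isActive hi with ⟨k, hk⟩ | hJ
    · rw [Finset.sum_eq_single_of_mem k (Finset.mem_univ k) fun l _ hl => by
        rw [(mem_pureGroup.1 hk).2 l hl]; ring, ← sq_abs]
      have := (abs_A_le_xi hk).trans (hk₂ k)
      gcongr
    · have h1 : ∑ k, |M.A i k| ≤ X := by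
        calc ∑ k, |M.A i k| ≤ ∑ k, X * (|M.A i k| / M.xi k) := by
              refine Finset.sum_le_sum fun k _ => ?_
              have h2 := xi_pos htwo k
              rw [mul_div_assoc', le_div_iff₀ h2, mul_comm]
              exact mul_le_mul_of_nonneg_right (hk₂ k) (abs_nonneg _)
          _ = X * ∑ k, |M.A i k| / M.xi k := by rw [Finset.mul_sum]
          _ ≤ X * 1 := by gcongr; exact hsum i hJ
          _ = X := mul_one X
      calc ∑ k, M.A i k ^ 2 = ∑ k, |M.A i k| ^ 2 := by simp
        _ ≤ (∑ k, |M.A i k|) ^ 2 := Finset.sum_sq_le_sq_sum_of_nonneg fun _ _ => abs_nonneg _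
        _ ≤ X ^ 2 := by
          have : 0 ≤ ∑ k, |M.A i k| := Finset.sum_nonneg fun _ _ => abs_nonneg _
          gcongr
  have herr : ∀ i ∈ parallelSet H, (3 + 8 / c ^ 2) * ω * M.sd i ^ 2 ≤
      (3 + 8 / c ^ 2) * ω / c * X ^ 2 := by
    intro i hi
    calc _ ≤ (3 + 8 / c ^ 2) * ω * (X ^ 2 / c) := by gcongr; exact hsd i hi
      _ = _ := by ring
  obtain ⟨i₁, hi₁, hA⟩ := exists_abs_A_eq_xi htwo k₁
  have hi₁H : i₁ ∈ parallelSet H := mem_parallelSet.2 ⟨_, hH.pure_mem k₁, hi₁⟩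
  have hV₁ : M.sd i₁ ^ 2 * ‖T (M.beta i₁)‖ ^ 2 = m ^ 2 := by
    rw [hV, Finset.sum_eq_single_of_mem k₁ (Finset.mem_univ _) fun l _ hl => by
      rw [(mem_pureGroup.1 hi₁).2 l hl, zero_smul], norm_smul, Real.norm_eq_abs, hA]
  have hlarge : (1 - ε) * m ^ 2 < ‖∑ k, M.A j k • T (M.zeta k)‖ ^ 2 := by
    have h1 := (abs_le.1 (hschur i₁ hi₁H)).1
    have h2 := (abs_le.1 (hschur j hj)).2
    rw [hV₁] at h1
    rw [hV] at h2
    have h3 := hmax i₁ hi₁H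
    have h4 := herr i₁ hi₁H
    have h5 := herr j hj
    have h6 : 2 * ((3 + 8 / c ^ 2) * ω / c) * X ^ 2 < ε * m ^ 2 := by
      calc _ < ε * (c / C₀ ^ 2) * X ^ 2 := by gcongr
        _ = ε * (c / C₀ ^ 2 * X ^ 2) := by ring
        _ ≤ _ := by gcongr
    linarith
  have hm0 : 0 ≤ m ^ 2 := sq_nonneg m
  by_cases hjp : M.IsPure j
  · refine ⟨hjp, fun i hi hij => absurd hlarge (not_lt.2 ?_)⟩
    have hmem := mem_pureGroup.1 (hτ j hjp)
    rw [Finset.sum_eq_single_of_mem (τ j) (Finset.mem_univ _) fun l _ hl => by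
      rw [hmem.2 l hl, zero_smul], ← hij, hTin i hi, smul_zero, norm_zero]
    have : 0 ≤ (1 - ε) * m ^ 2 := mul_nonneg (by linarith) hm0
    linarith
  · exfalso
    have hJ : j ∈ M.Jbar q δ := (hH.isActive hj).resolve_left hjp
    refine absurd hlarge (not_lt.2 ?_)
    have h1 : ‖∑ k, M.A j k • T (M.zeta k)‖ ≤ (∑ k, |M.A j k| / M.xi k) * m := by
      rw [Finset.sum_mul]
      refine norm_sum_le_of_le _ fun k _ => ?_
      rw [norm_smul, Real.norm_eq_abs]
      have h2 := xi_pos htwo k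
      calc |M.A j k| * ‖T (M.zeta k)‖ = |M.A j k| / M.xi k * (M.xi k * ‖T (M.zeta k)‖) := by
            field_simp
        _ ≤ _ := by gcongr; exact hk₁ k
    calc _ ≤ ((∑ k, |M.A j k| / M.xi k) * m) ^ 2 := by gcongr
      _ = (∑ k, |M.A j k| / M.xi k) ^ 2 * m ^ 2 := by ring
      _ ≤ _ := by gcongr; exact (hnon j hJ).le

/-- The pruning step returns `r` groups of pure variables. The scale assumptions are not needed
if `r ≤ 1` and `J̄₁ = ∅`, or if all factors are to be returned and `J̄₁ = ∅`. -/
theorem recovers_of_isPruned {M : FactorModel p K P} {q : ℝ≥0∞} {δ c C C₀ ε ω : ℝ}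
    (htwo : M.TwoPure) (hreg : M.Regular q δ c C) (hc : 0 < c) (hC₀ : 0 < C₀) (hε : 0 < ε)
    (hε1 : ε < 1) {H : Finset (Finset (Fin p))} (hH : M.GroupSpec q δ H)
    {S : Matrix (Fin p) (Fin p) ℝ} (hS : ∀ i j, S i j = S j i) {jhat : Fin p → Fin p}
    (hform : M.FormApprox (ThetaHat S jhat) (parallelSet H) K ω) (hω : 0 ≤ ω)
    (hω1 : ω * (1 + 4 / c ^ 2) ≤ 1) (hω2 : 2 * ((3 + 8 / c ^ 2) * ω / c) < ε * (c / C₀ ^ 2))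
    (hJ : (M.Jbar q δ).Nonempty → M.ScaleRatio C₀ ∧ M.ScaleNonPure q δ ε) {r : ℕ} (hr : r ≤ K)
    (hr' : 1 < r → r < K → M.ScaleRatio C₀) {Ihat : Finset (Finset (Fin p))}
    (hI : IsPruned S jhat H r Ihat) : M.Recovers r Ihat := by
  classical
  by_cases hcard : H.card ≤ r
  · have hK : r = K := le_antisymm hr ((card_groups_ge htwo hH).trans hcard)
    subst hK
    rw [hI.2 hcard]
    exact recovers_all (eq_of_card_groups_le htwo hH hcard)
  · rw [not_le] at hcard
    obtain ⟨i, hsel, hIhat⟩ := hI.1 hcard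
    obtain ⟨τ, hτ⟩ := M.exists_isFactorOf
    refine recovers_of_selection hτ hH hr (fun a => (hsel a).1) ?_ hIhat
    rintro a S' hS' hsub hpure hinj hlt
    have hΘ : ∀ i j, ThetaHat S jhat i j = ThetaHat S jhat j i := by
      intro i j
      by_cases hij : i = j
      · rw [hij]
      · rw [ThetaHat_of_ne hij, ThetaHat_of_ne (Ne.symm hij), hS]
    have hmax : ∀ j ∈ parallelSet H, schurDiag (ThetaHat S jhat) S' j ≤
        schurDiag (ThetaHat S jhat) S' (i a) := by
      intro j hj
      have := (hsel a).2 j hj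
      rw [hS']
      convert this
    by_cases hne : (M.Jbar q δ).Nonempty
    · obtain ⟨h1, h2⟩ := hJ hne
      exact hτ.maximizer_isPure htwo hreg hc h1 hC₀ h2 hε hε1 hH hΘ hform hω hω1 hω2 hsub hpure
        hinj hlt (hsel a).1 hmax
    · rw [Finset.not_nonempty_iff_eq_empty] at hne
      have hcK := card_groups_le_of_Jbar_eq_empty hH hne
      by_cases hr1 : 1 < r
      · refine hτ.maximizer_isPure htwo hreg hc (hr' hr1 (hcard.trans_le hcK)) hC₀ (ε := ε) ?_ hε
          hε1 hH hΘ hform hω hω1 hω2 hsub hpure hinj hlt (hsel a).1 hmax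
        intro j hj
        rw [hne] at hj
        simp at hj
      · refine ⟨(hH.isActive (hsel a).1).resolve_right (by rw [hne]; simp), ?_⟩
        intro j hj
        rw [hS'] at hj
        obtain ⟨b, hb, -⟩ := Finset.mem_image.1 hj
        have h1 := (Finset.mem_filter.1 hb).2
        have h2 := a.2
        have h3 : b.val < a.val := h1
        omega

end FactorModel

/-! ### The estimated number of factors -/

namespace FactorModel

variable {p K : ℕ} {Ω : Type*} [MeasurableSpace Ω] {P : Measure Ω}

theorem card_image_rep_le {M : FactorModel p K P} {q : ℝ≥0∞} {δ : ℝ}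
    {H : Finset (Finset (Fin p))} (hH : M.GroupSpec q δ H) {rep : Finset (Fin p) → Fin p}
    (hrep : ∀ g ∈ H, rep g ∈ g) {L : Finset (Fin p)} (hL : ∀ l ∈ L, ∃ g ∈ H, rep g = l) :
    L.card ≤ K + (M.Jbar q δ).card := by
  classical
  have h1 : L ⊆ (Finset.univ.image fun k => rep (M.pureGroup k)) ∪ M.Jbar q δ := by
    intro l hl
    obtain ⟨g, hg, rfl⟩ := hL l hl
    rw [Finset.mem_union]
    by_cases hp : M.IsPure (rep g)
    · obtain ⟨k, hk⟩ := hp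
      left
      rw [hH.eq_of_mem hg (hrep g hg) hk]
      exact Finset.mem_image_of_mem _ (Finset.mem_univ k)
    · exact Or.inr (hH.mem_Jbar g hg _ (hrep g hg) hp)
  refine (Finset.card_le_card h1).trans ((Finset.card_union_le _ _).trans ?_)
  gcongr
  exact Finset.card_image_le.trans (by simp)

/-- The vector on `Fin p` that corresponds, after rescaling by the sample variances, to a vector
on the set `L` of representatives. -/
def extendScaled (M : FactorModel p K P) (S : Matrix (Fin p) (Fin p) ℝ) (L : Finset (Fin p)) :
    ({l // l ∈ L} → ℝ) →ₗ[ℝ] (Fin p → ℝ) where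
  toFun u i := (if h : i ∈ L then u ⟨i, h⟩ else 0) / √(M.scaled S i i)
  map_add' u v := by
    funext i
    by_cases h : i ∈ L <;> simp [h, add_div]
  map_smul' t u := by
    funext i
    by_cases h : i ∈ L <;> simp [h, mul_div_assoc]

theorem extendScaled_apply (M : FactorModel p K P) (S : Matrix (Fin p) (Fin p) ℝ)
    (L : Finset (Fin p)) (u : {l // l ∈ L} → ℝ) (i : Fin p) :
    M.extendScaled S L u i = (if h : i ∈ L then u ⟨i, h⟩ else 0) / √(M.scaled S i i) := rfl

theorem extendScaled_supp (M : FactorModel p K P) {S : Matrix (Fin p) (Fin p) ℝ}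
    {L : Finset (Fin p)} {u : {l // l ∈ L} → ℝ} {i : Fin p} (h : M.extendScaled S L u i ≠ 0) :
    ∃ hi : i ∈ L, u ⟨i, hi⟩ ≠ 0 := by
  rw [extendScaled_apply] at h
  by_cases hi : i ∈ L
  · refine ⟨hi, fun h0 => h ?_⟩
    simp [hi, h0]
  · simp [hi] at h

theorem sum_extendScaled_sq (M : FactorModel p K P) {S : Matrix (Fin p) (Fin p) ℝ}
    (L : Finset (Fin p)) (hW : ∀ i, 1 / 2 ≤ M.scaled S i i ∧ M.scaled S i i ≤ 2)
    (u : {l // l ∈ L} → ℝ) :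
    ∑ i, M.extendScaled S L u i ^ 2 ≤ 2 * (u ⬝ᵥ u) ∧
      u ⬝ᵥ u ≤ 2 * ∑ i, M.extendScaled S L u i ^ 2 := by
  have h1 : ∑ i, M.extendScaled S L u i ^ 2 =
      ∑ l : {l // l ∈ L}, u l ^ 2 / M.scaled S l l := by
    have h2 : ∑ i, M.extendScaled S L u i ^ 2 = ∑ i ∈ L, M.extendScaled S L u i ^ 2 := by
      refine (Finset.sum_subset (Finset.subset_univ L) fun i _ hi => ?_).symm
      rw [extendScaled_apply, dif_neg hi, zero_div]
      ring
    rw [h2, ← Finset.sum_coe_sort L]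
    refine Finset.sum_congr rfl fun l _ => ?_
    rw [extendScaled_apply, dif_pos l.2, div_pow, Real.sq_sqrt (by linarith [(hW l).1])]
  have h3 : u ⬝ᵥ u = ∑ l, u l ^ 2 := by simp [dotProduct, sq]
  rw [h1, h3, Finset.mul_sum, Finset.mul_sum]
  constructor <;> refine Finset.sum_le_sum fun l _ => ?_
  · have := (hW l).1
    rw [div_le_iff₀ (by linarith)]
    nlinarith [sq_nonneg (u l)]
  · have := (hW l).2
    rw [mul_div_assoc', le_div_iff₀ (by linarith [(hW l).1])]
    nlinarith [sq_nonneg (u l)]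

variable [IsProbabilityMeasure P]

theorem quad_Mhat_submatrix (M : FactorModel p K P) {S : Matrix (Fin p) (Fin p) ℝ}
    (hS : ∀ i, 0 < S i i) (jhat : Fin p → Fin p) (L : Finset (Fin p)) (u : {l // l ∈ L} → ℝ) :
    quad ((Mhat (corr S) jhat).submatrix (Subtype.val : {l // l ∈ L} → Fin p) Subtype.val) u =
      quad (M.scaled (ThetaHat S jhat)) (M.extendScaled S L u) := by
  have hsum : ∀ f : Fin p → ℝ, ∑ i, M.extendScaled S L u i * f i =
      ∑ l : {l // l ∈ L}, u l / √(M.scaled S l l) * f l := by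
    intro f
    have h1 : ∑ i, M.extendScaled S L u i * f i = ∑ i ∈ L, M.extendScaled S L u i * f i := by
      refine (Finset.sum_subset (Finset.subset_univ L) fun i _ hi => ?_).symm
      rw [extendScaled_apply, dif_neg hi, zero_div, zero_mul]
    rw [h1, ← Finset.sum_coe_sort L]
    refine Finset.sum_congr rfl fun l _ => ?_
    rw [extendScaled_apply, dif_pos l.2]
  rw [quad_eq_sum, quad_eq_sum]
  simp_rw [mul_assoc, ← Finset.mul_sum, hsum]
  refine Finset.sum_congr rfl fun l _ => ?_
  simp_rw [mul_comm (M.scaled (ThetaHat S jhat) _ _), hsum]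
  rw [div_mul_eq_mul_div, mul_div_assoc, Finset.sum_div]
  congr 1
  refine Finset.sum_congr rfl fun m _ => ?_
  rw [Matrix.submatrix_apply, M.Mhat_eq_scaled hS]
  ring

theorem Mhat_submatrix_isHermitian {S : Matrix (Fin p) (Fin p) ℝ} (hS : ∀ i j, S i j = S j i)
    (jhat : Fin p → Fin p) (L : Finset (Fin p)) :
    ((Mhat (corr S) jhat).submatrix (Subtype.val : {l // l ∈ L} → Fin p)
      Subtype.val).IsHermitian := by
  ext a b
  simp only [Matrix.conjTranspose_apply, Matrix.submatrix_apply, star_trivial]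
  by_cases hab : (a : Fin p) = b
  · rw [hab]
  · simp only [Mhat, Matrix.of_apply, if_neg hab, if_neg (Ne.symm hab), corr]
    rw [hS, mul_comm]

/-- The matrix on the representatives has at most `K` large eigenvalues, as the noiseless matrix
has rank at most `K`. -/
theorem Khat_le {M : FactorModel p K P} {q : ℝ≥0∞} {δ ω μ : ℝ}
    {H : Finset (Finset (Fin p))} (hH : M.GroupSpec q δ H)
    {S : Matrix (Fin p) (Fin p) ℝ} (hS : ∀ i j, S i j = S j i)
    (hW : ∀ i, 1 / 2 ≤ M.scaled S i i ∧ M.scaled S i i ≤ 2) (hSpos : ∀ i, 0 < S i i)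
    {jhat : Fin p → Fin p} {rep : Finset (Fin p) → Fin p} (hrep : ∀ g ∈ H, rep g ∈ g)
    (hform : M.FormApprox (ThetaHat S jhat) (parallelSet H) (K + (M.Jbar q δ).card) ω)
    (hω : 0 ≤ ω) (hμ : 2 * ω < μ) : Khat (corr S) H jhat rep μ ≤ K := by
  classical
  unfold Khat
  refine Finset.sup_le fun k hk => ?_
  obtain ⟨-, hk⟩ := Finset.mem_filter.1 hk
  rw [id]
  by_contra! hlt
  refine absurd hk (not_le.2 (lt_of_le_of_lt ?_ hμ))
  set L := H.image rep with hL
  have hLH : ∀ l ∈ L, ∃ g ∈ H, rep g = l := fun l hl => Finset.mem_image.1 hl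
  let F : ({l // l ∈ L} → ℝ) →ₗ[ℝ] EuclideanSpace ℝ (Fin K) :=
    (Fintype.linearCombination ℝ M.beta).comp (M.extendScaled S L)
  have hF : ∀ u, F u = ∑ i, M.extendScaled S L u i • M.beta i := fun u => by
    simp [F, Fintype.linearCombination_apply]
  convert kthEig_le_of_ker (Mhat_submatrix_isHermitian hS jhat L) (t := 2 * ω) (by positivity)
    (by rw [finrank_euclideanSpace_fin]; exact hlt) F ?_
  intro u hu
  have h1 := M.quad_Mhat_submatrix hSpos jhat L u
  have h2 := hform (M.extendScaled S L u) (fun i hi => by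
      obtain ⟨hi', -⟩ := M.extendScaled_supp hi
      obtain ⟨g, hg, rfl⟩ := hLH i hi'
      exact mem_parallelSet.2 ⟨g, hg, hrep g hg⟩)
    ((Finset.card_le_card (t := L) fun i hi =>
      (M.extendScaled_supp (Finset.mem_filter.1 hi).2).1).trans (card_image_rep_le hH hrep hLH))
  rw [hF] at hu
  rw [hu, norm_zero, ← h1] at h2
  have h3 := (M.sum_extendScaled_sq L hW u).1
  have h4 := (abs_le.1 h2).2
  have h5 := mul_le_mul_of_nonneg_left h3 hω
  unfold quad at h4
  linarith

/-- On the representatives of the groups of pure variables, the matrix is well conditioned. -/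
theorem le_Khat {M : FactorModel p K P} {q : ℝ≥0∞} {δ c C ω μ : ℝ}
    (htwo : M.TwoPure) (hreg : M.Regular q δ c C) (hc : 0 < c)
    {H : Finset (Finset (Fin p))} (hH : M.GroupSpec q δ H)
    {S : Matrix (Fin p) (Fin p) ℝ} (hS : ∀ i j, S i j = S j i)
    (hW : ∀ i, 1 / 2 ≤ M.scaled S i i ∧ M.scaled S i i ≤ 2) (hSpos : ∀ i, 0 < S i i)
    {jhat : Fin p → Fin p} {rep : Finset (Fin p) → Fin p} (hrep : ∀ g ∈ H, rep g ∈ g)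
    (hform : M.FormApprox (ThetaHat S jhat) (parallelSet H) K ω)
    (hω : 0 ≤ ω) (hω1 : ω * (1 + 4 / c ^ 2) ≤ 1 / 2) (hμ : μ ≤ c ^ 2 / 4) :
    K ≤ Khat (corr S) H jhat rep μ := by
  classical
  unfold Khat
  refine Finset.le_sup (f := id) (Finset.mem_filter.2 ⟨Finset.mem_Icc.2
    ⟨M.one_le_K, card_groups_ge htwo hH⟩, hμ.trans ?_⟩)
  set L := H.image rep with hL
  set ρ : Fin K → Fin p := fun k => rep (M.pureGroup k) with hρ
  have hρL : ∀ k, ρ k ∈ L := fun k => Finset.mem_image_of_mem _ (hH.pure_mem k)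
  have hρp : ∀ k, ρ k ∈ M.pureGroup k := fun k => hrep _ (hH.pure_mem k)
  have hρinj : Function.Injective ρ := fun k l h => pureGroup_unique (hρp k) (h ▸ hρp l)
  let T₀ : (Fin K → ℝ) →ₗ[ℝ] ({l // l ∈ L} → ℝ) :=
    { toFun := fun y l => ∑ k, if ρ k = l then y k else 0
      map_add' := fun y z => by
        funext l
        simp only [Pi.add_apply, ← Finset.sum_add_distrib]
        exact Finset.sum_congr rfl fun k _ => by split_ifs <;> simp
      map_smul' := fun t y => by
        funext l
        simp only [Pi.smul_apply, smul_eq_mul, Finset.mul_sum, RingHom.id_apply]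
        exact Finset.sum_congr rfl fun k _ => by split_ifs <;> simp }
  have hT₀ : ∀ y l, T₀ y l = ∑ k, if ρ k = (l : Fin p) then y k else 0 := fun _ _ => rfl
  have hT₀inj : Function.Injective T₀ := by
    intro y z hyz
    funext k
    have := congrFun hyz ⟨ρ k, hρL k⟩
    rw [hT₀, hT₀] at this
    simpa [hρinj.eq_iff] using this
  convert le_kthEig_of_subspace (Mhat_submatrix_isHermitian hS jhat L) M.one_le_K
    ((WithLp.linearEquiv 2 ℝ ({l // l ∈ L} → ℝ)).symm.toLinearMap.comp T₀)
    ((WithLp.linearEquiv 2 ℝ ({l // l ∈ L} → ℝ)).symm.injective.comp hT₀inj) ?_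
  intro y
  change c ^ 2 / 4 * (T₀ y ⬝ᵥ T₀ y) ≤ quad _ (T₀ y)
  rw [M.quad_Mhat_submatrix hSpos]
  have hsupp : ∀ i, M.extendScaled S L (T₀ y) i ≠ 0 → i ∈ Finset.univ.image ρ := by
    intro i hi
    obtain ⟨hi', hne⟩ := M.extendScaled_supp hi
    rw [hT₀] at hne
    obtain ⟨k, -, hk⟩ := Finset.exists_ne_zero_of_sum_ne_zero hne
    refine Finset.mem_image.2 ⟨k, Finset.mem_univ k, ?_⟩
    by_contra h0
    exact hk (if_neg h0)
  have h1 := hform (M.extendScaled S L (T₀ y)) (fun i hi => by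
      obtain ⟨k, -, rfl⟩ := Finset.mem_image.1 (hsupp i hi)
      exact mem_parallelSet.2 ⟨_, hH.pure_mem k, hρp k⟩)
    ((Finset.card_le_card (t := Finset.univ.image ρ) fun i hi =>
      hsupp i (Finset.mem_filter.1 hi).2).trans (Finset.card_image_le.trans (by simp)))
  obtain ⟨τ, hτ⟩ := M.exists_isFactorOf
  have h2 := hreg.sq_mul_sum_le_norm_sum_beta hc hτ (S := Finset.univ.image ρ) (by
      intro i hi
      obtain ⟨k, -, rfl⟩ := Finset.mem_image.1 hi
      exact ⟨k, hρp k⟩) (by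
      intro i hi j hj hij
      obtain ⟨k, -, rfl⟩ := Finset.mem_image.1 (Finset.mem_coe.1 hi)
      obtain ⟨l, -, rfl⟩ := Finset.mem_image.1 (Finset.mem_coe.1 hj)
      rw [hτ.eq (hρp k), hτ.eq (hρp l)] at hij
      rw [hij]) (M.extendScaled S L (T₀ y)) hsupp
  have h3 := (M.sum_extendScaled_sq L hW (T₀ y)).2
  set F := ‖∑ i, M.extendScaled S L (T₀ y) i • M.beta i‖ ^ 2
  set N := ∑ i, M.extendScaled S L (T₀ y) i ^ 2
  have hN : 0 ≤ N := Finset.sum_nonneg fun _ _ => sq_nonneg _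
  have h4 := (abs_le.1 h1).1
  have h5 : ω * (4 / c ^ 2) * c ^ 2 = 4 * ω := by field_simp
  have h6 : ω * c ^ 2 + 4 * ω ≤ c ^ 2 / 2 := by
    have := mul_le_mul_of_nonneg_right hω1 (sq_nonneg c)
    nlinarith
  have h7 : ω ≤ 1 := by
    have : 0 ≤ ω * (4 / c ^ 2) := by positivity
    linarith
  have h8 := mul_le_mul_of_nonneg_left h2 (sub_nonneg.2 h7)
  have h9 : c ^ 2 / 2 * N ≤ (1 - ω) * (c ^ 2 * N) - ω * N := by nlinarith
  have h10 := mul_le_mul_of_nonneg_left h3 (show 0 ≤ c ^ 2 / 4 by positivity)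
  linarith

end FactorModel

/-! ### The procedure always has an output -/

theorem exists_isPartnerMap {p : ℕ} (R : Matrix (Fin p) (Fin p) ℝ) {H : Finset (Finset (Fin p))}
    (h : ∀ g ∈ H, ∀ i ∈ g, ∃ l ∈ g, l ≠ i) : ∃ jhat, IsPartnerMap R H jhat := by
  classical
  have : ∀ i, ∃ j, i ∈ parallelSet H → ∃ g ∈ H, i ∈ g ∧ j ∈ g ∧ j ≠ i ∧
      ∀ l ∈ g, l ≠ i → score 2 R i j ≤ score 2 R i l := by
    intro i
    by_cases hi : i ∈ parallelSet H
    · obtain ⟨g, hg, hig⟩ := mem_parallelSet.1 hi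
      obtain ⟨l, hl, hli⟩ := h g hg i hig
      obtain ⟨j, hj, hmin⟩ := Finset.exists_min_image (g.erase i) (score 2 R i)
        ⟨l, Finset.mem_erase.2 ⟨hli, hl⟩⟩
      rw [Finset.mem_erase] at hj
      exact ⟨j, fun _ => ⟨g, hg, hig, hj.2, hj.1,
        fun l hl hli => hmin l (Finset.mem_erase.2 ⟨hli, hl⟩)⟩⟩
    · exact ⟨i, fun h => absurd h hi⟩
  choose jhat hj using this
  exact ⟨jhat, hj⟩

theorem exists_isRepMap {p : ℕ} (hp : 0 < p) (R : Matrix (Fin p) (Fin p) ℝ)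
    {H : Finset (Finset (Fin p))} (h : ∀ g ∈ H, g.Nonempty) : ∃ rep, IsRepMap R H rep := by
  classical
  have : ∀ g : Finset (Fin p), ∃ l, g ∈ H → l ∈ g ∧ ∀ i ∈ g,
      lqNorm 2 (rowDel R i i i) ≤ lqNorm 2 (rowDel R l l l) := by
    intro g
    by_cases hg : g ∈ H
    · obtain ⟨l, hl, hmax⟩ :=
        Finset.exists_max_image g (fun i => lqNorm 2 (rowDel R i i i)) (h g hg)
      exact ⟨l, fun _ => ⟨hl, hmax⟩⟩
    · exact ⟨⟨0, hp⟩, fun h => absurd h hg⟩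
  choose rep hrep using this
  exact ⟨rep, hrep⟩

theorem exists_isSelection {p : ℕ} (Θ : Matrix (Fin p) (Fin p) ℝ) {Hset : Finset (Fin p)}
    (h : Hset.Nonempty) (r : ℕ) : ∃ i, IsSelection Θ Hset r i := by
  classical
  have : ∀ S : Finset (Fin p), ∃ m ∈ Hset, ∀ j ∈ Hset, schurDiag Θ S j ≤ schurDiag Θ S m :=
    fun S => Finset.exists_max_image Hset (schurDiag Θ S) h
  choose m hm hmax using this
  let st : ℕ → Finset (Fin p) := fun k => Nat.rec ∅ (fun _ S => insert (m S) S) k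
  have hst : ∀ k, st k = (Finset.range k).image fun a => m (st a) := by
    intro k
    induction k with
    | zero => rfl
    | succ k ih =>
      have : st (k + 1) = insert (m (st k)) (st k) := rfl
      rw [this, Finset.range_add_one, Finset.image_insert, ← ih]
  refine ⟨fun a => m (st a), fun k => ⟨hm _, fun j hj => ?_⟩⟩
  have : ((Finset.univ.filter fun a : Fin r => a < k).image fun a : Fin r => m (st a)) = st k := by
    rw [hst k]
    ext x
    simp only [Finset.mem_image, Finset.mem_filter, Finset.mem_univ, true_and, Finset.mem_range]
    constructor
    · rintro ⟨a, ha, rfl⟩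
      exact ⟨a, ha, rfl⟩
    · rintro ⟨a, ha, rfl⟩
      exact ⟨⟨a, ha.trans k.2⟩, ha, rfl⟩
  have h2 := hmax (st k) j hj
  convert h2

theorem exists_isPruned {p : ℕ} (S : Matrix (Fin p) (Fin p) ℝ) (jhat : Fin p → Fin p)
    {H : Finset (Finset (Fin p))} (h : ∀ g ∈ H, g.Nonempty) (r : ℕ) :
    ∃ Ihat, IsPruned S jhat H r Ihat := by
  classical
  by_cases hr : r < H.card
  · obtain ⟨g, hg⟩ := Finset.card_pos.1 ((Nat.zero_le r).trans_lt hr)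
    obtain ⟨j, hj⟩ := h g hg
    obtain ⟨i, hi⟩ := exists_isSelection (ThetaHat S jhat)
      ⟨j, mem_parallelSet.2 ⟨g, hg, hj⟩⟩ r
    exact ⟨H.filter fun g => ∃ a, i a ∈ g, fun _ => ⟨i, hi, fun g => by simp⟩,
      fun h => absurd hr (not_lt.2 h)⟩
  · exact ⟨H, fun h => absurd h hr, fun _ => rfl⟩

/-! ### Correctness of the procedure on the concentration event -/

theorem sampleCov_symm {n p : ℕ} (X : Fin n → Fin p → ℝ) (i j : Fin p) :
    sampleCov X i j = sampleCov X j i := by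
  simp only [sampleCov, Matrix.smul_apply, Matrix.mul_apply, Matrix.transpose_apply]
  congr 1
  exact Finset.sum_congr rfl fun _ _ => mul_comm _ _

namespace FactorModel

/-- The consequences of a small entrywise error of the sample covariance matrix. -/
theorem exists_correct_groups {c : ℝ} (hc : 0 < c) :
    ∃ C₄ δ₀ : ℝ, 0 < C₄ ∧ 0 < δ₀ ∧ ∀ {p K : ℕ} {Ω : Type*} [MeasurableSpace Ω] {P : Measure Ω}
      [IsProbabilityMeasure P] {M : FactorModel p K P} {q : ℝ≥0∞} {C δ : ℝ}
      {S : Matrix (Fin p) (Fin p) ℝ},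
      1 ≤ q → M.TwoPure → M.Separated q δ → M.Regular q δ c C → 0 < δ → δ ≤ δ₀ →
      (∀ i j, S i j = S j i) → M.SparseClose S 2 (δ / 8) →
      M.GroupSpec q δ (parallelGroups q (corr S) δ) ∧
      (∃ jhat, IsPartnerMap (corr S) (parallelGroups q (corr S) δ) jhat) ∧
      (∃ rep, IsRepMap (corr S) (parallelGroups q (corr S) δ) rep) ∧
      (∀ i, 1 / 2 ≤ M.scaled S i i ∧ M.scaled S i i ≤ 2) ∧ (∀ i, 0 < S i i) ∧
      ∀ jhat, IsPartnerMap (corr S) (parallelGroups q (corr S) δ) jhat → ∀ s η, 0 ≤ η →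
        M.SparseClose S s η →
        M.FormApprox (ThetaHat S jhat) (parallelSet (parallelGroups q (corr S) δ)) s
          (η + C₄ * δ) := by
  obtain ⟨C₄, δ₀, hC₄, hδ₀, hmain⟩ := exists_Mhat_bound hc
  refine ⟨C₄ + 1 / 4, min δ₀ (min 1 (1 / C₄)), by positivity, by positivity, ?_⟩
  intro p K Ω _ P _ M q C δ S hq htwo hsep hreg hδ hδ' hS h2
  have hδ1 : δ ≤ 1 := hδ'.trans ((min_le_right _ _).trans (min_le_left _ _))
  have hδC : C₄ * δ ≤ 1 := by
    have := hδ'.trans ((min_le_right _ _).trans (min_le_right _ _))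
    rwa [le_div_iff₀ hC₄, mul_comm] at this
  obtain ⟨i₀, j₀, hij⟩ := htwo.exists_ne
  have hp := hreg.two_lt hc hij
  have hR : ∀ i j, |corr S i j - M.R i j| ≤ δ / 2 := fun i j =>
    (h2.abs_corr_sub_le hS (by linarith) i j).trans (by linarith)
  obtain ⟨hspec, hpart⟩ := groupSpec_parallelGroups hq hp hδ.le htwo hsep hR
  have hW : ∀ i, 1 / 2 ≤ M.scaled S i i ∧ M.scaled S i i ≤ 2 := fun i => by
    have := abs_le.1 (h2.abs_scaled_sub_le hS i i)
    rw [R_self] at this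
    constructor <;> linarith
  refine ⟨hspec, exists_isPartnerMap _ fun g hg i hi => ?_, exists_isRepMap (by omega) _
    hspec.nonempty, hW, fun i => ?_, fun jhat hjhat s η hη hs => ?_⟩
  · obtain ⟨l, hl, hli, -⟩ := hpart g hg i hi
    exact ⟨l, hl, hli⟩
  · have h1 := (hW i).1
    have h3 := M.sd_pos i
    have h4 : S i i = M.scaled S i i * (M.sd i * M.sd i) := by
      simp only [FactorModel.scaled, Matrix.of_apply]; field_simp
    rw [h4]
    have : 0 < M.scaled S i i := by linarith
    positivity
  · have h1 := hs.formApprox h2 hη (by linarith) hS hδC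
      (hmain hq hreg hδ (hδ'.trans (min_le_left _ _)) hR hspec hpart hjhat)
    have e : η + (2 * (δ / 8) + C₄ * δ) = η + (C₄ + 1 / 4) * δ := by ring
    rwa [e] at h1

/-- The deterministic core: where the sample covariance matrix is close to `Σ` on sparse vectors,
every output of the procedure is correct, whatever the number `r` and the way ties are broken. -/
theorem exists_correct_procedure {c : ℝ} (hc : 0 < c) :
    ∃ C₄ δ₀ : ℝ, 0 < C₄ ∧ 0 < δ₀ ∧ ∀ {p K n : ℕ} {Ω : Type*} [MeasurableSpace Ω] {P : Measure Ω}
      [IsProbabilityMeasure P] {M : FactorModel p K P} {q : ℝ≥0∞} {C C₀ ε δ η : ℝ}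
      {X : Fin n → Fin p → ℝ},
      1 ≤ q → 0 < C₀ → 0 < ε → ε < 1 → M.TwoPure → M.Separated q δ → M.Regular q δ c C →
      ((M.Jbar q δ).Nonempty → M.ScaleRatio C₀ ∧ M.ScaleNonPure q δ ε) →
      0 < δ → δ ≤ δ₀ → 0 ≤ η → (η + C₄ * δ) * (1 + 4 / c ^ 2) ≤ 1 / 2 →
      2 * ((3 + 8 / c ^ 2) * (η + C₄ * δ) / c) < ε * (c / C₀ ^ 2) →
      M.SparseClose (sampleCov X) 2 (δ / 8) → M.SparseClose (sampleCov X) K η →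
      (∀ r, r ≤ K → (1 < r → r < K → M.ScaleRatio C₀) →
        (∃ Ihat, IsOutput q δ X r Ihat) ∧ ∀ Ihat, IsOutput q δ X r Ihat → M.Recovers r Ihat) ∧
      ∀ μ η', 0 ≤ η' → M.SparseClose (sampleCov X) (K + (M.Jbar q δ).card) η' →
        2 * (η' + C₄ * δ) < μ → (M.Jbar q δ = ∅ → μ ≤ c ^ 2 / 4) →
        (∃ k Ihat, IsFullOutput q δ μ X k Ihat) ∧ ∀ k Ihat, IsFullOutput q δ μ X k Ihat →
          M.Recovers k Ihat ∧ (μ ≤ c ^ 2 / 4 → k = K) := by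
  obtain ⟨C₄, δ₀, hC₄, hδ₀, hmain⟩ := exists_correct_groups hc
  refine ⟨C₄, δ₀, hC₄, hδ₀, ?_⟩
  intro p K n Ω _ P _ M q C C₀ ε δ η X hq hC₀ hε hε1 htwo hsep hreg hJ hδ hδ' hη hω1 hω2 h2 hK
  have hS := sampleCov_symm X
  obtain ⟨hspec, hpartner, hrep, hW, hSpos, hform⟩ := hmain hq htwo hsep hreg hδ hδ' hS h2
  have hω : 0 ≤ η + C₄ * δ := by positivity
  have hprune : ∀ jhat, IsPartnerMap (sampleCorr X) (parallelGroups q (sampleCorr X) δ) jhat →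
      ∀ r, r ≤ K → (1 < r → r < K → M.ScaleRatio C₀) → ∀ Ihat,
        IsPruned (sampleCov X) jhat (parallelGroups q (sampleCorr X) δ) r Ihat →
        M.Recovers r Ihat := fun jhat hj r hr hr' Ihat hI =>
    recovers_of_isPruned htwo hreg hc hC₀ hε hε1 hspec hS (hform jhat hj K η hη hK) hω
      (hω1.trans (by norm_num)) hω2 hJ hr hr' hI
  constructor
  · intro r hr hr'
    constructor
    · obtain ⟨jhat, hj⟩ := hpartner
      obtain ⟨Ihat, hI⟩ := exists_isPruned (sampleCov X) jhat hspec.nonempty r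
      exact ⟨Ihat, jhat, hj, hI⟩
    · rintro Ihat ⟨jhat, hj, hI⟩
      exact hprune jhat hj r hr hr' Ihat hI
  · intro μ η' hη' hKJ hμ hμJ
    constructor
    · obtain ⟨jhat, hj⟩ := hpartner
      obtain ⟨rep, hr⟩ := hrep
      obtain ⟨Ihat, hI⟩ := exists_isPruned (sampleCov X) jhat hspec.nonempty
        (Khat (sampleCorr X) (parallelGroups q (sampleCorr X) δ) jhat rep μ)
      exact ⟨_, Ihat, jhat, rep, hj, hr, rfl, hI⟩
    · rintro k Ihat ⟨jhat, rep, hj, hr, rfl, hI⟩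
      have hle : Khat (sampleCorr X) (parallelGroups q (sampleCorr X) δ) jhat rep μ ≤ K :=
        Khat_le hspec hS hW hSpos (fun g hg => (hr g hg).1) (hform jhat hj _ η' hη' hKJ)
          (by positivity) hμ
      have heq : μ ≤ c ^ 2 / 4 →
          Khat (sampleCorr X) (parallelGroups q (sampleCorr X) δ) jhat rep μ = K := fun h =>
        le_antisymm hle (le_Khat htwo hreg hc hspec hS hW hSpos (fun g hg => (hr g hg).1)
          (hform jhat hj _ η hη hK) hω hω1 h)
      refine ⟨hprune jhat hj _ hle (fun _ hlt => ?_) Ihat hI, heq⟩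
      rcases (M.Jbar q δ).eq_empty_or_nonempty with h0 | h0
      · exact absurd (heq (hμJ h0)) hlt.ne
      · exact (hJ h0).1

end FactorModel

/-! ### Asymptotics -/

theorem delta_nonneg {cδ : ℝ} (h : 0 ≤ cδ) (p n : ℕ) : 0 ≤ delta cδ p n :=
  mul_nonneg h (Real.sqrt_nonneg _)

theorem delta_pos {cδ : ℝ} (h : 0 < cδ) (p : ℕ) {n : ℕ} (hn : 2 ≤ n) : 0 < delta cδ p n := by
  have hn' : (2 : ℝ) ≤ n := by exact_mod_cast hn
  have h1 : 0 < Real.log (max (p : ℝ) (n : ℝ)) :=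
    Real.log_pos (by have := le_max_right (p : ℝ) (n : ℝ); linarith)
  exact mul_pos h (Real.sqrt_pos.2 (div_pos h1 (by linarith)))

/-- The scale of the deviations in terms of the threshold `δ`. -/
theorem devScale_eq {cδ : ℝ} (h : 0 < cδ) (s p : ℕ) {n : ℕ} (hn : 2 ≤ n) :
    devScale s p n =
      √(s * delta cδ p n ^ 2) / cδ + s * delta cδ p n ^ 2 / cδ ^ 2 := by
  have hn' : (2 : ℝ) ≤ n := by exact_mod_cast hn
  have h1 : 0 ≤ Real.log (max (p : ℝ) (n : ℝ)) / n :=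
    div_nonneg (Real.log_nonneg (by have := le_max_right (p : ℝ) (n : ℝ); linarith))
      (by linarith)
  have h2 : delta cδ p n ^ 2 = cδ ^ 2 * (Real.log (max (p : ℝ) (n : ℝ)) / n) := by
    rw [delta, mul_pow, Real.sq_sqrt h1]
  have h3 : √(s * delta cδ p n ^ 2) = cδ * √(s * Real.log (max (p : ℝ) (n : ℝ)) / n) := by
    rw [h2, ← mul_assoc, mul_comm (s : ℝ), mul_assoc, Real.sqrt_mul (sq_nonneg _),
      Real.sqrt_sq h.le, mul_div_assoc]
  rw [h3, h2, devScale, mul_div_cancel_left₀ _ h.ne']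
  congr 1
  field_simp

namespace FactorModel

variable {p K : ℕ} {Ω : Type*} [MeasurableSpace Ω] {P : Measure Ω}

/-- Pure variables are not in `J̄₁`, and there is one for every factor. -/
theorem card_Jbar_add_le {M : FactorModel p K P} (htwo : M.TwoPure) (q : ℝ≥0∞) (δ : ℝ) :
    K + (M.Jbar q δ).card ≤ p := by
  classical
  choose i hi _ _ _ using htwo
  have hinj : Function.Injective i := fun k l h => pureGroup_unique (hi k) (h ▸ hi l)
  have h1 : (Finset.univ.image i).card = K := by
    rw [Finset.card_image_of_injective _ hinj]; simp
  have h2 : Disjoint (Finset.univ.image i) (M.Jbar q δ) := by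
    rw [Finset.disjoint_left]
    intro a ha hJ
    obtain ⟨k, -, rfl⟩ := Finset.mem_image.1 ha
    exact (Finset.mem_filter.1 hJ).2.1 ⟨k, hi k⟩
  have h3 := Finset.card_le_univ (Finset.univ.image i ∪ M.Jbar q δ)
  rw [Finset.card_union_of_disjoint h2, h1] at h3
  simpa using h3

variable [IsProbabilityMeasure P]

theorem SparseClose.mono {M : FactorModel p K P} {S : Matrix (Fin p) (Fin p) ℝ} {s : ℕ}
    {η η' : ℝ} (h : M.SparseClose S s η) (hη : η ≤ η') : M.SparseClose S s η' := by
  intro a ha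
  refine (h a ha).trans (mul_le_mul_of_nonneg_right hη ?_)
  rw [← integral_dotProduct_X_sq]
  exact integral_nonneg fun _ => sq_nonneg _

/-- The concentration inequality for the sample covariance matrix of a sub-Gaussian factor
model. -/
theorem exists_sparseClose_bound {γ : ℝ} (hγ : 0 < γ) :
    ∃ H : ℝ, 0 < H ∧ ∀ {p K n s : ℕ} {Ω Ω' : Type*} [MeasurableSpace Ω] [MeasurableSpace Ω']
      {P : Measure Ω} {P' : Measure Ω'} [IsProbabilityMeasure P] [IsProbabilityMeasure P']
      {M : FactorModel p K P'} {X : Fin n → Ω → Fin p → ℝ}, 2 ≤ n → 1 ≤ s → s ≤ p →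
      IsIIDSample P P' X M.X → M.IsSubGaussian γ →
      P {ω | ¬ M.SparseClose (sampleCov fun t => X t ω) s (H * devScale s p n)} ≤
        ENNReal.ofReal (2 / n) := by
  obtain ⟨H, hH, hmain⟩ := sparse_concentration hγ
  refine ⟨H, hH, ?_⟩
  intro p K n s Ω Ω' _ _ P P' _ _ M X hn hs hsp hX hsub
  exact hmain hn hs hsp hX M.Sigma_posDef (fun a => (hsub.dotProduct a).1)
    (fun a => (hsub.dotProduct a).2) fun a => M.integral_dotProduct_X_sq a

end FactorModel

theorem tendsto_measure_zero_of_subset {Ω : ℕ → Type*} [∀ n, MeasurableSpace (Ω n)]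
    {P : ∀ n, Measure (Ω n)} {bad E₁ E₂ E₃ : ∀ n, Set (Ω n)}
    (hbad : ∀ᶠ n in atTop, bad n ⊆ E₁ n ∪ E₂ n ∪ E₃ n)
    (hE : ∀ᶠ n : ℕ in atTop, P n (E₁ n) ≤ ENNReal.ofReal (2 / n) ∧
      P n (E₂ n) ≤ ENNReal.ofReal (2 / n) ∧ P n (E₃ n) ≤ ENNReal.ofReal (2 / n)) :
    Tendsto (fun n => P n (bad n)) atTop (𝓝 0) := by
  have h1 : Tendsto (fun n : ℕ => ENNReal.ofReal (2 / n)) atTop (𝓝 0) := by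
    have := ENNReal.tendsto_ofReal (tendsto_const_div_atTop_nhds_zero_nat (2 : ℝ))
    rwa [ENNReal.ofReal_zero] at this
  have h2 : Tendsto (fun n : ℕ => ENNReal.ofReal (2 / n) + ENNReal.ofReal (2 / n) +
      ENNReal.ofReal (2 / n)) atTop (𝓝 0) := by
    have := (h1.add h1).add h1
    simpa only [add_zero] using this
  refine tendsto_of_tendsto_of_tendsto_of_le_of_le' tendsto_const_nhds h2
    (Eventually.of_forall fun _ => zero_le) ?_
  filter_upwards [hbad, hE] with n hn hn'
  refine (measure_mono hn).trans ((measure_union_le _ _).trans ?_)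
  exact add_le_add ((measure_union_le _ _).trans (add_le_add hn'.1 hn'.2.1)) hn'.2.2

/-- The deviation on vectors with `k + m` non-zero entries is of the order of the threshold for
the number of factors. -/
theorem devScale_add_le {cδ : ℝ} (h : 0 < cδ) (k m p : ℕ) {n : ℕ} (hn : 2 ≤ n)
    (hδ : delta cδ p n ≤ 1) :
    devScale (k + m) p n ≤ (1 / cδ + 1 / cδ ^ 2) * (√(k * delta cδ p n ^ 2) +
      k * delta cδ p n ^ 2 + m * delta cδ p n) := by
  rw [devScale_eq h _ _ hn]
  have hd := delta_nonneg h.le p n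
  set d := delta cδ p n
  have h1 : √(((k + m : ℕ) : ℝ) * d ^ 2) ≤ √(k * d ^ 2) + m * d := by
    have h2 : √((m : ℝ) * d ^ 2) ≤ m * d := by
      refine (Real.sqrt_le_left (by positivity)).2 ?_
      rw [mul_pow]
      refine mul_le_mul_of_nonneg_right ?_ (sq_nonneg d)
      rcases Nat.eq_zero_or_pos m with rfl | hm
      · simp
      · have : (1 : ℝ) ≤ m := by exact_mod_cast hm
        nlinarith
    push_cast
    rw [add_mul]
    refine le_trans ?_ (add_le_add_right h2 _)
    refine (Real.sqrt_le_left (by positivity)).2 ?_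
    have h3 := Real.sq_sqrt (show 0 ≤ (k : ℝ) * d ^ 2 by positivity)
    have h4 := Real.sq_sqrt (show 0 ≤ (m : ℝ) * d ^ 2 by positivity)
    have h5 : 0 ≤ √((k : ℝ) * d ^ 2) * √((m : ℝ) * d ^ 2) := by positivity
    nlinarith
  have h3 : ((k + m : ℕ) : ℝ) * d ^ 2 ≤ k * d ^ 2 + m * d := by
    push_cast
    rw [add_mul]
    have : d ^ 2 ≤ d := by nlinarith
    gcongr
  have h4 : 0 ≤ √((k : ℝ) * d ^ 2) := Real.sqrt_nonneg _
  have h5 : 0 ≤ (k : ℝ) * d ^ 2 := by positivity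
  rw [add_mul]
  refine add_le_add ?_ ?_
  · rw [div_mul_eq_mul_div, one_mul]; gcongr; linarith
  · rw [div_mul_eq_mul_div, one_mul]; gcongr; linarith

end PureVar

end

open PureVar

theorem theorem3 :
    ∃ c₀ : ℝ → ℝ, ∀ (q : ℝ≥0∞) (γ cδ c C : ℝ),
      1 ≤ q → 0 < γ → 0 < cδ → c₀ γ ≤ cδ → 0 < c → c ≤ C →
      ∃ C₁ : ℝ, 0 < C₁ ∧
      ∀ (p K : ℕ → ℕ) (Ω' Ω : ℕ → Type*)
        [∀ n, MeasurableSpace (Ω' n)] [∀ n, MeasurableSpace (Ω n)]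
        (P' : ∀ n, Measure (Ω' n)) (P : ∀ n, Measure (Ω n))
        [∀ n, IsProbabilityMeasure (P' n)] [∀ n, IsProbabilityMeasure (P n)]
        (M : ∀ n, FactorModel (p n) (K n) (P' n))
        (X : ∀ n, Fin n → Ω n → Fin (p n) → ℝ)
        (C₀ ε : ℝ),
      0 < C₀ → 0 < ε → ε < 1 →
      (∀ n, IsIIDSample (P n) (P' n) (X n) (M n).X) →
      (∀ᶠ n in atTop, (M n).TwoPure ∧ (M n).IsSubGaussian γ ∧
        (M n).Separated q (delta cδ (p n) n) ∧ (M n).Regular q (delta cδ (p n) n) c C) →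
      Tendsto (fun n => (K n : ℝ) * delta cδ (p n) n ^ 2) atTop (𝓝 0) →
      (∀ᶠ n in atTop, ((M n).Jbar q (delta cδ (p n) n)).Nonempty →
        (M n).ScaleRatio C₀ ∧ (M n).ScaleNonPure q (delta cδ (p n) n) ε) →
      (∀ r : ∀ n, Ω n → ℕ, (∀ n ω, 1 ≤ r n ω ∧ r n ω ≤ K n) →
        (∀ᶠ n in atTop, (∃ ω, 1 < r n ω ∧ r n ω < K n) → (M n).ScaleRatio C₀) →
        Tendsto (fun n => P n {ω | ¬
          ((∃ Ihat, IsOutput q (delta cδ (p n) n) (fun t => X n t ω) (r n ω) Ihat) ∧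
            ∀ Ihat, IsOutput q (delta cδ (p n) n) (fun t => X n t ω) (r n ω) Ihat →
              (M n).Recovers (r n ω) Ihat)}) atTop (𝓝 0)) ∧
      (∀ C', C₁ ≤ C' → ∀ μ : ℕ → ℝ,
        (∀ n, μ n = C' * (√((K n : ℝ) * delta cδ (p n) n ^ 2) +
          (K n : ℝ) * delta cδ (p n) n ^ 2 +
          (((M n).Jbar q (delta cδ (p n) n)).card : ℝ) * delta cδ (p n) n)) →
        Tendsto (fun n => P n {ω | ¬
          ((∃ k Ihat, IsFullOutput q (delta cδ (p n) n) (μ n) (fun t => X n t ω) k Ihat) ∧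
            ∀ k Ihat, IsFullOutput q (delta cδ (p n) n) (μ n) (fun t => X n t ω) k Ihat →
              (M n).Recovers k Ihat)}) atTop (𝓝 0) ∧
        (Tendsto (fun n => (((M n).Jbar q (delta cδ (p n) n)).card : ℝ) * delta cδ (p n) n)
            atTop (𝓝 0) →
          Tendsto (fun n => P n {ω | ¬
            ((∃ k Ihat, IsFullOutput q (delta cδ (p n) n) (μ n) (fun t => X n t ω) k Ihat) ∧
              ∀ k Ihat, IsFullOutput q (delta cδ (p n) n) (μ n) (fun t => X n t ω) k Ihat →
                k = K n ∧ (M n).Recovers (K n) Ihat)}) atTop (𝓝 0))) := by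
  classical
  choose! H hHpos hconc using fun (γ : ℝ) (h : 0 < γ) => FactorModel.exists_sparseClose_bound h
  refine ⟨fun γ => 32 * H γ, ?_⟩
  intro q γ cδ c C hq hγ hcδ hc₀ hc hcC
  replace hc₀ : 32 * H γ ≤ cδ := hc₀
  replace hHpos := hHpos γ hγ
  replace hconc := @hconc γ hγ
  generalize H γ = H at hc₀ hHpos hconc
  obtain ⟨C₄, δ₀, hC₄, hδ₀, hproc⟩ := FactorModel.exists_correct_procedure hc
  refine ⟨2 * (H * (1 / cδ + 1 / cδ ^ 2)) + 2 * C₄ + 1, by positivity, ?_⟩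
  intro p K Ω' Ω _ _ P' P _ _ M X C₀ ε hC₀ hε hε1 hX hM hK0 hJ
  set d : ℕ → ℝ := fun n => delta cδ (p n) n with hd
  have hd0 : ∀ n, 0 ≤ d n := fun n => delta_nonneg hcδ.le _ _
  have hdpos : ∀ᶠ n in atTop, 0 < d n := by
    filter_upwards [eventually_ge_atTop 2] with n hn using delta_pos hcδ _ hn
  have hK1 : ∀ n, (1 : ℝ) ≤ K n := fun n => by exact_mod_cast (M n).one_le_K
  have hsqrt : Tendsto (fun n => √((K n : ℝ) * d n ^ 2)) atTop (𝓝 0) := by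
    have := (Real.continuous_sqrt.tendsto 0).comp hK0
    rwa [Real.sqrt_zero] at this
  have hdle : ∀ n, d n ≤ √((K n : ℝ) * d n ^ 2) := fun n => by
    refine Real.le_sqrt_of_sq_le ?_
    have := hK1 n
    nlinarith [sq_nonneg (d n)]
  have hdlim : Tendsto d atTop (𝓝 0) :=
    tendsto_of_tendsto_of_tendsto_of_le_of_le tendsto_const_nhds hsqrt hd0 hdle
  -- the error of the estimated forms on vectors with at most `K` non-zero entries
  set η : ℕ → ℝ := fun n => H * devScale (K n) (p n) n with hη
  have hηlim : Tendsto η atTop (𝓝 0) := by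
    have h1 : Tendsto (fun n => H * (√((K n : ℝ) * d n ^ 2) / cδ + (K n : ℝ) * d n ^ 2 / cδ ^ 2))
        atTop (𝓝 0) := by
      have := ((hsqrt.div_const cδ).add (hK0.div_const (cδ ^ 2))).const_mul H
      simpa using this
    refine h1.congr' ?_
    filter_upwards [eventually_ge_atTop 2] with n hn
    simp only [hη]
    rw [devScale_eq hcδ _ _ hn]
  have hdev0 : ∀ s n, 2 ≤ n → 0 ≤ H * devScale s (p n) n := fun s n hn => by
    rw [devScale_eq hcδ _ _ hn]
    positivity
  have hωlim : Tendsto (fun n => η n + C₄ * d n) atTop (𝓝 0) := by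
    have := hηlim.add (hdlim.const_mul C₄)
    simpa using this
  have hω1 : ∀ᶠ n in atTop, (η n + C₄ * d n) * (1 + 4 / c ^ 2) ≤ 1 / 2 := by
    have := hωlim.mul_const (1 + 4 / c ^ 2)
    rw [zero_mul] at this
    exact this.eventually_le_const (by norm_num)
  have hω2 : ∀ᶠ n in atTop,
      2 * ((3 + 8 / c ^ 2) * (η n + C₄ * d n) / c) < ε * (c / C₀ ^ 2) := by
    have := ((hωlim.const_mul (3 + 8 / c ^ 2)).div_const c).const_mul 2
    simp only [mul_zero, zero_div] at this
    exact this.eventually_lt_const (by positivity)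
  have hdsmall : ∀ᶠ n in atTop, d n ≤ min δ₀ (min 1 (cδ ^ 2 / (32 * H))) :=
    hdlim.eventually_le_const (by positivity)
  -- the entrywise error is a small multiple of the threshold `δ`
  have hη2 : ∀ᶠ n in atTop, H * devScale 2 (p n) n ≤ d n / 8 := by
    filter_upwards [eventually_ge_atTop 2, hdsmall] with n hn hdn
    rw [devScale_eq hcδ _ _ hn]
    change H * (√(((2 : ℕ) : ℝ) * d n ^ 2) / cδ + ((2 : ℕ) : ℝ) * d n ^ 2 / cδ ^ 2) ≤ d n / 8
    have h0 := hd0 n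
    have h1 : √(((2 : ℕ) : ℝ) * d n ^ 2) ≤ 2 * d n := by
      refine (Real.sqrt_le_left (by positivity)).2 ?_
      push_cast
      nlinarith
    have h2 : H / cδ ≤ 1 / 32 := by
      rw [div_le_iff₀ hcδ]
      linarith
    have h3 : H * d n / cδ ^ 2 ≤ 1 / 32 := by
      have h4 := hdn.trans ((min_le_right _ _).trans (min_le_right _ _))
      rw [le_div_iff₀ (by positivity)] at h4
      rw [div_le_iff₀ (by positivity)]
      linarith
    calc H * (√(((2 : ℕ) : ℝ) * d n ^ 2) / cδ + ((2 : ℕ) : ℝ) * d n ^ 2 / cδ ^ 2)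
        ≤ H * (2 * d n / cδ + 2 * d n ^ 2 / cδ ^ 2) := by gcongr; norm_num
      _ = 2 * d n * (H / cδ) + 2 * d n * (H * d n / cδ ^ 2) := by ring
      _ ≤ 2 * d n * (1 / 32) + 2 * d n * (1 / 32) := by gcongr
      _ = d n / 8 := by ring
  set m : ℕ → ℕ := fun n => ((M n).Jbar q (d n)).card with hm
  set E : ℕ → ∀ n, Set (Ω n) := fun s n =>
    {ω | ¬ (M n).SparseClose (sampleCov fun t => X n t ω) s (H * devScale s (p n) n)} with hE
  have hprob : ∀ᶠ n : ℕ in atTop, P n (E 2 n) ≤ ENNReal.ofReal (2 / n) ∧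
      P n (E (K n) n) ≤ ENNReal.ofReal (2 / n) ∧
      P n (E (K n + m n) n) ≤ ENNReal.ofReal (2 / n) := by
    filter_upwards [eventually_ge_atTop 2, hM] with n hn ⟨htwo, hsub, hsep, hreg⟩
    obtain ⟨i, j, hij⟩ := htwo.exists_ne
    have h2 := hreg.two_lt hc hij
    have h3 := FactorModel.card_Jbar_add_le htwo q (d n)
    have h4 := (M n).one_le_K
    exact ⟨hconc hn (by norm_num) h2.le (hX n) hsub,
      hconc hn h4 ((Nat.le_add_right _ _).trans h3) (hX n) hsub,
      hconc hn (h4.trans (Nat.le_add_right _ _)) h3 (hX n) hsub⟩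
  -- the deterministic analysis off the exceptional events
  have hcore : ∀ᶠ n in atTop, ∀ ω, ω ∉ E 2 n ∪ E (K n) n ∪ E (K n + m n) n →
      (∀ r, r ≤ K n → (1 < r → r < K n → (M n).ScaleRatio C₀) →
        (∃ Ihat, IsOutput q (d n) (fun t => X n t ω) r Ihat) ∧
          ∀ Ihat, IsOutput q (d n) (fun t => X n t ω) r Ihat → (M n).Recovers r Ihat) ∧
      ∀ μ, 2 * (H * devScale (K n + m n) (p n) n + C₄ * d n) < μ →
        ((M n).Jbar q (d n) = ∅ → μ ≤ c ^ 2 / 4) →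
        (∃ k Ihat, IsFullOutput q (d n) μ (fun t => X n t ω) k Ihat) ∧
          ∀ k Ihat, IsFullOutput q (d n) μ (fun t => X n t ω) k Ihat →
            (M n).Recovers k Ihat ∧ (μ ≤ c ^ 2 / 4 → k = K n) := by
    filter_upwards [eventually_ge_atTop 2, hM, hJ, hdpos, hdsmall, hω1, hω2, hη2] with
      n hn ⟨htwo, hsub, hsep, hreg⟩ hJn hdn hdn' h1 h2 h3 ω hω
    simp only [hE, Set.mem_union, Set.mem_ofPred_eq, not_or, not_not] at hω
    obtain ⟨⟨hω2, hωK⟩, hωKJ⟩ := hω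
    obtain ⟨ha, hb⟩ := hproc hq hC₀ hε hε1 htwo hsep hreg hJn hdn (hdn'.trans (min_le_left _ _))
      (hdev0 _ n hn) h1 h2 (hω2.mono h3) hωK
    exact ⟨ha, fun μ hμ hμJ => hb μ _ (hdev0 _ n hn) hωKJ hμ hμJ⟩
  constructor
  · intro r hr hratio
    refine tendsto_measure_zero_of_subset ?_ hprob
    filter_upwards [hcore, hratio] with n hn hrn ω hω
    by_contra hgood
    exact hω ((hn ω hgood).1 (r n ω) (hr n ω).2 fun h1 h2 => hrn ⟨ω, h1, h2⟩)
  · intro C' hC' μ hμ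
    have hC'0 : 0 ≤ C' := le_trans (by positivity) hC'
    -- the threshold exceeds the error on vectors with at most `K + |J̄₁|` non-zero entries
    have hμlarge : ∀ᶠ n in atTop,
        2 * (H * devScale (K n + m n) (p n) n + C₄ * d n) < μ n := by
      filter_upwards [eventually_ge_atTop 2, hdpos, hdsmall] with n hn hdn hdn'
      have h1 := devScale_add_le hcδ (K n) (m n) (p n) hn
        (hdn'.trans ((min_le_right _ _).trans (min_le_left _ _)))
      rw [hμ n]
      change _ < C' * (√((K n : ℝ) * d n ^ 2) + (K n : ℝ) * d n ^ 2 + (m n : ℝ) * d n)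
      change _ ≤ (1 / cδ + 1 / cδ ^ 2) *
        (√((K n : ℝ) * d n ^ 2) + (K n : ℝ) * d n ^ 2 + (m n : ℝ) * d n) at h1
      have h2 := hdle n
      have h3 : 0 ≤ (K n : ℝ) * d n ^ 2 := by positivity
      have h4 : 0 ≤ (m n : ℝ) * d n := by positivity
      set Y := √((K n : ℝ) * d n ^ 2) + (K n : ℝ) * d n ^ 2 + (m n : ℝ) * d n with hY
      have hYd : d n ≤ Y := by linarith
      have hY0 : 0 < Y := hdn.trans_le hYd
      calc 2 * (H * devScale (K n + m n) (p n) n + C₄ * d n)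
          ≤ 2 * (H * ((1 / cδ + 1 / cδ ^ 2) * Y) + C₄ * Y) := by gcongr
        _ < (2 * (H * (1 / cδ + 1 / cδ ^ 2)) + 2 * C₄ + 1) * Y := by linarith
        _ ≤ C' * Y := by gcongr
    have hμsmall : ∀ᶠ n in atTop, (M n).Jbar q (d n) = ∅ → μ n ≤ c ^ 2 / 4 := by
      have h1 : Tendsto (fun n => C' * (√((K n : ℝ) * d n ^ 2) + (K n : ℝ) * d n ^ 2))
          atTop (𝓝 0) := by
        have := (hsqrt.add hK0).const_mul C'
        simpa using this
      filter_upwards [h1.eventually_le_const (show 0 < c ^ 2 / 4 by positivity)] with n hn hJ0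
      rw [hμ n]
      change C' * (√((K n : ℝ) * d n ^ 2) + (K n : ℝ) * d n ^ 2 +
        (((M n).Jbar q (d n)).card : ℝ) * d n) ≤ c ^ 2 / 4
      rw [hJ0]
      simpa using hn
    constructor
    · refine tendsto_measure_zero_of_subset ?_ hprob
      filter_upwards [hcore, hμlarge, hμsmall] with n hn h1 h2 ω hω
      by_contra hgood
      obtain ⟨h3, h4⟩ := (hn ω hgood).2 (μ n) h1 h2
      exact hω ⟨h3, fun k Ihat hI => (h4 k Ihat hI).1⟩
    · intro hJ0
      have hμ0 : ∀ᶠ n in atTop, μ n ≤ c ^ 2 / 4 := by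
        have h1 : Tendsto μ atTop (𝓝 0) := by
          have := ((hsqrt.add hK0).add hJ0).const_mul C'
          simp only [add_zero, mul_zero] at this
          exact this.congr fun n => (hμ n).symm
        exact h1.eventually_le_const (by positivity)
      refine tendsto_measure_zero_of_subset ?_ hprob
      filter_upwards [hcore, hμlarge, hμ0] with n hn h1 h2 ω hω
      by_contra hgood
      obtain ⟨h3, h4⟩ := (hn ω hgood).2 (μ n) h1 fun _ => h2
      refine hω ⟨h3, fun k Ihat hI => ?_⟩
      obtain ⟨h5, h6⟩ := h4 k Ihat hI
      have hk := h6 h2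
      exact ⟨hk, hk ▸ h5⟩
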